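/- **Setting.** Let $\mathcal X$ be a measurable space with countably generated $\sigma$-algebra (for instance a subset of $\mathbb R^d$), let $\mathcal Q$ be the set of Markov transition kernels on $\mathcal X$, let $Q\in\mathcal Q$ have a stationary probability distribution $Q_0$, and let $Q_0\otimes Q$ be the law of $(X_t,X_{t+1})$. For a measure $\mu$ and $s\ge 1$ put $\|f\|_{L^{\phi_s}(\mu)}=\inf\{c>0:\int (e^{(|f|/c)^s}-1)\,d\mu\le 1\}$; $L^{\phi_s}(\mu)$ is the space of measurable $f$ with finite norm, and $E^{\phi_s}(\mu)$ the set of $f\in L^{\phi_s}(\mu)$ with $\int(e^{(|f|/c)^s}-1)\,d\mu<\infty$ for every $c>0$. Write $\|\cdot\|_{\phi_s}$ for the norm with $\mu=Q_0$ (functions of $X_t$) or $\mu=Q_0\otimes Q$ (functions of $(X_t,X_{t+1})$), and $\|\cdot\|_p$ for the $L^p(Q_0\otimes Q)$ norm. Let $\beta\in(0,1)$, $\alpha<0$, $r>1$ and $u\in E^{\phi_r}(Q_0\otimes Q)$ (Assumption U). For $\hat Q\in\mathcal Q$ let $$\mathbb T(\hat Q)f(x)=\beta\log \mathbb E^{\hat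 Q}\big[e^{f(X_{t+1})+\alpha u(X_t,X_{t+1})}\,\big|\,X_t=x\big],$$ let $v(\hat Q)$ be its fixed point in $E^{\phi_r}(Q_0)$ ($Q_0$-a.e.; $v(\hat Q)=0$, say, if there is none), let $v=v(Q)$, and let $m_v(\hat Q)(x_0,x_1)=\exp\{v(\hat Q)(x_1)+\alpha u(x_0,x_1)-\beta^{-1}v(\hat Q)(x_0)\}$. When $\hat Q(\cdot|x)$ and $Q(\cdot|x)$ are mutually absolutely continuous for every $x$, let $\ell(\hat Q)(x_0,x_1)=\log\frac{d\hat Q(\cdot|x_0)}{dQ(\cdot|x_0)}(x_1)$ and $\eta(\hat Q)(x_0,x_1)=\ell(\hat Q)(x_0,x_1)-\mathbb E^Q[\ell(\hat Q)(X_t,X_{t+1})|X_t=x_0]$. For a constant $M$, say that $\hat Q\in\mathcal Q$ satisfies **AM2** if $\hat Q(\cdot|x)$ and $Q(\cdot|x)$ are mutually absolutely continuous for every $x$ and one of the following holds: (a) $\hat\ell=\ell(\hat Q)\in E^{\phi_r}(Q_0\otimes Q)$, $\|\hat\ell\|_{\phi_r}\le M$ and $\mathbb E^{Q_0\otimes Q}\big[\exp\big(\big|\tfrac{1}{1-\beta}(\hat\ell+\alpha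 u)\big|^r\big)\big]\le M$; (b) $\hat\ell\in L^{\phi_1}(Q_0\otimes Q)$, $\hat Q$ has a stationary probability distribution $\hat Q_0$ with $Q_0\ll\hat Q_0\ll Q_0$, and there is $p>1$ such that, with $\hat\Delta=\frac{d\hat Q_0}{dQ_0}$ and $\hat\Delta_2=\frac{d(\hat Q_0\otimes\hat Q)}{d(Q_0\otimes Q)}$, the expectations $\mathbb E^{Q_0}[\hat\Delta^{p}]$, $\mathbb E^{Q_0}[\hat\Delta^{1-p}]$ and $\mathbb E^{Q_0\otimes Q}[\hat\Delta_2^{\,p}]$ are all at most $M$. **Proposition.** Let $(\Pi_n)$ be random probability measures (posteriors) on $\mathcal Q$, equipped with some $\sigma$-algebra, and let $\mathcal A_n\subseteq\mathcal Q$ be measurable sets with $\Pi_n(\mathcal A_n)=1+o_p(1)$, all of whose elements satisfy AM2 with one constant $M$ that does not depend on $n$. Let $(a_n)$ be a positive sequence with $a_n\to0$, and let $1\le s\le r$. Suppose $$\sup_{\hat Q\in\mathcal A_n}\|\eta(\hat Q)\|_{\phi_1}=o(1),\qquad \sup_{\hat Q\in\mathcal A_n}\|\mathbb T(\hat Q)v-v\|_{\phi_s}=O(a_n).$$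 Then $\mathbb T(Q)$, and $\mathbb T(\hat Q)$ for every $n$ and every $\hat Q\in\mathcal A_n$, has a fixed point in $E^{\phi_r}(Q_0)$, and this is its only fixed point in $E^{\phi_{s'}}(Q_0)$ for each $1<s'\le r$ (up to $Q_0$-null sets). Moreover, for every positive sequence $C_n\to\infty$ and every $1<p<\infty$, $$\Pi_n(\{\hat Q:\|v(\hat Q)-v(Q)\|_{\phi_1}>C_na_n\})=o_p(1),$$ $$\Pi_n(\{\hat Q:\|m_v(\hat Q)-m_v(Q)\|_{p}>C_na_n\})=o_p(1),$$ $$\Pi_n\Big(\Big\{\hat Q:\Big\|\frac{m_v(\hat Q)}{m_v(Q)}-1\Big\|_{p}>C_na_n\Big\}\Big)=o_p(1),$$ where the mass of a set that is not measurable is its outer measure. -/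

import Mathlib

open MeasureTheory ProbabilityTheory Filter Topology
open scoped ENNReal

noncomputable section

namespace RobustValue

/-! ### Exponential Orlicz classes -/

/-- The modular `∫ φ_r(|f| / c) dμ`, where `φ_r(t) = exp (t ^ r) - 1`. -/
def orliczModular {E : Type*} [MeasurableSpace E] (μ : Measure E) (r : ℝ) (f : E → ℝ) (c : ℝ) :
    ℝ≥0∞ :=
  ∫⁻ z, ENNReal.ofReal (Real.exp ((|f z| / c) ^ r) - 1) ∂μ

/-- The Luxemburg norm `‖f‖_{φ_r} = inf {c > 0 : ∫ φ_r(|f| / c) dμ ≤ 1}` of `f`, with value `∞`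
when no such `c` exists. -/
def orliczNorm {E : Type*} [MeasurableSpace E] (μ : Measure E) (r : ℝ) (f : E → ℝ) : ℝ≥0∞ :=
  ⨅ (c : ℝ) (_ : 0 < c ∧ orliczModular μ r f c ≤ 1), ENNReal.ofReal c

/-- `f` belongs to the Orlicz space `L^{φ_r}(μ)`. -/
def MemOrlicz {E : Type*} [MeasurableSpace E] (μ : Measure E) (r : ℝ) (f : E → ℝ) : Prop :=
  Measurable f ∧ orliczNorm μ r f < ∞

/-- `f` belongs to the Orlicz heart `E^{φ_r}(μ)`. -/
def MemOrliczHeart {E : Type*} [MeasurableSpace E] (μ : Measure E) (r : ℝ) (f : E → ℝ) : Prop :=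
  MemOrlicz μ r f ∧ ∀ c : ℝ, 0 < c → orliczModular μ r f c < ∞

variable {X : Type*} [MeasurableSpace X]

/-! ### The value function recursion -/

/-- The operator `𝕋(κ) f (x) = β log E^κ[exp (f(X_{t+1}) + α u(X_t, X_{t+1})) | X_t = x]`. -/
def valueOp (u : X × X → ℝ) (α β : ℝ) (κ : Kernel X X) (f : X → ℝ) : X → ℝ :=
  fun x => β * Real.log (∫ y, Real.exp (f y + α * u (x, y)) ∂(κ x))

/-- `f ∈ E^{φ_s}(Q₀)` and `f` is a fixed point of `𝕋(κ)` (as an element of that space, that is,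
`Q₀`-almost everywhere). -/
def IsValueFixedPoint (Q₀ : Measure X) (u : X × X → ℝ) (α β s : ℝ) (κ : Kernel X X)
    (f : X → ℝ) : Prop :=
  MemOrliczHeart Q₀ s f ∧ valueOp u α β κ f =ᵐ[Q₀] f

open Classical in
/-- The value function `v(κ)`: the fixed point of `𝕋(κ)` in `E^{φ_r}(Q₀)` (and `0` if there is
none). -/
def valueFunction (Q₀ : Measure X) (u : X × X → ℝ) (α β r : ℝ) (κ : Kernel X X) : X → ℝ :=
  if h : ∃ f, IsValueFixedPoint Q₀ u α β r κ f then h.choose else 0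

/-- `f` is *the* value function under `κ`: it is a fixed point of `𝕋(κ)` in `E^{φ_r}(Q₀)`, and for
every `1 < s ≤ r` it is the only one in `E^{φ_s}(Q₀)`, up to `Q₀`-null sets. -/
def IsUniqueValueFunction (Q₀ : Measure X) (u : X × X → ℝ) (α β r : ℝ) (κ : Kernel X X)
    (f : X → ℝ) : Prop :=
  IsValueFixedPoint Q₀ u α β r κ f ∧
    ∀ s : ℝ, 1 < s → s ≤ r → ∀ g : X → ℝ, IsValueFixedPoint Q₀ u α β s κ g → g =ᵐ[Q₀] f

/-- The worst-case belief distortion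
`m_v(X_t, X_{t+1}) = exp (v(X_{t+1}) + α u(X_t, X_{t+1}) - β⁻¹ v(X_t))` induced by `v`. -/
def distortion (u : X × X → ℝ) (α β : ℝ) (v : X → ℝ) : X × X → ℝ :=
  fun z => Real.exp (v z.2 + α * u z - β⁻¹ * v z.1)

/-! ### Alternative models -/

/-- The set of all Markov transition kernels on `X`. -/
abbrev MarkovKernels (X : Type*) [MeasurableSpace X] : Type _ :=
  {κ : Kernel X X // IsMarkovKernel κ}

/-- Everywhere mutual absolute continuity of two kernels. -/
def EverywhereEquivalent (Q κ : Kernel X X) : Prop :=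
  ∀ x, Q x ≪ κ x ∧ κ x ≪ Q x

section LikelihoodRatio

variable [MeasurableSpace.CountablyGenerated X]

/-- The log-likelihood ratio `ℓ(x₀, x₁) = log (dκ(· | x₀) / dQ(· | x₀)) (x₁)`
(in a jointly measurable version). -/
def logLikelihoodRatio (Q κ : Kernel X X) : X × X → ℝ :=
  fun z => Real.log (Kernel.rnDeriv κ Q z.1 z.2).toReal

/-- The score `η(x₀, x₁) = ℓ(x₀, x₁) - E^Q[ℓ(X_t, X_{t+1}) | X_t = x₀]`. -/
def score (Q κ : Kernel X X) : X × X → ℝ :=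
  fun z => logLikelihoodRatio Q κ z - ∫ y, logLikelihoodRatio Q κ (z.1, y) ∂(Q z.1)

/-- Part (a) of the regularity condition on the alternative model `κ`. -/
def TailCondition (Q₀ : Measure X) (Q : Kernel X X) (u : X × X → ℝ) (α β r M : ℝ)
    (κ : Kernel X X) : Prop :=
  MemOrliczHeart (Q₀ ⊗ₘ Q) r (logLikelihoodRatio Q κ) ∧
  orliczNorm (Q₀ ⊗ₘ Q) r (logLikelihoodRatio Q κ) ≤ ENNReal.ofReal M ∧
  ∫⁻ z, ENNReal.ofReal
      (Real.exp (|1 / (1 - β) * (logLikelihoodRatio Q κ z + α * u z)| ^ r)) ∂(Q₀ ⊗ₘ Q)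
    ≤ ENNReal.ofReal M

/-- Part (b) of the regularity condition on the alternative model `κ`: the state is stationary
under `κ`, with a stationary distribution `κ₀` that is equivalent to `Q₀`, and the densities
`dκ₀/dQ₀` and `d(κ₀ ⊗ κ)/d(Q₀ ⊗ Q)` satisfy moment bounds. -/
def StationaryCondition (Q₀ : Measure X) (Q : Kernel X X) (M : ℝ) (κ : Kernel X X) : Prop :=
  MemOrlicz (Q₀ ⊗ₘ Q) 1 (logLikelihoodRatio Q κ) ∧
  ∃ κ₀ : Measure X, IsProbabilityMeasure κ₀ ∧ Kernel.Invariant κ κ₀ ∧ Q₀ ≪ κ₀ ∧ κ₀ ≪ Q₀ ∧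
    ∃ p : ℝ, 1 < p ∧
      ∫⁻ x, (κ₀.rnDeriv Q₀ x) ^ p ∂Q₀ ≤ ENNReal.ofReal M ∧
      ∫⁻ x, (κ₀.rnDeriv Q₀ x) ^ (1 - p) ∂Q₀ ≤ ENNReal.ofReal M ∧
      ∫⁻ z, ((κ₀ ⊗ₘ κ).rnDeriv (Q₀ ⊗ₘ Q) z) ^ p ∂(Q₀ ⊗ₘ Q) ≤ ENNReal.ofReal M

/-- The uniform regularity condition AM2, with constant `M`, on the alternative model `κ`. -/
def SatisfiesAM2 (Q₀ : Measure X) (Q : Kernel X X) (u : X × X → ℝ) (α β r M : ℝ)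
    (κ : Kernel X X) : Prop :=
  EverywhereEquivalent Q κ ∧
    (TailCondition Q₀ Q u α β r M κ ∨ StationaryCondition Q₀ Q M κ)

end LikelihoodRatio

end RobustValue

end

namespace RobustValue

/-! ### Log-integrals of exponentials under one probability measure -/

section OneMeasure

variable {E : Type*} [MeasurableSpace E] {ν : Measure E}

/-! A change of measure from `κ` to `Q` turns the value recursion into an entropic recursion `f ↦ β
log E^Q[exp (f + h)]` with payoff `h = α u + ℓ`, where `ℓ` is the log-likelihood ratio. This
operator is monotone and convex. Jensen and Hölder give the moment bound `E exp (k|Tf|) ≤ (E exp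
(k|f|)) ^ β * H ^ (1 - β)` for `k * β ≥ 1`, with `H` an exponential moment of `h`; in `n` iterations
the starting point enters only through the power `β ^ n`.

Existence and uniqueness (`exists_fixedPoint`, `le_ae_of_fixedPoints`). Convexity bounds `T^n f -
T^n g` by `θ (T^n w - T^n g)`, where `w = g + (f - g) / θ`. For functions in the heart with exponent
`s > 1`, the cost of the dilation is cancelled by the power `β ^ n` when `θ = β ^ (n (s - 1) / s)`.
Hence iterates merge geometrically in `L¹`. In case (b) of AM2 the argument is run for `κ` with its
own stationary law, and Hölder bounds on the densities identify the function classes.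

Stability (`exists_orliczNorm_fixedPoint_sub_le`). The gradient inequality for `log E exp` yields
`(w - v)⁺ ≤ |d| + β E^Q[m (w - v)⁺ | X_t]`, where `d = T v - v` and `m` is a normalized tilt
density, and symmetrically for `v - w`. Unrolled `N` times, each iterate of the weighted expectation
is bounded in the `φ_1` norm by `4 * b`, where `exp b` bounds the `2N`-th moment of `m`. Because `r
> 1`, `b` can be taken polynomial in `N`, so `β ^ N * 4 * b ≤ 1 / 2` for some `N` and the remainder
is absorbed. Only one exponential moment of `ℓ`, of an order fixed in advance, has to be bounded
uniformly.

That moment comes from the score (`expMoment_logLikelihoodRatio_le_two`): since `E^Q[exp ℓ | X_t] =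
1`, the conditional mean of `ℓ` is `-log E^Q[exp η | X_t]`, which is controlled by `η`. So `‖v(κ) -
v‖ = O(a n)` in `φ_1`, uniformly on `A n`. The ratio of distortions is the exponential of a shift
difference of `v(κ) - v`, so its `L^p` distance to one has the same order. The events in question
eventually miss `A n`, and their posterior mass vanishes. -/

theorem ofReal_integral_le_lintegral {f : E → ℝ} (hf : Integrable f ν) :
    ENNReal.ofReal (∫ y, f y ∂ν) ≤ ∫⁻ y, ENNReal.ofReal (f y) ∂ν := by
  calc ENNReal.ofReal (∫ y, f y ∂ν) ≤ ENNReal.ofReal (∫ y, max (f y) 0 ∂ν) :=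
        ENNReal.ofReal_le_ofReal (integral_mono hf hf.pos_part fun y => le_max_left _ _)
    _ = ∫⁻ y, ENNReal.ofReal (max (f y) 0) ∂ν :=
        ofReal_integral_eq_lintegral_ofReal hf.pos_part (ae_of_all _ fun y => le_max_right _ _)
    _ = ∫⁻ y, ENNReal.ofReal (f y) ∂ν := by simp

theorem ofReal_exp_ne_zero (t : ℝ) : ENNReal.ofReal (Real.exp t) ≠ 0 := by
  simp [Real.exp_pos]

theorem one_le_ofReal_exp {t : ℝ} (ht : 0 ≤ t) : 1 ≤ ENNReal.ofReal (Real.exp t) := by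
  rw [← ENNReal.ofReal_one]
  exact ENNReal.ofReal_le_ofReal (Real.one_le_exp ht)

theorem ofReal_exp_mono {a b : ℝ} (h : a ≤ b) :
    ENNReal.ofReal (Real.exp a) ≤ ENNReal.ofReal (Real.exp b) :=
  ENNReal.ofReal_le_ofReal (Real.exp_le_exp.2 h)

theorem ofReal_exp_add (a b : ℝ) : ENNReal.ofReal (Real.exp (a + b))
    = ENNReal.ofReal (Real.exp a) * ENNReal.ofReal (Real.exp b) := by
  rw [Real.exp_add, ENNReal.ofReal_mul (Real.exp_pos _).le]

theorem ofReal_exp_rpow (a c : ℝ) :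
    ENNReal.ofReal (Real.exp a) ^ c = ENNReal.ofReal (Real.exp (a * c)) := by
  rw [ENNReal.ofReal_rpow_of_pos (Real.exp_pos _), Real.exp_mul]

theorem one_le_lintegral_of_one_le [IsProbabilityMeasure ν] {F : E → ℝ≥0∞} (h : ∀ y, 1 ≤ F y) :
    1 ≤ ∫⁻ y, F y ∂ν := by
  calc (1 : ℝ≥0∞) = ∫⁻ _, 1 ∂ν := by simp
    _ ≤ _ := lintegral_mono h

/-- Tangent line of the convex map `t ↦ t ^ s` at `L`, from Bernoulli's inequality after scaling by
`L`. -/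
theorem rpow_tangent_le {s L t : ℝ} (hs : 1 ≤ s) (hL : 0 ≤ L) (ht : 0 ≤ t) :
    L ^ s + s * L ^ (s - 1) * (t - L) ≤ t ^ s := by
  rcases hL.eq_or_lt with rfl | hL
  · rcases hs.eq_or_lt with rfl | hs'
    · simp
    · rw [Real.zero_rpow (by linarith), Real.zero_rpow (by linarith)]
      simpa using Real.rpow_nonneg ht s
  · have h := one_add_mul_self_le_rpow_one_add (s := t / L - 1)
      (by have := div_nonneg ht hL.le; linarith) hs
    have h2 : t ^ s = L ^ s * (1 + (t / L - 1)) ^ s := by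
      rw [← Real.mul_rpow hL.le (by have := div_nonneg ht hL.le; linarith)]
      congr 1; field_simp; ring
    have h3 : L ^ s = L ^ (s - 1) * L := by
      rw [← Real.rpow_add_one hL.ne']; simp
    have hpos : 0 < L ^ s := Real.rpow_pos_of_pos hL s
    rw [h2]
    refine le_trans (le_of_eq ?_) (mul_le_mul_of_nonneg_left h hpos.le)
    rw [h3]; field_simp

/-- Bernoulli's inequality for `exp w`. It minorizes `exp (c * w)` by an affine function of `exp w`,
whose mean is explicit. -/
theorem mul_exp_sub_one_le {c w : ℝ} (hc : 1 ≤ c) :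
    1 + c * (Real.exp w - 1) ≤ Real.exp (c * w) := by
  have h := one_add_mul_self_le_rpow_one_add (s := Real.exp w - 1)
    (by have := Real.exp_pos w; linarith) hc
  rwa [add_sub_cancel, ← Real.exp_mul, mul_comm w] at h

/-- Jensen's inequality for `t ↦ exp (k |log t| ^ s)`, on the range where this map is convex. -/
theorem exp_abs_log_integral_exp_le [IsProbabilityMeasure ν] {g : E → ℝ} {k s : ℝ}
    (hs : 1 ≤ s) (hk : 0 ≤ k)
    (hL : 1 ≤ k * s * |Real.log (∫ y, Real.exp (g y) ∂ν)| ^ (s - 1)) :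
    ENNReal.ofReal (Real.exp (k * |Real.log (∫ y, Real.exp (g y) ∂ν)| ^ s))
      ≤ ∫⁻ y, ENNReal.ofReal (Real.exp (k * |g y| ^ s)) ∂ν := by
  by_cases hg : Integrable (fun y => Real.exp (g y)) ν
  swap
  -- Here the integral defaults to `0` and `Real.log 0 = 0`, so the left side is `1`.
  · rw [integral_undef hg, Real.log_zero, abs_zero, Real.zero_rpow (by linarith)]
    simp only [mul_zero, Real.exp_zero, ENNReal.ofReal_one]
    exact one_le_lintegral_of_one_le fun y => one_le_ofReal_exp (by positivity)
  have hpos : 0 < ∫ y, Real.exp (g y) ∂ν := integral_exp_pos hg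
  set I := ∫ y, Real.exp (g y) ∂ν with hI
  set L := |Real.log I| with hLdef
  have hL0 : 0 ≤ L := abs_nonneg _
  -- The slope of `t ↦ k * t ^ s` at `L`; `hL` says `1 ≤ c`, the range in which Bernoulli's
  -- inequality applies.
  set c := k * s * L ^ (s - 1) with hc
  have key : ∀ y, k * L ^ s + c * (|g y| - L) ≤ k * |g y| ^ s := by
    intro y
    have := mul_le_mul_of_nonneg_left (rpow_tangent_le hs hL0 (abs_nonneg (g y))) hk
    calc _ = k * (L ^ s + s * L ^ (s - 1) * (|g y| - L)) := by rw [hc]; ring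
      _ ≤ _ := this
  have hexpI : Real.exp (Real.log I) = I := Real.exp_log hpos
  have hEL : 0 < Real.exp (k * L ^ s) := Real.exp_pos _
  -- an affine function of `exp (g y)` with mean `exp (k L ^ s)` below the integrand
  obtain ⟨A, B, hmean, hle⟩ : ∃ A B : ℝ, A + B * I = Real.exp (k * L ^ s) ∧
      ∀ y, A + B * Real.exp (g y) ≤ Real.exp (k * |g y| ^ s) := by
    rcases le_total 0 (Real.log I) with h | h
    · have hLI : L = Real.log I := abs_of_nonneg h
      refine ⟨Real.exp (k * L ^ s) * (1 - c), Real.exp (k * L ^ s) * (c / I), ?_, fun y => ?_⟩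
      · field_simp; ring
      · have h1 := mul_exp_sub_one_le (w := g y - L) hL
        have h2 : Real.exp (g y - L) = Real.exp (g y) / I := by
          rw [Real.exp_sub, hLI, hexpI]
        calc Real.exp (k * L ^ s) * (1 - c) + Real.exp (k * L ^ s) * (c / I) * Real.exp (g y)
            = Real.exp (k * L ^ s) * (1 + c * (Real.exp (g y - L) - 1)) := by rw [h2]; ring
          _ ≤ Real.exp (k * L ^ s) * Real.exp (c * (g y - L)) :=
              mul_le_mul_of_nonneg_left h1 hEL.le
          _ = Real.exp (k * L ^ s + c * (g y - L)) := (Real.exp_add _ _).symm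
          _ ≤ _ := by
              refine Real.exp_le_exp.2 (le_trans ?_ (key y))
              have := mul_le_mul_of_nonneg_left (le_abs_self (g y)) (zero_le_one.trans hL)
              linarith
    · have hLI : L = -Real.log I := abs_of_nonpos h
      refine ⟨Real.exp (k * L ^ s) * (1 + c), -(Real.exp (k * L ^ s) * (c / I)), ?_, fun y => ?_⟩
      · field_simp; ring
      · have h1 := mul_exp_sub_one_le (w := -g y - L) hL
        have h2 : Real.exp (g y + L) = Real.exp (g y) / I := by
          rw [hLI, ← sub_eq_add_neg, Real.exp_sub, hexpI]
        -- The inequality `exp t + exp (-t) ≥ 2`. It replaces `exp (-g)`, whose mean is unknown, by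
        -- an affine function of `exp g`.
        have h3 : 1 - Real.exp (g y + L) ≤ Real.exp (-g y - L) - 1 := by
          have e1 := Real.add_one_le_exp (-g y - L)
          have e2 := Real.add_one_le_exp (g y + L)
          have e3 : Real.exp (-g y - L) * Real.exp (g y + L) = 1 := by
            rw [← Real.exp_add]; simp
          nlinarith [Real.exp_pos (-g y - L), Real.exp_pos (g y + L),
            sq_nonneg (Real.exp (-g y - L) - Real.exp (g y + L)),
            sq_nonneg (Real.exp (-g y - L) + Real.exp (g y + L) - 2)]
        calc Real.exp (k * L ^ s) * (1 + c) + -(Real.exp (k * L ^ s) * (c / I)) * Real.exp (g y)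
            = Real.exp (k * L ^ s) * (1 + c * (1 - Real.exp (g y + L))) := by rw [h2]; ring
          _ ≤ Real.exp (k * L ^ s) * (1 + c * (Real.exp (-g y - L) - 1)) := by
              have := mul_le_mul_of_nonneg_left h3 (zero_le_one.trans hL)
              exact mul_le_mul_of_nonneg_left (by linarith) hEL.le
          _ ≤ Real.exp (k * L ^ s) * Real.exp (c * (-g y - L)) :=
              mul_le_mul_of_nonneg_left h1 hEL.le
          _ = Real.exp (k * L ^ s + c * (-g y - L)) := (Real.exp_add _ _).symm
          _ ≤ _ := by
              refine Real.exp_le_exp.2 (le_trans ?_ (key y))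
              have := mul_le_mul_of_nonneg_left (neg_le_abs (g y)) (zero_le_one.trans hL)
              linarith
  have hint : Integrable (fun y => A + B * Real.exp (g y)) ν :=
    (integrable_const A).add (hg.const_mul B)
  calc ENNReal.ofReal (Real.exp (k * L ^ s)) = ENNReal.ofReal (∫ y, (A + B * Real.exp (g y)) ∂ν) := by
        rw [integral_add (integrable_const A) (hg.const_mul B), integral_const_mul, ← hI, ← hmean]
        simp
    _ ≤ ∫⁻ y, ENNReal.ofReal (A + B * Real.exp (g y)) ∂ν := ofReal_integral_le_lintegral hint
    _ ≤ _ := lintegral_mono fun y => ENNReal.ofReal_le_ofReal (hle y)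

theorem exp_abs_log_integral_exp_le_one [IsProbabilityMeasure ν] {g : E → ℝ} {k : ℝ}
    (hk : 1 ≤ k) :
    ENNReal.ofReal (Real.exp (k * |Real.log (∫ y, Real.exp (g y) ∂ν)|))
      ≤ ∫⁻ y, ENNReal.ofReal (Real.exp (k * |g y|)) ∂ν := by
  simpa using exp_abs_log_integral_exp_le (ν := ν) (g := g) (k := k) le_rfl (by linarith)
    (by simpa using hk)

/-- Below the threshold `((k * s)⁻¹) ^ (s - 1)⁻¹` for `|log ∫ exp g|` the convexity condition may
fail, but there the left side is at most a constant depending only on `k` and `s`. Uniformity in `ν`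
and `g` is what allows conditional use and iteration. -/
theorem exp_abs_log_integral_exp_le_add {k s : ℝ} (hs : 1 < s) (hk : 0 < k) :
    ∃ K : ℝ, ∀ (ν : Measure E) [IsProbabilityMeasure ν] (g : E → ℝ),
    ENNReal.ofReal (Real.exp (k * |Real.log (∫ y, Real.exp (g y) ∂ν)| ^ s))
      ≤ ENNReal.ofReal K + ∫⁻ y, ENNReal.ofReal (Real.exp (k * |g y| ^ s)) ∂ν := by
  refine ⟨Real.exp (k * (((k * s)⁻¹) ^ (s - 1)⁻¹) ^ s), fun ν _ g => ?_⟩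
  set L := |Real.log (∫ y, Real.exp (g y) ∂ν)|
  have hks : 0 < k * s := by positivity
  rcases le_total L (((k * s)⁻¹) ^ (s - 1)⁻¹) with h | h
  · refine le_add_right (ofReal_exp_mono ?_)
    exact mul_le_mul_of_nonneg_left
      (Real.rpow_le_rpow (abs_nonneg _) h (by linarith)) hk.le
  · refine le_add_left (exp_abs_log_integral_exp_le hs.le hk.le ?_)
    have h1 : (k * s)⁻¹ ≤ L ^ (s - 1) := by
      calc (k * s)⁻¹ = (((k * s)⁻¹) ^ (s - 1)⁻¹) ^ (s - 1) := by
            rw [Real.rpow_inv_rpow (by positivity) (by linarith)]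
        _ ≤ _ := Real.rpow_le_rpow (by positivity) h (by linarith)
    calc (1 : ℝ) = k * s * (k * s)⁻¹ := (mul_inv_cancel₀ hks.ne').symm
      _ ≤ _ := mul_le_mul_of_nonneg_left h1 hks.le

/-- Convexity and monotonicity of `f ↦ log ∫ exp f`. -/
theorem log_integral_exp_convex [IsProbabilityMeasure ν] {f g w : E → ℝ} {θ : ℝ}
    (hθ : 0 ≤ θ) (hθ1 : θ ≤ 1) (hfm : Integrable (fun y => Real.exp (f y)) ν)
    (hg : Integrable (fun y => Real.exp (g y)) ν) (hw : Integrable (fun y => Real.exp (w y)) ν)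
    (hle : ∀ᵐ y ∂ν, f y ≤ (1 - θ) * g y + θ * w y) :
    Real.log (∫ y, Real.exp (f y) ∂ν) ≤
      (1 - θ) * Real.log (∫ y, Real.exp (g y) ∂ν) + θ * Real.log (∫ y, Real.exp (w y) ∂ν) := by
  have hf0 := integral_exp_pos hfm
  have hg0 := integral_exp_pos hg
  have hw0 := integral_exp_pos hw
  set a := Real.log (∫ y, Real.exp (g y) ∂ν) with ha
  set b := Real.log (∫ y, Real.exp (w y) ∂ν) with hb
  rw [Real.log_le_iff_le_exp hf0]
  -- Once normalized, `exp (g - a)` and `exp (w - b)` have mean one, so pointwise convexity of `exp`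
  -- gives the bound after integration.
  have h1 : ∀ᵐ y ∂ν, Real.exp (f y) ≤ Real.exp ((1 - θ) * a + θ * b) *
      ((1 - θ) * (Real.exp (g y) * (∫ y, Real.exp (g y) ∂ν)⁻¹)
        + θ * (Real.exp (w y) * (∫ y, Real.exp (w y) ∂ν)⁻¹)) := by
    filter_upwards [hle] with y hy
    have e1 : Real.exp (g y) * (∫ y, Real.exp (g y) ∂ν)⁻¹ = Real.exp (g y - a) := by
      rw [Real.exp_sub, ha, Real.exp_log hg0, div_eq_mul_inv]
    have e2 : Real.exp (w y) * (∫ y, Real.exp (w y) ∂ν)⁻¹ = Real.exp (w y - b) := by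
      rw [Real.exp_sub, hb, Real.exp_log hw0, div_eq_mul_inv]
    rw [e1, e2]
    have hc := convexOn_exp.2 (Set.mem_univ (g y - a)) (Set.mem_univ (w y - b))
      (by linarith : 0 ≤ 1 - θ) hθ (by ring)
    simp only [smul_eq_mul] at hc
    calc Real.exp (f y) ≤ Real.exp (((1 - θ) * a + θ * b)
          + ((1 - θ) * (g y - a) + θ * (w y - b))) := Real.exp_le_exp.2 (by linarith)
      _ = Real.exp ((1 - θ) * a + θ * b) * Real.exp ((1 - θ) * (g y - a) + θ * (w y - b)) :=
          Real.exp_add _ _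
      _ ≤ _ := mul_le_mul_of_nonneg_left hc (Real.exp_pos _).le
  have hi1 := (hg.mul_const (∫ y, Real.exp (g y) ∂ν)⁻¹).const_mul (1 - θ)
  have hi2 := (hw.mul_const (∫ y, Real.exp (w y) ∂ν)⁻¹).const_mul θ
  calc ∫ y, Real.exp (f y) ∂ν ≤ _ := integral_mono_ae hfm ((hi1.add hi2).const_mul _) h1
    _ = Real.exp ((1 - θ) * a + θ * b) := by
      simp only [Pi.add_apply]
      rw [integral_const_mul, integral_add hi1 hi2, integral_const_mul, integral_const_mul,
        integral_mul_const, integral_mul_const, mul_inv_cancel₀ hg0.ne', mul_inv_cancel₀ hw0.ne']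
      ring

theorem lintegral_ofReal_exp_eq {f : E → ℝ} (hf : Integrable (fun y => Real.exp (f y)) ν) :
    ∫⁻ y, ENNReal.ofReal (Real.exp (f y)) ∂ν = ENNReal.ofReal (∫ y, Real.exp (f y) ∂ν) :=
  (ofReal_integral_eq_lintegral_ofReal hf (ae_of_all _ fun _ => (Real.exp_pos _).le)).symm

theorem integrable_exp_iff {f : E → ℝ} (hf : AEMeasurable f ν) :
    Integrable (fun y => Real.exp (f y)) ν ↔ ∫⁻ y, ENNReal.ofReal (Real.exp (f y)) ∂ν < ∞ := by
  rw [Integrable, and_iff_right (a := AEStronglyMeasurable (fun y => Real.exp (f y)) ν)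
    (Real.measurable_exp.comp_aemeasurable hf).aestronglyMeasurable,
    hasFiniteIntegral_iff_ofReal (ae_of_all _ fun _ => (Real.exp_pos _).le)]

/-- Jensen's inequality for the exponential function. -/
theorem exp_toReal_lintegral_le [IsProbabilityMeasure ν] {G : E → ℝ≥0∞} (hG : Measurable G) :
    ENNReal.ofReal (Real.exp (∫⁻ y, G y ∂ν).toReal)
      ≤ ∫⁻ y, ENNReal.ofReal (Real.exp (G y).toReal) ∂ν := by
  by_cases h : ∫⁻ y, G y ∂ν = ∞
  · rw [h]
    simp only [ENNReal.toReal_top, Real.exp_zero, ENNReal.ofReal_one]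
    exact one_le_lintegral_of_one_le fun y => one_le_ofReal_exp ENNReal.toReal_nonneg
  have hi : Integrable (fun y => (G y).toReal) ν := integrable_toReal_of_lintegral_ne_top hG.aemeasurable h
  have hI : ∫ y, (G y).toReal ∂ν = (∫⁻ y, G y ∂ν).toReal :=
    integral_toReal hG.aemeasurable (ae_lt_top hG h)
  set a := (∫⁻ y, G y ∂ν).toReal
  -- The integrand is the tangent line of `exp` at the mean `a`.
  have hi2 : Integrable (fun y => Real.exp a * (1 - a) + Real.exp a * (G y).toReal) ν :=
    (integrable_const _).add (hi.const_mul _)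
  calc ENNReal.ofReal (Real.exp a)
      = ENNReal.ofReal (∫ y, (Real.exp a * (1 - a) + Real.exp a * (G y).toReal) ∂ν) := by
        rw [integral_add (integrable_const _) (hi.const_mul _), integral_const_mul _ (fun y => (G y).toReal),
          hI]
        simp; congr 1; ring
    _ ≤ _ := ofReal_integral_le_lintegral hi2
    _ ≤ _ := lintegral_mono fun y => ENNReal.ofReal_le_ofReal (by
        have := mul_le_mul_of_nonneg_left (Real.add_one_le_exp ((G y).toReal - a)) (Real.exp_pos a).le
        rw [← Real.exp_add] at this
        calc _ = Real.exp a * ((G y).toReal - a + 1) := by ring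
          _ ≤ _ := this
          _ = _ := by congr 1; ring)

/-- The gradient inequality for `f ↦ log ∫ exp f`. -/
theorem log_integral_exp_sub_le [IsProbabilityMeasure ν] {f g : E → ℝ} (hfm : Measurable f)
    (hgm : Measurable g) (hf : Integrable (fun y => Real.exp (f y)) ν)
    (hg : Integrable (fun y => Real.exp (g y)) ν) :
    ENNReal.ofReal (Real.log (∫ y, Real.exp (f y) ∂ν) - Real.log (∫ y, Real.exp (g y) ∂ν))
      ≤ ∫⁻ y, ENNReal.ofReal (Real.exp (f y)) / (∫⁻ y, ENNReal.ofReal (Real.exp (f y)) ∂ν)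
          * ENNReal.ofReal (f y - g y) ∂ν := by
  have hf0 := integral_exp_pos hf
  have hg0 := integral_exp_pos hg
  set I := ∫ y, Real.exp (f y) ∂ν with hI
  rw [lintegral_ofReal_exp_eq hf, ← hI]
  have e1 : ∀ y, ENNReal.ofReal (Real.exp (f y)) / ENNReal.ofReal I * ENNReal.ofReal (f y - g y)
      = ENNReal.ofReal (Real.exp (f y) / I * max (f y - g y) 0) := by
    intro y
    rw [ENNReal.ofReal_mul (by positivity), ENNReal.ofReal_div_of_pos hf0]
    simp
  simp_rw [e1]
  by_cases hint : Integrable (fun y => Real.exp (f y) / I * max (f y - g y) 0) ν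
  swap
  · have hm : AEStronglyMeasurable (fun y => Real.exp (f y) / I * max (f y - g y) 0) ν := by
      apply Measurable.aestronglyMeasurable; fun_prop
    have : ∫⁻ y, ENNReal.ofReal (Real.exp (f y) / I * max (f y - g y) 0) ∂ν = ∞ := by
      by_contra hne
      refine hint ⟨hm, ?_⟩
      rw [hasFiniteIntegral_iff_ofReal (ae_of_all _ fun y => by positivity)]
      exact lt_top_iff_ne_top.2 hne
    rw [this]; exact le_top
  rw [← ofReal_integral_eq_lintegral_ofReal hint (ae_of_all _ fun y => by positivity)]
  refine ENNReal.ofReal_le_ofReal ?_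
  set a := ∫ y, Real.exp (f y) / I * max (f y - g y) 0 ∂ν with ha
  -- Pointwise `exp g ≥ exp f * exp (-(f - g)⁺)`. The tangent line of `exp (-t)` at `a`, the tilted
  -- mean of `(f - g)⁺`, is then integrated against `exp f`.
  have key : I * Real.exp (-a) ≤ ∫ y, Real.exp (g y) ∂ν := by
    have hi := ((hf.mul_const (Real.exp (-a) * (1 + a))).sub
      (hint.mul_const (Real.exp (-a) * I)))
    calc I * Real.exp (-a)
        = ∫ y, (Real.exp (f y) * (Real.exp (-a) * (1 + a))
            - Real.exp (f y) / I * max (f y - g y) 0 * (Real.exp (-a) * I)) ∂ν := by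
          rw [integral_sub (hf.mul_const _) (hint.mul_const _), integral_mul_const,
            integral_mul_const, ← ha, ← hI]; ring
      _ ≤ _ := integral_mono hi hg fun y => by
          have h1 := Real.add_one_le_exp (a - max (f y - g y) 0)
          have h2 : Real.exp (f y) * Real.exp (-max (f y - g y) 0) ≤ Real.exp (g y) := by
            rw [← Real.exp_add]
            exact Real.exp_le_exp.2 (by have := le_max_left (f y - g y) 0; linarith)
          have h3 : Real.exp (-a) * Real.exp (a - max (f y - g y) 0)
              = Real.exp (-max (f y - g y) 0) := by rw [← Real.exp_add]; congr 1; ring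
          calc _ = Real.exp (f y) * (Real.exp (-a) * (a - max (f y - g y) 0 + 1)) := by
                field_simp; ring
            _ ≤ Real.exp (f y) * (Real.exp (-a) * Real.exp (a - max (f y - g y) 0)) := by
                gcongr
            _ ≤ _ := by rw [h3]; exact h2
  have := Real.log_le_log (by positivity) key
  rw [Real.log_mul hf0.ne' (Real.exp_pos _).ne', Real.log_exp] at this
  linarith

theorem lintegral_rpow_le_lintegral_rpow [IsProbabilityMeasure ν] {F : E → ℝ≥0∞}
    (hF : AEMeasurable F ν) {c : ℝ} (hc : 1 ≤ c) :
    (∫⁻ y, F y ∂ν) ^ c ≤ ∫⁻ y, F y ^ c ∂ν := by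
  have hc0 : 0 < c := by linarith
  have h := ENNReal.lintegral_mul_norm_pow_le (μ := ν) (f := fun y => F y ^ c) (g := fun _ => 1)
    (hF.pow_const c) aemeasurable_const (p := c⁻¹) (q := 1 - c⁻¹) (by positivity)
    (by have := inv_le_one_of_one_le₀ hc; linarith) (by ring)
  simp only [ENNReal.one_rpow, mul_one, lintegral_const, measure_univ,
    ENNReal.rpow_rpow_inv hc0.ne'] at h
  calc _ ≤ ((∫⁻ y, F y ^ c ∂ν) ^ c⁻¹) ^ c := ENNReal.rpow_le_rpow h hc0.le
    _ = _ := ENNReal.rpow_inv_rpow hc0.ne' _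

/-- Cauchy–Schwarz for `1 = exp (f / 2) * exp (-f / 2)`. It bounds the inverse of a normalizing
constant by an exponential moment. -/
theorem one_le_lintegral_exp_mul_lintegral_exp_neg [IsProbabilityMeasure ν] {f : E → ℝ}
    (hf : Measurable f) :
    1 ≤ (∫⁻ y, ENNReal.ofReal (Real.exp (f y)) ∂ν)
      * ∫⁻ y, ENNReal.ofReal (Real.exp (-f y)) ∂ν := by
  have h := ENNReal.lintegral_mul_norm_pow_le (μ := ν) (f := fun y => ENNReal.ofReal (Real.exp (f y)))
    (g := fun y => ENNReal.ofReal (Real.exp (-f y))) (by fun_prop) (by fun_prop)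
    (p := 1 / 2) (q := 1 / 2) (by norm_num) (by norm_num) (by norm_num)
  simp only [ofReal_exp_rpow, ← ofReal_exp_add] at h
  rw [← ENNReal.mul_rpow_of_nonneg _ _ (by norm_num)] at h
  have h2 : (1 : ℝ≥0∞) ≤ ((∫⁻ y, ENNReal.ofReal (Real.exp (f y)) ∂ν)
      * ∫⁻ y, ENNReal.ofReal (Real.exp (-f y)) ∂ν) ^ (1 / 2 : ℝ) := by simpa using h
  calc (1 : ℝ≥0∞) = 1 ^ (2 : ℝ) := by simp
    _ ≤ _ := ENNReal.rpow_le_rpow h2 (by norm_num)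
    _ = _ := by rw [← ENNReal.rpow_mul]; norm_num

end OneMeasure

/-! ### Exponential moments -/

section ExpMoment

variable {E : Type*} [MeasurableSpace E] {μ : Measure E}

/-- The exponential moment `∫ exp (k |f| ^ s) dμ`. -/
noncomputable def expMoment (μ : Measure E) (k s : ℝ) (f : E → ℝ) : ℝ≥0∞ :=
  ∫⁻ x, ENNReal.ofReal (Real.exp (k * |f x| ^ s)) ∂μ

/-- All exponential moments of `|f| ^ s` are finite. -/
def HasAllExpMoments (μ : Measure E) (s : ℝ) (f : E → ℝ) : Prop :=
  Measurable f ∧ ∀ k : ℝ, 0 < k → expMoment μ k s f < ∞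

theorem expMoment_one (k : ℝ) (f : E → ℝ) :
    expMoment μ k 1 f = ∫⁻ x, ENNReal.ofReal (Real.exp (k * |f x|)) ∂μ := by
  simp [expMoment]

theorem one_le_expMoment [IsProbabilityMeasure μ] {k : ℝ} (hk : 0 ≤ k) (s : ℝ) (f : E → ℝ) :
    1 ≤ expMoment μ k s f :=
  one_le_lintegral_of_one_le fun y => one_le_ofReal_exp (by positivity)

theorem ofReal_exp_eq_sub_one_add_one {t : ℝ} (ht : 0 ≤ t) :
    ENNReal.ofReal (Real.exp t) = ENNReal.ofReal (Real.exp t - 1) + 1 := by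
  rw [← ENNReal.ofReal_one, ← ENNReal.ofReal_add (by linarith [Real.one_le_exp ht]) zero_le_one]
  simp

theorem lintegral_ofReal_exp_eq_orliczModular_add_one [IsProbabilityMeasure μ] {s c : ℝ}
    (hc : 0 ≤ c) (f : E → ℝ) :
    ∫⁻ x, ENNReal.ofReal (Real.exp ((|f x| / c) ^ s)) ∂μ = orliczModular μ s f c + 1 := by
  unfold orliczModular
  have : ∀ x, ENNReal.ofReal (Real.exp ((|f x| / c) ^ s))
      = ENNReal.ofReal (Real.exp ((|f x| / c) ^ s) - 1) + 1 :=
    fun x => ofReal_exp_eq_sub_one_add_one (by positivity)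
  simp_rw [this]
  rw [lintegral_add_right _ measurable_const]
  simp

theorem expMoment_eq_orliczModular_add_one [IsProbabilityMeasure μ] {s k : ℝ}
    (hs : 0 < s) (hk : 0 < k) (f : E → ℝ) :
    expMoment μ k s f = orliczModular μ s f (k ^ (-s⁻¹)) + 1 := by
  rw [← lintegral_ofReal_exp_eq_orliczModular_add_one (by positivity)]
  refine lintegral_congr fun x => ?_
  congr 2
  rw [Real.div_rpow (abs_nonneg _) (by positivity), ← Real.rpow_mul hk.le]
  have : -s⁻¹ * s = -1 := by field_simp
  rw [this, Real.rpow_neg_one, div_inv_eq_mul, mul_comm]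

/-- Translates the Orlicz heart into exponential moments, the language of the estimates below.
Finiteness of the norm is automatic: by convexity of `φ_s`, a division of `f` by `k ≥ 1` divides the
modular by at least `k`, so `k = max 1 m`, with `m` the modular at `1`, is admissible. -/
theorem memOrliczHeart_iff [IsProbabilityMeasure μ] {s : ℝ} (hs : 1 ≤ s) {f : E → ℝ} :
    MemOrliczHeart μ s f ↔ HasAllExpMoments μ s f := by
  have hs0 : 0 < s := by linarith
  constructor
  · rintro ⟨⟨hm, -⟩, h⟩
    refine ⟨hm, fun k hk => ?_⟩
    rw [expMoment_eq_orliczModular_add_one hs0 hk]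
    exact ENNReal.add_lt_top.2 ⟨h _ (by positivity), ENNReal.one_lt_top⟩
  · rintro ⟨hm, h⟩
    have hfin : ∀ c : ℝ, 0 < c → orliczModular μ s f c < ∞ := by
      intro c hc
      have h1 := h (c ^ (-s)) (by positivity)
      rw [expMoment_eq_orliczModular_add_one hs0 (by positivity), ← Real.rpow_mul hc.le] at h1
      have : -s * -s⁻¹ = 1 := by field_simp
      rw [this, Real.rpow_one] at h1
      exact (le_add_right le_rfl).trans_lt h1
    refine ⟨⟨hm, ?_⟩, hfin⟩
    set m := (orliczModular μ s f 1).toReal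
    set k := max 1 m with hk
    have hk1 : 1 ≤ k := le_max_left _ _
    have hk0 : 0 < k := by linarith
    have hmod : orliczModular μ s f k ≤ 1 := by
      calc orliczModular μ s f k
          ≤ ∫⁻ z, ENNReal.ofReal k⁻¹ * ENNReal.ofReal (Real.exp ((|f z| / 1) ^ s) - 1) ∂μ := by
            refine lintegral_mono fun z => ?_
            rw [← ENNReal.ofReal_mul (by positivity)]
            refine ENNReal.ofReal_le_ofReal ?_
            have hkinv : k⁻¹ ≤ 1 := inv_le_one_of_one_le₀ hk1
            have h1 : (|f z| / k) ^ s ≤ k⁻¹ * |f z| ^ s := by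
              rw [div_eq_inv_mul, Real.mul_rpow (by positivity) (abs_nonneg _)]
              refine mul_le_mul_of_nonneg_right ?_ (by positivity)
              calc k⁻¹ ^ s ≤ k⁻¹ ^ (1 : ℝ) :=
                    Real.rpow_le_rpow_of_exponent_ge (by positivity) hkinv hs
                _ = k⁻¹ := Real.rpow_one _
            have h2 := convexOn_exp.2 (Set.mem_univ (|f z| ^ s)) (Set.mem_univ 0)
              (by positivity : 0 ≤ k⁻¹) (by linarith : 0 ≤ 1 - k⁻¹) (by ring)
            simp only [smul_eq_mul, mul_zero, add_zero, Real.exp_zero, mul_one] at h2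
            have h3 := Real.exp_le_exp.2 h1
            rw [div_one]
            linarith
        _ = ENNReal.ofReal k⁻¹ * orliczModular μ s f 1 := by
            rw [lintegral_const_mul' _ _ ENNReal.ofReal_ne_top]; rfl
        _ ≤ ENNReal.ofReal k⁻¹ * ENNReal.ofReal k := by
            gcongr
            rw [← ENNReal.ofReal_toReal (hfin 1 one_pos).ne]
            exact ENNReal.ofReal_le_ofReal (le_max_right _ _)
        _ = 1 := by
            rw [← ENNReal.ofReal_mul (by positivity), inv_mul_cancel₀ hk0.ne', ENNReal.ofReal_one]
    exact (iInf₂_le k ⟨hk0, hmod⟩).trans_lt ENNReal.ofReal_lt_top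

theorem expMoment_mono_left {k k' : ℝ} (h : k ≤ k') (s : ℝ) (f : E → ℝ) :
    expMoment μ k s f ≤ expMoment μ k' s f :=
  lintegral_mono fun x => ofReal_exp_mono (mul_le_mul_of_nonneg_right h (by positivity))

theorem expMoment_congr_ae {f g : E → ℝ} (h : f =ᵐ[μ] g) (k s : ℝ) :
    expMoment μ k s f = expMoment μ k s g :=
  lintegral_congr_ae (by filter_upwards [h] with x hx; rw [hx])

theorem HasAllExpMoments.of_le_add {s : ℝ} (hs : 1 ≤ s) {f g w : E → ℝ}
    (hf : HasAllExpMoments μ s f) (hg : HasAllExpMoments μ s g) (hw : Measurable w) {C : ℝ}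
    (hC : 0 ≤ C) (h : ∀ x, |w x| ≤ C * (|f x| + |g x|)) : HasAllExpMoments μ s w := by
  refine ⟨hw, fun k hk => ?_⟩
  -- The factor `2` dominates the exponential of a sum by the larger of two exponentials; `+ 1`
  -- keeps `c` positive when `C = 0`.
  set c := 2 * (k * C ^ s * 2 ^ (s - 1)) + 1
  have hc : 0 < c := by positivity
  have hle : ∀ x, ENNReal.ofReal (Real.exp (k * |w x| ^ s))
      ≤ ENNReal.ofReal (Real.exp (c * |f x| ^ s)) + ENNReal.ofReal (Real.exp (c * |g x| ^ s)) := by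
    intro x
    have h1 : |w x| ^ s ≤ C ^ s * (2 ^ (s - 1) * (|f x| ^ s + |g x| ^ s)) := by
      calc |w x| ^ s ≤ (C * (|f x| + |g x|)) ^ s :=
            Real.rpow_le_rpow (abs_nonneg _) (h x) (by linarith)
        _ = C ^ s * (|f x| + |g x|) ^ s := Real.mul_rpow hC (by positivity)
        _ ≤ _ := mul_le_mul_of_nonneg_left (by
            exact_mod_cast NNReal.rpow_add_le_mul_rpow_add_rpow (Real.nnabs (f x))
              (Real.nnabs (g x)) hs) (by positivity)
    have h2 : k * |w x| ^ s ≤ (c - 1) / 2 * (|f x| ^ s + |g x| ^ s) := by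
      calc _ ≤ _ := mul_le_mul_of_nonneg_left h1 hk.le
        _ = _ := by simp only [c]; ring
    have hf0 : 0 ≤ |f x| ^ s := by positivity
    have hg0 : 0 ≤ |g x| ^ s := by positivity
    have hc1 : 0 ≤ c - 1 := by simp only [c]; ring_nf; positivity
    rcases le_total (|f x| ^ s) (|g x| ^ s) with h3 | h3
    · refine le_add_left (ofReal_exp_mono (h2.trans ?_))
      nlinarith
    · refine le_add_right (ofReal_exp_mono (h2.trans ?_))
      nlinarith
  have hfm := hf.1
  calc expMoment μ k s w ≤ _ := lintegral_mono hle
    _ = expMoment μ c s f + expMoment μ c s g := lintegral_add_left (by fun_prop) _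
    _ < ∞ := ENNReal.add_lt_top.2 ⟨hf.2 c hc, hg.2 c hc⟩

theorem HasAllExpMoments.add {s : ℝ} (hs : 1 ≤ s) {f g : E → ℝ}
    (hf : HasAllExpMoments μ s f) (hg : HasAllExpMoments μ s g) :
    HasAllExpMoments μ s (fun x => f x + g x) :=
  hf.of_le_add hs hg (hf.1.add hg.1) zero_le_one fun x => by
    rw [one_mul]; exact abs_add_le _ _

theorem HasAllExpMoments.const_mul {s : ℝ} (hs : 1 ≤ s) {f : E → ℝ}
    (hf : HasAllExpMoments μ s f) (c : ℝ) : HasAllExpMoments μ s (fun x => c * f x) :=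
  hf.of_le_add hs hf (hf.1.const_mul c) (abs_nonneg c) fun x => by
    rw [abs_mul]; exact mul_le_mul_of_nonneg_left (by linarith [abs_nonneg (f x)]) (abs_nonneg c)

theorem HasAllExpMoments.zero [IsFiniteMeasure μ] {s : ℝ} (hs : 1 ≤ s) :
    HasAllExpMoments μ s (fun _ => 0) := by
  refine ⟨measurable_const, fun k _ => ?_⟩
  rw [expMoment, abs_zero, Real.zero_rpow (by linarith)]
  simp

theorem HasAllExpMoments.mono [IsFiniteMeasure μ] {s s' : ℝ} (hs : 0 ≤ s) (hss : s ≤ s') {f : E → ℝ}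
    (hf : HasAllExpMoments μ s' f) : HasAllExpMoments μ s f := by
  refine ⟨hf.1, fun k hk => ?_⟩
  have hle : ∀ x, ENNReal.ofReal (Real.exp (k * |f x| ^ s))
      ≤ ENNReal.ofReal (Real.exp k) * ENNReal.ofReal (Real.exp (k * |f x| ^ s')) := by
    intro x
    rw [← ofReal_exp_add]
    refine ofReal_exp_mono ?_
    have : |f x| ^ s ≤ 1 + |f x| ^ s' := by
      rcases le_total |f x| 1 with h | h
      · linarith [Real.rpow_le_one (abs_nonneg (f x)) h hs, Real.rpow_nonneg (abs_nonneg (f x)) s']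
      · linarith [Real.rpow_le_rpow_of_exponent_le h hss]
    nlinarith
  calc expMoment μ k s f ≤ _ := lintegral_mono hle
    _ = ENNReal.ofReal (Real.exp k) * expMoment μ k s' f :=
        lintegral_const_mul' _ _ ENNReal.ofReal_ne_top
    _ < ∞ := ENNReal.mul_lt_top ENNReal.ofReal_lt_top (hf.2 k hk)

end ExpMoment

/-! ### The entropic operator of a kernel with an invariant distribution -/

section EntropicOp

variable {X : Type*} [MeasurableSpace X] {Q : Kernel X X} [IsMarkovKernel Q]
  {μ : Measure X} [IsProbabilityMeasure μ]

/-- The operator `f ↦ β log E^Q[exp (f(X_{t+1}) + h(X_t, X_{t+1})) | X_t]`. -/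
noncomputable def entropicOp (Q : Kernel X X) (h : X × X → ℝ) (β : ℝ) (f : X → ℝ) : X → ℝ :=
  fun x => β * Real.log (∫ y, Real.exp (f y + h (x, y)) ∂(Q x))

theorem measurable_entropicOp {h : X × X → ℝ} (hh : Measurable h) (β : ℝ) {f : X → ℝ}
    (hf : Measurable f) : Measurable (entropicOp Q h β f) := by
  have h1 : StronglyMeasurable (fun x => ∫ y, Real.exp (f y + h (x, y)) ∂(Q x)) :=
    StronglyMeasurable.integral_kernel_prod_right (κ := Q)
      (f := fun x y => Real.exp (f y + h (x, y)))
      (Measurable.stronglyMeasurable (by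
        simp only [Function.uncurry_def]; fun_prop))
  exact (Real.measurable_log.comp h1.measurable).const_mul β

theorem measurePreserving_snd (hμ : Kernel.Invariant Q μ) :
    MeasurePreserving Prod.snd (μ ⊗ₘ Q) μ :=
  ⟨measurable_snd, by
    have := Measure.snd_compProd μ Q
    rw [Measure.snd] at this
    rw [this]; exact hμ⟩

theorem measurePreserving_fst : MeasurePreserving Prod.fst (μ ⊗ₘ Q) μ :=
  ⟨measurable_fst, by simpa [Measure.fst] using Measure.fst_compProd μ Q⟩

theorem ae_ae_of_ae_invariant (hμ : Kernel.Invariant Q μ) {p : X → Prop} (h : ∀ᵐ y ∂μ, p y) :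
    ∀ᵐ x ∂μ, ∀ᵐ y ∂(Q x), p y :=
  Measure.ae_ae_of_ae_compProd (p := fun z : X × X => p z.2)
    ((measurePreserving_snd hμ).quasiMeasurePreserving.ae h)

theorem HasAllExpMoments.comp_snd (hμ : Kernel.Invariant Q μ) {s : ℝ} {f : X → ℝ}
    (hf : HasAllExpMoments μ s f) : HasAllExpMoments (μ ⊗ₘ Q) s (fun z => f z.2) := by
  have hm := hf.1
  refine ⟨hm.comp measurable_snd, fun k hk => ?_⟩
  have := (measurePreserving_snd hμ).lintegral_comp
    (f := fun x => ENNReal.ofReal (Real.exp (k * |f x| ^ s))) (by fun_prop)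
  rw [expMoment, this]
  exact hf.2 k hk

theorem HasAllExpMoments.comp_fst {s : ℝ} {f : X → ℝ}
    (hf : HasAllExpMoments μ s f) : HasAllExpMoments (μ ⊗ₘ Q) s (fun z => f z.1) := by
  have hm := hf.1
  refine ⟨hm.comp measurable_fst, fun k hk => ?_⟩
  have := (measurePreserving_fst (μ := μ) (Q := Q)).lintegral_comp
    (f := fun x => ENNReal.ofReal (Real.exp (k * |f x| ^ s))) (by fun_prop)
  rw [expMoment, this]
  exact hf.2 k hk

/-- Since `β (f + h) = β f + (1 - β) (β / (1 - β) h)` is a convex combination, convexity of `t ^ s`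
and Hölder with weights `β`, `1 - β` apply; invariance removes the time shift. The power `β` on the
moment of `f` is the source of all contraction. -/
theorem lintegral_exp_add_le (hμ : Kernel.Invariant Q μ) {h : X × X → ℝ} (hh : Measurable h)
    {f : X → ℝ} (hf : Measurable f) {β s k : ℝ} (hβ₀ : 0 < β) (hβ₁ : β < 1) (hs : 1 ≤ s)
    (hk : 0 ≤ k) :
    ∫⁻ x, ∫⁻ y, ENNReal.ofReal (Real.exp (k * β ^ s * |f y + h (x, y)| ^ s)) ∂(Q x) ∂μ
      ≤ expMoment μ k s f ^ β
        * expMoment (μ ⊗ₘ Q) k s (fun z => β / (1 - β) * h z) ^ (1 - β) := by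
  have hβ' : 0 < 1 - β := by linarith
  rw [← Measure.lintegral_compProd
    (f := fun z : X × X => ENNReal.ofReal (Real.exp (k * β ^ s * |f z.2 + h z| ^ s))) (by fun_prop)]
  calc _ ≤ ∫⁻ z, ENNReal.ofReal (Real.exp (k * |f z.2| ^ s)) ^ β
        * ENNReal.ofReal (Real.exp (k * |β / (1 - β) * h z| ^ s)) ^ (1 - β) ∂(μ ⊗ₘ Q) := by
        refine lintegral_mono fun z => ?_
        rw [ofReal_exp_rpow, ofReal_exp_rpow, ← ofReal_exp_add]
        refine ofReal_exp_mono ?_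
        have h1 := (convexOn_rpow hs).2 (Set.mem_Ici.2 (abs_nonneg (f z.2)))
          (Set.mem_Ici.2 (abs_nonneg (β / (1 - β) * h z))) hβ₀.le hβ'.le (by ring)
        simp only [smul_eq_mul] at h1
        have h2 : β ^ s * |f z.2 + h z| ^ s
            ≤ (β * |f z.2| + (1 - β) * |β / (1 - β) * h z|) ^ s := by
          rw [← Real.mul_rpow hβ₀.le (abs_nonneg _)]
          refine Real.rpow_le_rpow (by positivity) ?_ (by linarith)
          rw [abs_mul, abs_of_pos (by positivity : 0 < β / (1 - β))]
          have : (1 - β) * (β / (1 - β) * |h z|) = β * |h z| := by field_simp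
          rw [this, ← mul_add]
          exact mul_le_mul_of_nonneg_left (abs_add_le _ _) hβ₀.le
        calc _ = k * (β ^ s * |f z.2 + h z| ^ s) := by ring
          _ ≤ _ := mul_le_mul_of_nonneg_left (h2.trans h1) hk
          _ = _ := by ring
    _ ≤ (∫⁻ z, ENNReal.ofReal (Real.exp (k * |f z.2| ^ s)) ∂(μ ⊗ₘ Q)) ^ β
        * (∫⁻ z, ENNReal.ofReal (Real.exp (k * |β / (1 - β) * h z| ^ s)) ∂(μ ⊗ₘ Q)) ^ (1 - β) :=
        ENNReal.lintegral_mul_norm_pow_le (by fun_prop) (by fun_prop) hβ₀.le hβ'.le (by ring)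
    _ = _ := by
        rw [(measurePreserving_snd hμ).lintegral_comp
          (f := fun x => ENNReal.ofReal (Real.exp (k * |f x| ^ s))) (by fun_prop)]
        rfl

theorem expMoment_entropicOp_le (hμ : Kernel.Invariant Q μ) {h : X × X → ℝ} (hh : Measurable h)
    {β s k : ℝ} (hβ₀ : 0 < β) (hβ₁ : β < 1) (hs : 1 < s) (hk : 0 < k) :
    ∃ K : ℝ, ∀ f : X → ℝ, Measurable f → expMoment μ k s (entropicOp Q h β f)
      ≤ ENNReal.ofReal K + expMoment μ k s f ^ β
        * expMoment (μ ⊗ₘ Q) k s (fun z => β / (1 - β) * h z) ^ (1 - β) := by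
  obtain ⟨K, hK⟩ := exp_abs_log_integral_exp_le_add (E := X) hs (by positivity : 0 < k * β ^ s)
  refine ⟨K, fun f hf => ?_⟩
  calc expMoment μ k s (entropicOp Q h β f)
      ≤ ∫⁻ x, (ENNReal.ofReal K +
        ∫⁻ y, ENNReal.ofReal (Real.exp (k * β ^ s * |f y + h (x, y)| ^ s)) ∂(Q x)) ∂μ := by
        refine lintegral_mono fun x => le_trans (le_of_eq ?_) (hK (Q x) fun y => f y + h (x, y))
        rw [entropicOp, abs_mul, abs_of_pos hβ₀, Real.mul_rpow hβ₀.le (abs_nonneg _), mul_assoc]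
    _ = ENNReal.ofReal K + ∫⁻ x, ∫⁻ y,
        ENNReal.ofReal (Real.exp (k * β ^ s * |f y + h (x, y)| ^ s)) ∂(Q x) ∂μ := by
        rw [lintegral_add_left measurable_const]; simp
    _ ≤ _ := by gcongr; exact lintegral_exp_add_le hμ hh hf hβ₀ hβ₁ hs.le hk.le

/-- For `s = 1` the condition `1 ≤ k * β` makes Jensen's inequality available everywhere. No
additive constant appears, so the bound iterates multiplicatively. -/
theorem expMoment_one_entropicOp_le (hμ : Kernel.Invariant Q μ) {h : X × X → ℝ}
    (hh : Measurable h) {β k : ℝ} (hβ₀ : 0 < β) (hβ₁ : β < 1) (hk : 1 ≤ k * β)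
    {f : X → ℝ} (hf : Measurable f) :
    expMoment μ k 1 (entropicOp Q h β f) ≤ expMoment μ k 1 f ^ β
        * expMoment (μ ⊗ₘ Q) k 1 (fun z => β / (1 - β) * h z) ^ (1 - β) := by
  have hk0 : 0 ≤ k := by
    by_contra hneg; push Not at hneg; nlinarith
  refine le_trans (lintegral_mono fun x => ?_) (lintegral_exp_add_le hμ hh hf hβ₀ hβ₁ le_rfl hk0)
  have := exp_abs_log_integral_exp_le_one (ν := Q x) (g := fun y => f y + h (x, y)) hk
  simp only [Real.rpow_one]
  refine le_trans (le_of_eq ?_) this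
  rw [entropicOp, abs_mul, abs_of_pos hβ₀, mul_assoc]

theorem HasAllExpMoments.entropicOp {f : X → ℝ} {s : ℝ} (hf : HasAllExpMoments μ s f)
    (hμ : Kernel.Invariant Q μ) {h : X × X → ℝ} {β : ℝ} (hβ₀ : 0 < β) (hβ₁ : β < 1) (hs : 1 < s)
    (hh : HasAllExpMoments (μ ⊗ₘ Q) s h) : HasAllExpMoments μ s (entropicOp Q h β f) := by
  refine ⟨measurable_entropicOp hh.1 β hf.1, fun k hk => ?_⟩
  obtain ⟨K, hK⟩ := expMoment_entropicOp_le hμ hh.1 hβ₀ hβ₁ hs hk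
  refine (hK f hf.1).trans_lt (ENNReal.add_lt_top.2 ⟨ENNReal.ofReal_lt_top, ENNReal.mul_lt_top ?_ ?_⟩)
  · exact ENNReal.rpow_lt_top_of_nonneg hβ₀.le (hf.2 k hk).ne
  · exact ENNReal.rpow_lt_top_of_nonneg (by linarith) ((hh.const_mul hs.le _).2 k hk).ne

theorem HasAllExpMoments.entropicOp_iterate {f : X → ℝ} {s : ℝ} (hf : HasAllExpMoments μ s f)
    (hμ : Kernel.Invariant Q μ) {h : X × X → ℝ} {β : ℝ} (hβ₀ : 0 < β) (hβ₁ : β < 1) (hs : 1 < s)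
    (hh : HasAllExpMoments (μ ⊗ₘ Q) s h) (n : ℕ) :
    HasAllExpMoments μ s ((RobustValue.entropicOp Q h β)^[n] f) := by
  induction n with
  | zero => simpa using hf
  | succ n ih => rw [Function.iterate_succ_apply']; exact ih.entropicOp hμ hβ₀ hβ₁ hs hh

theorem ae_integrable_exp_add (hμ : Kernel.Invariant Q μ) {h : X × X → ℝ} {s : ℝ}
    (hs : 1 ≤ s) (hh : HasAllExpMoments (μ ⊗ₘ Q) s h) {f : X → ℝ} (hf : HasAllExpMoments μ s f) :
    ∀ᵐ x ∂μ, Integrable (fun y => Real.exp (f y + h (x, y))) (Q x) := by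
  have h1 := (((hf.comp_snd hμ).add hs hh).mono zero_le_one hs)
  have h2 := h1.2 1 one_pos
  have hm := h1.1
  have hfm := hf.1
  have hhm := hh.1
  rw [expMoment_one, Measure.lintegral_compProd (by fun_prop)] at h2
  have h3 := ae_lt_top (Measurable.lintegral_kernel_prod_right (κ := Q)
    (f := fun x y => ENNReal.ofReal (Real.exp (1 * |f y + h (x, y)|)))
    (by simp only [Function.uncurry_def]; fun_prop)) h2.ne
  filter_upwards [h3] with x hx
  rw [integrable_exp_iff (by fun_prop)]
  refine lt_of_le_of_lt (lintegral_mono fun y => ofReal_exp_mono ?_) hx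
  rw [one_mul]; exact le_abs_self _

/-- Convexity and monotonicity of the entropic operator. -/
theorem entropicOp_convex (hμ : Kernel.Invariant Q μ) {h : X × X → ℝ} {β s θ : ℝ}
    (hβ₀ : 0 < β) (hs : 1 ≤ s) (hh : HasAllExpMoments (μ ⊗ₘ Q) s h)
    {f g w : X → ℝ} (hf : HasAllExpMoments μ s f) (hg : HasAllExpMoments μ s g)
    (hw : HasAllExpMoments μ s w) (hθ : 0 ≤ θ) (hθ1 : θ ≤ 1)
    (hle : ∀ᵐ x ∂μ, f x ≤ (1 - θ) * g x + θ * w x) :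
    ∀ᵐ x ∂μ, entropicOp Q h β f x
      ≤ (1 - θ) * entropicOp Q h β g x + θ * entropicOp Q h β w x := by
  filter_upwards [ae_integrable_exp_add hμ hs hh hf, ae_integrable_exp_add hμ hs hh hg,
    ae_integrable_exp_add hμ hs hh hw, ae_ae_of_ae_invariant hμ hle] with x h1 h2 h3 h4
  have := log_integral_exp_convex hθ hθ1 h1 h2 h3 (by
    filter_upwards [h4] with y hy
    linarith)
  have := mul_le_mul_of_nonneg_left this hβ₀.le
  simp only [entropicOp]
  linarith

theorem entropicOp_mono (hμ : Kernel.Invariant Q μ) {h : X × X → ℝ} {β s : ℝ}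
    (hβ₀ : 0 < β) (hs : 1 ≤ s) (hh : HasAllExpMoments (μ ⊗ₘ Q) s h)
    {f g : X → ℝ} (hf : HasAllExpMoments μ s f) (hg : HasAllExpMoments μ s g)
    (hle : f ≤ᵐ[μ] g) : entropicOp Q h β f ≤ᵐ[μ] entropicOp Q h β g := by
  have := entropicOp_convex (θ := 0) hμ hβ₀ hs hh hf hg hg le_rfl zero_le_one
    (by filter_upwards [hle] with x hx; simpa using hx)
  filter_upwards [this] with x hx
  simpa using hx

theorem entropicOp_congr_ae (hμ : Kernel.Invariant Q μ) (h : X × X → ℝ) (β : ℝ)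
    {f g : X → ℝ} (hfg : f =ᵐ[μ] g) : entropicOp Q h β f =ᵐ[μ] entropicOp Q h β g := by
  filter_upwards [ae_ae_of_ae_invariant hμ hfg] with x hx
  simp only [entropicOp]
  congr 2
  exact integral_congr_ae (by filter_upwards [hx] with y hy; rw [hy])

/-- At each step the exponents of the payoff moment combine to `β + (1 - β) = 1`, so that factor
does not grow with `n`, while the starting point is forgotten at the rate `β ^ n`. -/
theorem expMoment_one_iterate_le (hμ : Kernel.Invariant Q μ) {h : X × X → ℝ}
    (hh : Measurable h) {β k : ℝ} (hβ₀ : 0 < β) (hβ₁ : β < 1) (hk : 1 ≤ k * β)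
    {f : X → ℝ} (hf : Measurable f) (n : ℕ) :
    expMoment μ k 1 ((entropicOp Q h β)^[n] f) ≤ expMoment μ k 1 f ^ (β ^ n)
        * expMoment (μ ⊗ₘ Q) k 1 (fun z => β / (1 - β) * h z) := by
  have hk0 : 0 ≤ k := by
    by_contra hneg; push Not at hneg; nlinarith
  set H := expMoment (μ ⊗ₘ Q) k 1 (fun z => β / (1 - β) * h z)
  have hmeas : ∀ n, Measurable ((entropicOp Q h β)^[n] f) := by
    intro n
    induction n with
    | zero => simpa using hf
    | succ n ih => rw [Function.iterate_succ_apply']; exact measurable_entropicOp hh β ih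
  induction n with
  | zero =>
    simp only [Function.iterate_zero, id_eq, pow_zero, ENNReal.rpow_one]
    exact le_mul_of_one_le_right' (one_le_expMoment hk0 _ _)
  | succ n ih =>
    rw [Function.iterate_succ_apply']
    calc _ ≤ _ := expMoment_one_entropicOp_le hμ hh hβ₀ hβ₁ hk (hmeas n)
      _ ≤ (expMoment μ k 1 f ^ (β ^ n) * H) ^ β * H ^ (1 - β) := by
          gcongr
      _ = expMoment μ k 1 f ^ (β ^ (n + 1)) * H := by
          rw [ENNReal.mul_rpow_of_nonneg _ _ hβ₀.le, ← ENNReal.rpow_mul, ← pow_succ, mul_assoc,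
            ← ENNReal.rpow_add_of_nonneg _ _ hβ₀.le (by linarith)]
          simp

end EntropicOp

/-! ### Existence and uniqueness of the fixed point of the entropic operator -/

section

variable {E : Type*} [MeasurableSpace E] {μ : Measure E}

theorem lintegral_ofReal_abs_le_expMoment {k : ℝ} (hk : 1 ≤ k) (f : E → ℝ) :
    ∫⁻ x, ENNReal.ofReal |f x| ∂μ ≤ expMoment μ k 1 f := by
  rw [expMoment_one]
  refine lintegral_mono fun x => ENNReal.ofReal_le_ofReal ?_
  have := Real.add_one_le_exp (k * |f x|)
  nlinarith [abs_nonneg (f x)]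

theorem ae_summable_of_lintegral_le {w : ℕ → E → ℝ} (hw : ∀ n, Measurable (w n)) {ρ C : ℝ≥0∞}
    (hρ : ρ < 1) (hC : C < ∞) (h : ∀ n, ∫⁻ x, ENNReal.ofReal |w n x| ∂μ ≤ ρ ^ n * C) :
    ∀ᵐ x ∂μ, Summable fun n => |w n x| := by
  have h1 : ∫⁻ x, ∑' n, ENNReal.ofReal |w n x| ∂μ < ∞ := by
    rw [lintegral_tsum fun n => by have := hw n; fun_prop]
    calc _ ≤ ∑' n, ρ ^ n * C := ENNReal.tsum_le_tsum h
      _ = (1 - ρ)⁻¹ * C := by rw [ENNReal.tsum_mul_right, ENNReal.tsum_geometric]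
      _ < ∞ := ENNReal.mul_lt_top (by simpa using hρ) hC
  have h2 := ae_lt_top (Measurable.tsum fun n => by have := hw n; fun_prop) h1.ne
  filter_upwards [h2] with x hx
  have := ENNReal.summable_toReal hx.ne
  simpa using this

end

section FixedPoint

variable {X : Type*} [MeasurableSpace X] {Q : Kernel X X} [IsMarkovKernel Q]
  {μ : Measure X} [IsProbabilityMeasure μ]

/-- Young's inequality without its sharp constants. The conjugate exponent `s / (s - 1)` governs how
fast exponential moments of functions in the heart grow with their order. -/
theorem mul_le_rpow_add_rpow {c t s : ℝ} (hc : 0 ≤ c) (ht : 0 ≤ t) (hs : 1 < s) :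
    c * t ≤ t ^ s + c ^ (s / (s - 1)) := by
  have hs1 : 0 < s - 1 := by linarith
  have hq : (s - 1)⁻¹ + 1 = s / (s - 1) := by field_simp; ring
  have e1 : ∀ x : ℝ, 0 ≤ x → x ^ (s - 1) * x = x ^ s := fun x hx => by
    rw [← Real.rpow_add_one' hx (by linarith)]; simp
  rcases le_total c (t ^ (s - 1)) with h | h
  · have h1 := mul_le_mul_of_nonneg_right h ht
    rw [e1 t ht] at h1
    have := Real.rpow_nonneg hc (s / (s - 1))
    linarith
  · have h1 : t ≤ c ^ (s - 1)⁻¹ := by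
      have := Real.rpow_le_rpow (by positivity) h (by positivity : 0 ≤ (s - 1)⁻¹)
      rwa [Real.rpow_rpow_inv ht hs1.ne'] at this
    have h2 : c * c ^ (s - 1)⁻¹ = c ^ (s / (s - 1)) := by
      rw [← hq, Real.rpow_add_one' hc (by rw [hq]; positivity), mul_comm]
    have := mul_le_mul_of_nonneg_left h1 hc
    have := Real.rpow_nonneg ht s
    linarith

theorem iterate_entropicOp_convex (hμ : Kernel.Invariant Q μ) {h : X × X → ℝ} {β s θ : ℝ}
    (hβ₀ : 0 < β) (hβ₁ : β < 1) (hs : 1 < s) (hh : HasAllExpMoments (μ ⊗ₘ Q) s h)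
    {f g w : X → ℝ} (hf : HasAllExpMoments μ s f) (hg : HasAllExpMoments μ s g)
    (hw : HasAllExpMoments μ s w) (hθ : 0 ≤ θ) (hθ1 : θ ≤ 1)
    (hle : ∀ᵐ x ∂μ, f x ≤ (1 - θ) * g x + θ * w x) (n : ℕ) :
    ∀ᵐ x ∂μ, (entropicOp Q h β)^[n] f x
      ≤ (1 - θ) * (entropicOp Q h β)^[n] g x + θ * (entropicOp Q h β)^[n] w x := by
  induction n with
  | zero => simpa using hle
  | succ n ih =>
    simp only [Function.iterate_succ_apply']
    exact entropicOp_convex hμ hβ₀ hs.le hh (hf.entropicOp_iterate hμ hβ₀ hβ₁ hs hh n)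
      (hg.entropicOp_iterate hμ hβ₀ hβ₁ hs hh n) (hw.entropicOp_iterate hμ hβ₀ hβ₁ hs hh n)
      hθ hθ1 ih

theorem rpow_pow_le_self {a : ℝ≥0∞} (ha : 1 ≤ a) {β : ℝ} (hβ₀ : 0 < β) (hβ₁ : β < 1) (n : ℕ) :
    a ^ (β ^ n) ≤ a := by
  calc a ^ (β ^ n) ≤ a ^ (1 : ℝ) := ENNReal.rpow_le_rpow_of_exponent_le ha (pow_le_one₀ hβ₀.le hβ₁.le)
    _ = a := ENNReal.rpow_one a

/-- Iterates of the entropic operator from two starting points approach each other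
geometrically in `L¹`. -/
theorem exists_lintegral_iterate_sub_le (hμ : Kernel.Invariant Q μ) {h : X × X → ℝ} {β s : ℝ}
    (hβ₀ : 0 < β) (hβ₁ : β < 1) (hs : 1 < s) (hh : HasAllExpMoments (μ ⊗ₘ Q) s h)
    {f g : X → ℝ} (hf : HasAllExpMoments μ s f) (hg : HasAllExpMoments μ s g) :
    ∃ C : ℝ≥0∞, C < ∞ ∧ ∀ n : ℕ,
      ∫⁻ x, ENNReal.ofReal ((entropicOp Q h β)^[n] f x - (entropicOp Q h β)^[n] g x) ∂μ
        ≤ ENNReal.ofReal (β ^ ((s - 1) / s)) ^ n * C := by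
  have hs0 : 0 < s := by linarith
  have hs1 : 0 < s - 1 := by linarith
  -- Chosen so that `ρ ^ q = β` for the conjugate exponent `q`. Dilation by `ρ ^ (-n)` costs `exp
  -- (lam ^ q / β ^ n)` in the moment of order `lam`, exactly offset by the power `β ^ n` in
  -- `expMoment_one_iterate_le`.
  set ρ := β ^ ((s - 1) / s) with hρ
  have hρ0 : 0 < ρ := by positivity
  have hρ1 : ρ ≤ 1 := Real.rpow_le_one hβ₀.le hβ₁.le (by positivity)
  set q := s / (s - 1) with hq
  have hρq : ρ ^ q = β := by
    rw [hρ, ← Real.rpow_mul hβ₀.le]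
    have : (s - 1) / s * q = 1 := by rw [hq]; field_simp
    rw [this, Real.rpow_one]
  set lam := 1 / β with hlam
  have hlamβ : 1 ≤ lam * β := by rw [hlam]; field_simp; exact le_rfl
  have hlam1 : 1 ≤ lam := by rw [hlam, le_div_iff₀ hβ₀]; linarith
  have hh1 := hh.mono zero_le_one hs.le
  set H := expMoment (μ ⊗ₘ Q) lam 1 (fun z => β / (1 - β) * h z) with hH
  have hHfin : H < ∞ := (hh1.const_mul le_rfl _).2 lam (by linarith)
  set F : X → ℝ := fun x => |f x| + 2 * |g x| with hF
  have hFm : Measurable F := by have := hf.1; have := hg.1; fun_prop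
  have hFall : HasAllExpMoments μ s F := hf.of_le_add hs.le hg hFm zero_le_two fun x => by
    rw [abs_of_nonneg (by positivity)]
    have := abs_nonneg (f x)
    simp only [hF]; linarith
  refine ⟨ENNReal.ofReal (Real.exp (lam ^ q)) * expMoment μ 1 s F * H + expMoment μ lam 1 g * H,
    ?_, fun n => ?_⟩
  · refine ENNReal.add_lt_top.2 ⟨ENNReal.mul_lt_top (ENNReal.mul_lt_top ENNReal.ofReal_lt_top
      (hFall.2 1 one_pos)) hHfin, ENNReal.mul_lt_top ?_ hHfin⟩
    exact (hg.mono zero_le_one hs.le).2 lam (by linarith)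
  set θ := ρ ^ n with hθ
  have hθ0 : 0 < θ := by positivity
  have hθ1 : θ ≤ 1 := pow_le_one₀ hρ0.le hρ1
  have hθq : θ ^ q = β ^ n := by
    rw [hθ, ← Real.rpow_natCast, ← Real.rpow_mul hρ0.le, mul_comm, Real.rpow_mul hρ0.le, hρq,
      Real.rpow_natCast]
  -- The extrapolation with `f = (1 - θ) g + θ w`; convexity of the iterates then produces the small
  -- factor `θ`.
  set w : X → ℝ := fun x => g x + θ⁻¹ * (f x - g x) with hw
  have hwle : ∀ x, |w x| ≤ θ⁻¹ * F x := by
    intro x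
    have h1 : 1 ≤ θ⁻¹ := (one_le_inv₀ hθ0).2 hθ1
    calc |w x| ≤ |g x| + |θ⁻¹ * (f x - g x)| := abs_add_le _ _
      _ ≤ θ⁻¹ * |g x| + θ⁻¹ * (|f x| + |g x|) := by
          rw [abs_mul, abs_of_pos (inv_pos.2 hθ0)]
          gcongr
          · exact le_mul_of_one_le_left (abs_nonneg _) h1
          · exact abs_sub _ _
      _ = _ := by simp only [hF]; ring
  have hwm : Measurable w := by have := hf.1; have := hg.1; fun_prop
  have hwall : HasAllExpMoments μ s w :=
    hFall.of_le_add hs.le hFall hwm (inv_pos.2 hθ0).le fun x => (hwle x).trans (by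
      have : 0 ≤ F x := by simp only [hF]; positivity
      rw [abs_of_nonneg this]
      exact mul_le_mul_of_nonneg_left (by linarith) (inv_pos.2 hθ0).le)
  have hconv := iterate_entropicOp_convex hμ hβ₀ hβ₁ hs hh hf hg hwall hθ0.le hθ1
    (ae_of_all _ fun x => le_of_eq (by simp only [hw]; field_simp; ring)) n
  have hwmom : expMoment μ lam 1 w
      ≤ ENNReal.ofReal (Real.exp ((lam * θ⁻¹) ^ q)) * expMoment μ 1 s F := by
    rw [expMoment_one, expMoment, ← lintegral_const_mul' _ _ ENNReal.ofReal_ne_top]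
    refine lintegral_mono fun x => ?_
    rw [← ofReal_exp_add]
    refine ofReal_exp_mono ?_
    have hF0 : 0 ≤ F x := by simp only [hF]; positivity
    have := mul_le_rpow_add_rpow (by positivity : 0 ≤ lam * θ⁻¹) hF0 hs
    rw [abs_of_nonneg hF0]
    calc lam * |w x| ≤ lam * (θ⁻¹ * F x) := by gcongr; exact hwle x
      _ = lam * θ⁻¹ * F x := by ring
      _ ≤ _ := by rw [one_mul, hq]; linarith
  have hwit : expMoment μ lam 1 ((entropicOp Q h β)^[n] w)
      ≤ ENNReal.ofReal (Real.exp (lam ^ q)) * expMoment μ 1 s F * H := by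
    refine (expMoment_one_iterate_le hμ hh.1 hβ₀ hβ₁ hlamβ hwm n).trans ?_
    gcongr
    calc expMoment μ lam 1 w ^ (β ^ n)
        ≤ (ENNReal.ofReal (Real.exp ((lam * θ⁻¹) ^ q)) * expMoment μ 1 s F) ^ (β ^ n) := by gcongr
      _ = ENNReal.ofReal (Real.exp ((lam * θ⁻¹) ^ q * β ^ n)) * expMoment μ 1 s F ^ (β ^ n) := by
          rw [ENNReal.mul_rpow_of_nonneg _ _ (by positivity), ofReal_exp_rpow]
      _ ≤ _ := by
          have e : (lam * θ⁻¹) ^ q * β ^ n = lam ^ q := by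
            rw [Real.mul_rpow (by positivity) (by positivity), Real.inv_rpow hθ0.le, hθq]
            field_simp
          rw [e]
          gcongr
          exact rpow_pow_le_self (one_le_expMoment zero_le_one _ _) hβ₀ hβ₁ n
  have hgit : expMoment μ lam 1 ((entropicOp Q h β)^[n] g) ≤ expMoment μ lam 1 g * H := by
    refine (expMoment_one_iterate_le hμ hh.1 hβ₀ hβ₁ hlamβ hg.1 n).trans ?_
    gcongr
    exact rpow_pow_le_self (one_le_expMoment (by linarith) _ _) hβ₀ hβ₁ n
  have hwn := (hwall.entropicOp_iterate hμ hβ₀ hβ₁ hs hh n).1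
  calc _ ≤ ∫⁻ x, ENNReal.ofReal θ * (ENNReal.ofReal |(entropicOp Q h β)^[n] w x|
          + ENNReal.ofReal |(entropicOp Q h β)^[n] g x|) ∂μ := by
        refine lintegral_mono_ae ?_
        filter_upwards [hconv] with x hx
        rw [← ENNReal.ofReal_add (abs_nonneg _) (abs_nonneg _), ← ENNReal.ofReal_mul hθ0.le]
        refine ENNReal.ofReal_le_ofReal ?_
        have h1 := mul_le_mul_of_nonneg_left (le_abs_self ((entropicOp Q h β)^[n] w x)) hθ0.le
        have h2 := mul_le_mul_of_nonneg_left (neg_le_abs ((entropicOp Q h β)^[n] g x)) hθ0.le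
        linarith
    _ = ENNReal.ofReal θ * (∫⁻ x, ENNReal.ofReal |(entropicOp Q h β)^[n] w x| ∂μ
          + ∫⁻ x, ENNReal.ofReal |(entropicOp Q h β)^[n] g x| ∂μ) := by
        rw [lintegral_const_mul' _ _ ENNReal.ofReal_ne_top, lintegral_add_left (by fun_prop)]
    _ ≤ _ := by
        rw [hθ, ENNReal.ofReal_pow hρ0.le]
        gcongr
        · exact (lintegral_ofReal_abs_le_expMoment hlam1 _).trans hwit
        · exact (lintegral_ofReal_abs_le_expMoment hlam1 _).trans hgit

theorem ofReal_rpow_lt_one {β s : ℝ} (hβ₀ : 0 < β) (hβ₁ : β < 1) (hs : 1 < s) :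
    ENNReal.ofReal (β ^ ((s - 1) / s)) < 1 := by
  rw [ENNReal.ofReal_lt_one]
  exact Real.rpow_lt_one hβ₀.le hβ₁ (div_pos (by linarith) (by linarith))

/-- Iteration leaves both functions unchanged, so the geometric bound on the integral of `(f - g)⁺`
holds for every `n` and forces it to vanish. -/
theorem le_ae_of_fixedPoints (hμ : Kernel.Invariant Q μ) {h : X × X → ℝ} {β s : ℝ}
    (hβ₀ : 0 < β) (hβ₁ : β < 1) (hs : 1 < s) (hh : HasAllExpMoments (μ ⊗ₘ Q) s h)
    {f g : X → ℝ} (hf : HasAllExpMoments μ s f) (hg : HasAllExpMoments μ s g)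
    (hTf : entropicOp Q h β f =ᵐ[μ] f) (hTg : entropicOp Q h β g =ᵐ[μ] g) : f ≤ᵐ[μ] g := by
  have hit : ∀ f : X → ℝ, entropicOp Q h β f =ᵐ[μ] f → ∀ n : ℕ,
      (entropicOp Q h β)^[n] f =ᵐ[μ] f := by
    intro f hf n
    induction n with
    | zero => exact ae_eq_refl _
    | succ n ih =>
      rw [Function.iterate_succ_apply']
      exact (entropicOp_congr_ae hμ h β ih).trans hf
  obtain ⟨C, hC, hle⟩ := exists_lintegral_iterate_sub_le hμ hβ₀ hβ₁ hs hh hf hg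
  have h1 : ∀ n : ℕ, ∫⁻ x, ENNReal.ofReal (f x - g x) ∂μ
      ≤ ENNReal.ofReal (β ^ ((s - 1) / s)) ^ n * C := by
    intro n
    refine le_trans (le_of_eq (lintegral_congr_ae ?_)) (hle n)
    filter_upwards [hit f hTf n, hit g hTg n] with x h1 h2
    rw [h1, h2]
  have h2 : Tendsto (fun n : ℕ => ENNReal.ofReal (β ^ ((s - 1) / s)) ^ n * C) atTop (𝓝 (0 * C)) :=
    ENNReal.Tendsto.mul_const
      (ENNReal.tendsto_pow_atTop_nhds_zero_of_lt_one (ofReal_rpow_lt_one hβ₀ hβ₁ hs))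
      (Or.inr hC.ne)
  rw [zero_mul] at h2
  have h3 : ∫⁻ x, ENNReal.ofReal (f x - g x) ∂μ = 0 :=
    le_antisymm (ge_of_tendsto' h2 h1) zero_le
  have hfm := hf.1
  have hgm := hg.1
  rw [lintegral_eq_zero_iff (by fun_prop)] at h3
  filter_upwards [h3] with x hx
  have : f x - g x ≤ 0 := by simpa using hx
  linarith

theorem exists_lintegral_abs_iterate_sub_le (hμ : Kernel.Invariant Q μ) {h : X × X → ℝ} {β s : ℝ}
    (hβ₀ : 0 < β) (hβ₁ : β < 1) (hs : 1 < s) (hh : HasAllExpMoments (μ ⊗ₘ Q) s h)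
    {f g : X → ℝ} (hf : HasAllExpMoments μ s f) (hg : HasAllExpMoments μ s g) :
    ∃ C : ℝ≥0∞, C < ∞ ∧ ∀ n : ℕ,
      ∫⁻ x, ENNReal.ofReal |(entropicOp Q h β)^[n] f x - (entropicOp Q h β)^[n] g x| ∂μ
        ≤ ENNReal.ofReal (β ^ ((s - 1) / s)) ^ n * C := by
  obtain ⟨C₁, hC₁, h₁⟩ := exists_lintegral_iterate_sub_le hμ hβ₀ hβ₁ hs hh hf hg
  obtain ⟨C₂, hC₂, h₂⟩ := exists_lintegral_iterate_sub_le hμ hβ₀ hβ₁ hs hh hg hf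
  refine ⟨C₁ + C₂, ENNReal.add_lt_top.2 ⟨hC₁, hC₂⟩, fun n => ?_⟩
  have hfn := (hf.entropicOp_iterate hμ hβ₀ hβ₁ hs hh n).1
  have hgn := (hg.entropicOp_iterate hμ hβ₀ hβ₁ hs hh n).1
  rw [mul_add]
  refine le_trans (le_trans (lintegral_mono fun x => ?_) (le_of_eq (lintegral_add_left
    (f := fun x => ENNReal.ofReal
      ((entropicOp Q h β)^[n] f x - (entropicOp Q h β)^[n] g x)) (by fun_prop)
    (fun x => ENNReal.ofReal ((entropicOp Q h β)^[n] g x - (entropicOp Q h β)^[n] f x)))))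
    (add_le_add (h₁ n) (h₂ n))
  rcases abs_cases ((entropicOp Q h β)^[n] f x - (entropicOp Q h β)^[n] g x) with ⟨h, -⟩ | ⟨h, -⟩
  · rw [h]; exact le_self_add
  · rw [h, neg_sub]; exact le_add_self

theorem rpow_mul_rpow_le {a b : ℝ≥0∞} {β : ℝ} (hβ₀ : 0 < β) (hβ₁ : β < 1) (ha : a ≠ ∞)
    (hb : b ≠ ∞) :
    a ^ β * b ^ (1 - β) ≤ ENNReal.ofReal β * a + ENNReal.ofReal (1 - β) * b := by
  have hβ' : 0 < 1 - β := by linarith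
  rw [← ENNReal.ofReal_toReal ha, ← ENNReal.ofReal_toReal hb,
    ENNReal.ofReal_rpow_of_nonneg ENNReal.toReal_nonneg hβ₀.le,
    ENNReal.ofReal_rpow_of_nonneg ENNReal.toReal_nonneg hβ'.le, ← ENNReal.ofReal_mul (by positivity),
    ← ENNReal.ofReal_mul hβ₀.le, ← ENNReal.ofReal_mul hβ'.le,
    ← ENNReal.ofReal_add (by positivity) (by positivity)]
  exact ENNReal.ofReal_le_ofReal (Real.geom_mean_le_arith_mean2_weighted hβ₀.le hβ'.le
    ENNReal.toReal_nonneg ENNReal.toReal_nonneg (by ring))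

/-- With weighted arithmetic–geometric means the moments satisfy `a (n + 1) ≤ K' + β * a n + (1 - β)
* H`. The level `K' / (1 - β) + H` is invariant under this recursion. -/
theorem exists_forall_expMoment_iterate_zero_le (hμ : Kernel.Invariant Q μ) {h : X × X → ℝ}
    {β s k : ℝ} (hβ₀ : 0 < β) (hβ₁ : β < 1) (hs : 1 < s) (hk : 0 < k)
    (hh : HasAllExpMoments (μ ⊗ₘ Q) s h) :
    ∃ R : ℝ≥0∞, R < ∞ ∧ ∀ n : ℕ, expMoment μ k s ((entropicOp Q h β)^[n] fun _ => 0) ≤ R := by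
  obtain ⟨K, hK⟩ := expMoment_entropicOp_le hμ hh.1 hβ₀ hβ₁ hs hk
  set H := expMoment (μ ⊗ₘ Q) k s (fun z => β / (1 - β) * h z) with hH
  have hHfin : H < ∞ := (hh.const_mul hs.le _).2 k hk
  have hβ' : 0 < 1 - β := by linarith
  set K' := ENNReal.ofReal K
  refine ⟨K' * ENNReal.ofReal (1 - β)⁻¹ + H, ENNReal.add_lt_top.2
    ⟨ENNReal.mul_lt_top ENNReal.ofReal_lt_top ENNReal.ofReal_lt_top, hHfin⟩, fun n => ?_⟩
  induction n with
  | zero =>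
    refine le_add_left ?_
    have : expMoment μ k s (fun _ => 0) = 1 := by
      rw [expMoment, abs_zero, Real.zero_rpow (by linarith)]; simp
    simpa [this] using one_le_expMoment hk.le s (fun z => β / (1 - β) * h z)
  | succ n ih =>
    rw [Function.iterate_succ_apply']
    have hz := (HasAllExpMoments.zero (μ := μ) hs.le).entropicOp_iterate hμ hβ₀ hβ₁ hs hh n
    have hinv : 1 + ENNReal.ofReal β * ENNReal.ofReal (1 - β)⁻¹ = ENNReal.ofReal (1 - β)⁻¹ := by
      rw [← ENNReal.ofReal_mul hβ₀.le, ← ENNReal.ofReal_one,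
        ← ENNReal.ofReal_add zero_le_one (by positivity)]
      congr 1; field_simp; ring
    have hsum : ENNReal.ofReal β + ENNReal.ofReal (1 - β) = 1 := by
      rw [← ENNReal.ofReal_add hβ₀.le hβ'.le]; simp
    calc _ ≤ _ := hK _ hz.1
      _ ≤ K' + (ENNReal.ofReal β * expMoment μ k s ((entropicOp Q h β)^[n] fun _ => 0)
            + ENNReal.ofReal (1 - β) * H) := by
          gcongr
          exact rpow_mul_rpow_le hβ₀ hβ₁ (hz.2 k hk).ne hHfin.ne
      _ ≤ K' + (ENNReal.ofReal β * (K' * ENNReal.ofReal (1 - β)⁻¹ + H)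
            + ENNReal.ofReal (1 - β) * H) := by gcongr
      _ = K' * (1 + ENNReal.ofReal β * ENNReal.ofReal (1 - β)⁻¹)
            + (ENNReal.ofReal β + ENNReal.ofReal (1 - β)) * H := by ring
      _ = _ := by rw [hinv, hsum, one_mul]

/-- Existence of a fixed point of the entropic operator. -/
theorem exists_fixedPoint (hμ : Kernel.Invariant Q μ) {h : X × X → ℝ} {β s : ℝ}
    (hβ₀ : 0 < β) (hβ₁ : β < 1) (hs : 1 < s) (hh : HasAllExpMoments (μ ⊗ₘ Q) s h) :
    ∃ v : X → ℝ, HasAllExpMoments μ s v ∧ entropicOp Q h β v =ᵐ[μ] v := by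
  set T := entropicOp Q h β with hT
  set u : ℕ → X → ℝ := fun n => T^[n] fun _ => 0 with hu
  have hz := HasAllExpMoments.zero (μ := μ) hs.le
  have huall : ∀ n, HasAllExpMoments μ s (u n) := fun n =>
    hz.entropicOp_iterate hμ hβ₀ hβ₁ hs hh n
  have hρ := ofReal_rpow_lt_one hβ₀ hβ₁ hs
  -- The orbits of `0` and `T 0` differ by one time step, so the geometric `L¹` bound makes the
  -- increments summable almost everywhere.
  have hlim : ∀ᵐ x ∂μ, ∃ l, Tendsto (fun n => u n x) atTop (𝓝 l) := by
    obtain ⟨C, hC, hle⟩ := exists_lintegral_abs_iterate_sub_le hμ hβ₀ hβ₁ hs hh hz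
      (hz.entropicOp hμ hβ₀ hβ₁ hs hh)
    have := ae_summable_of_lintegral_le (w := fun n x => u n x - u (n + 1) x)
      (fun n => (huall n).1.sub (huall (n + 1)).1) hρ hC (fun n => by
        simpa only [hu, Function.iterate_succ_apply] using hle n)
    filter_upwards [this] with x hx
    exact cauchySeq_tendsto_of_complete (cauchySeq_of_summable_dist (by simpa [Real.dist_eq] using hx))
  obtain ⟨v, hvm, hv⟩ := measurable_limit_of_tendsto_metrizable_ae
    (fun n => (huall n).1.aemeasurable) hlim
  have hvall : HasAllExpMoments μ s v := by
    refine ⟨hvm, fun k hk => ?_⟩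
    obtain ⟨R, hR, hle⟩ := exists_forall_expMoment_iterate_zero_le hμ hβ₀ hβ₁ hs hk hh
    calc expMoment μ k s v
        ≤ ∫⁻ x, liminf (fun n => ENNReal.ofReal (Real.exp (k * |u n x| ^ s))) atTop ∂μ := by
          refine lintegral_mono_ae ?_
          filter_upwards [hv] with x hx
          have hcont : Continuous fun t : ℝ => ENNReal.ofReal (Real.exp (k * |t| ^ s)) :=
            ENNReal.continuous_ofReal.comp (Real.continuous_exp.comp (continuous_const.mul
              (continuous_abs.rpow_const fun _ => Or.inr (by linarith))))
          exact (((hcont.tendsto _).comp hx).liminf_eq).ge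
      _ ≤ liminf (fun n => expMoment μ k s (u n)) atTop :=
          lintegral_liminf_le fun n => by have := (huall n).1; fun_prop
      _ ≤ liminf (fun _ : ℕ => R) atTop := liminf_le_liminf (Eventually.of_forall hle)
      _ = R := liminf_const R
      _ < ∞ := hR
  -- Fatou's lemma gives only this direction; the converse uses the orbit of `v`, which is now
  -- decreasing.
  have hTv : T v ≤ᵐ[μ] v := by
    have hint : ∀ᵐ x ∂μ, ∀ n, Integrable (fun y => Real.exp (u n y + h (x, y))) (Q x) :=
      ae_all_iff.2 fun n => ae_integrable_exp_add hμ hs.le hh (huall n)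
    filter_upwards [hv, ae_ae_of_ae_invariant hμ hv, hint,
      ae_integrable_exp_add hμ hs.le hh hvall] with x hx hxy hun hvi
    have hhm := hh.1
    have h1 : ENNReal.ofReal (∫ y, Real.exp (v y + h (x, y)) ∂(Q x))
        ≤ ENNReal.ofReal (Real.exp (v x / β)) := by
      rw [← lintegral_ofReal_exp_eq hvi]
      calc _ ≤ ∫⁻ y, liminf (fun n => ENNReal.ofReal (Real.exp (u n y + h (x, y)))) atTop ∂(Q x) := by
            refine lintegral_mono_ae ?_
            filter_upwards [hxy] with y hy
            have hcont : Continuous fun t : ℝ => ENNReal.ofReal (Real.exp (t + h (x, y))) := by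
              exact ENNReal.continuous_ofReal.comp (by fun_prop)
            exact (((hcont.tendsto _).comp hy).liminf_eq).ge
        _ ≤ liminf (fun n => ∫⁻ y, ENNReal.ofReal (Real.exp (u n y + h (x, y))) ∂(Q x)) atTop :=
            lintegral_liminf_le fun n => by have := (huall n).1; fun_prop
        _ = liminf (fun n => ENNReal.ofReal (Real.exp (u (n + 1) x / β))) atTop := by
            congr 1; ext n
            rw [lintegral_ofReal_exp_eq (hun n)]
            congr 1
            simp only [hu, Function.iterate_succ_apply']
            simp only [hT, entropicOp]
            rw [mul_div_cancel_left₀ _ hβ₀.ne', Real.exp_log (integral_exp_pos (hun n))]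
        _ = _ := by
            have hcont : Continuous fun t : ℝ => ENNReal.ofReal (Real.exp (t / β)) := by
              exact ENNReal.continuous_ofReal.comp (by fun_prop)
            exact ((hcont.tendsto _).comp (hx.comp (tendsto_add_atTop_nat 1))).liminf_eq
    rw [ENNReal.ofReal_le_ofReal_iff (Real.exp_pos _).le] at h1
    have h2 := (Real.log_le_iff_le_exp (integral_exp_pos hvi)).2 h1
    simp only [hT, entropicOp]
    rw [le_div_iff₀ hβ₀] at h2
    linarith
  have hvit : ∀ n, HasAllExpMoments μ s (T^[n] v) := fun n =>
    hvall.entropicOp_iterate hμ hβ₀ hβ₁ hs hh n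
  have hanti : ∀ n : ℕ, T^[n + 1] v ≤ᵐ[μ] T^[n] v := by
    intro n
    induction n with
    | zero => simpa using hTv
    | succ n ih =>
      have := entropicOp_mono hμ hβ₀ hs.le hh (hvit (n + 1)) (hvit n) ih
      simpa only [Function.iterate_succ_apply'] using this
  -- The orbits of `v` and of `0` merge, so the decreasing orbit of `v` tends to `v` itself, whence
  -- `v ≤ T v`.
  have hconv : ∀ᵐ x ∂μ, Tendsto (fun n => T^[n] v x) atTop (𝓝 (v x)) := by
    obtain ⟨C, hC, hle⟩ := exists_lintegral_abs_iterate_sub_le hμ hβ₀ hβ₁ hs hh hvall hz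
    have := ae_summable_of_lintegral_le (w := fun n x => T^[n] v x - u n x)
      (fun n => (hvit n).1.sub (huall n).1) hρ hC hle
    filter_upwards [this, hv] with x hx hvx
    have h1 : Tendsto (fun n => T^[n] v x - u n x) atTop (𝓝 0) :=
      (tendsto_zero_iff_abs_tendsto_zero _).2 hx.tendsto_atTop_zero
    simpa using h1.add hvx
  refine ⟨v, hvall, ?_⟩
  filter_upwards [hTv, ae_all_iff.2 hanti, hconv] with x h1 h2 h3
  refine le_antisymm h1 ?_
  have hmono : Antitone fun n => T^[n] v x := antitone_nat_of_succ_le h2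
  have := hmono.le_of_tendsto h3 1
  simpa using this

end FixedPoint

/-! ### Change of reference measure -/

section ChangeOfMeasure

variable {E : Type*} [MeasurableSpace E] {μ ν : Measure E} [IsProbabilityMeasure μ]
  [IsProbabilityMeasure ν]

theorem HasAllExpMoments.of_rnDeriv_rpow {p : ℝ} (hp : 1 < p) (hν : ν ≪ μ)
    (hD : ∫⁻ x, (ν.rnDeriv μ x) ^ p ∂μ < ∞) {s : ℝ} {f : E → ℝ}
    (hf : HasAllExpMoments μ s f) : HasAllExpMoments ν s f := by
  have hm := hf.1
  refine ⟨hm, fun k hk => ?_⟩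
  have hpq := Real.HolderConjugate.conjExponent hp
  set q := p.conjExponent
  have h1 := ENNReal.lintegral_mul_le_Lp_mul_Lq μ hpq (f := ν.rnDeriv μ)
    (g := fun x => ENNReal.ofReal (Real.exp (k * |f x| ^ s)))
    (Measure.measurable_rnDeriv ν μ).aemeasurable (by fun_prop)
  have h2 : expMoment ν k s f
      = ∫⁻ x, (ν.rnDeriv μ * fun x => ENNReal.ofReal (Real.exp (k * |f x| ^ s))) x ∂μ := by
    rw [expMoment, ← lintegral_rnDeriv_mul hν (by fun_prop)]
    rfl
  rw [h2]
  refine h1.trans_lt (ENNReal.mul_lt_top ?_ ?_)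
  · exact ENNReal.rpow_lt_top_of_nonneg (by have := hpq.pos; positivity) hD.ne
  · refine ENNReal.rpow_lt_top_of_nonneg (by have := hpq.symm.pos; positivity) (ne_of_lt ?_)
    have := hf.2 (k * q) (mul_pos hk hpq.symm.pos)
    refine lt_of_le_of_lt (le_of_eq (lintegral_congr fun x => ?_)) this
    rw [ofReal_exp_rpow]; congr 2; ring

/-- Hölder for `1 = Δ ^ (-q⁻¹) * Δ ^ q⁻¹` with `q` conjugate to `p`. As `p / q = p - 1`, the first
factor gives the moment of order `1 - p`, and the second turns `μ` into `ν`. -/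
theorem HasAllExpMoments.of_rnDeriv_rpow_neg {p : ℝ} (hp : 1 < p) (hν : ν ≪ μ) (hμν : μ ≪ ν)
    (hD : ∫⁻ x, (ν.rnDeriv μ x) ^ (1 - p) ∂μ < ∞) {s : ℝ} {f : E → ℝ}
    (hf : HasAllExpMoments ν s f) : HasAllExpMoments μ s f := by
  have hm := hf.1
  refine ⟨hm, fun k hk => ?_⟩
  have hpq := Real.HolderConjugate.conjExponent hp
  set q := p.conjExponent
  set Δ := ν.rnDeriv μ with hΔ
  have hΔm : Measurable Δ := Measure.measurable_rnDeriv ν μ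
  have hp0 := hpq.pos
  have hq0 := hpq.symm.pos
  have hpqi := hpq.inv_add_inv_eq_one
  have h1 := ENNReal.lintegral_mul_le_Lp_mul_Lq μ hpq
    (f := fun x => Δ x ^ (-q⁻¹))
    (g := fun x => Δ x ^ q⁻¹ * ENNReal.ofReal (Real.exp (k * |f x| ^ s)))
    (by fun_prop) (by fun_prop)
  have h2 : expMoment μ k s f = ∫⁻ x, ((fun x => Δ x ^ (-q⁻¹)) *
      fun x => Δ x ^ q⁻¹ * ENNReal.ofReal (Real.exp (k * |f x| ^ s))) x ∂μ := by
    refine lintegral_congr_ae ?_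
    filter_upwards [Measure.rnDeriv_pos' hμν, Measure.rnDeriv_lt_top ν μ] with x h0 htop
    simp only [Pi.mul_apply]
    rw [← mul_assoc, ← ENNReal.rpow_add _ _ h0.ne' htop.ne]
    simp
  rw [h2]
  refine h1.trans_lt (ENNReal.mul_lt_top ?_ ?_)
  · refine ENNReal.rpow_lt_top_of_nonneg (by positivity) (ne_of_lt ?_)
    refine lt_of_le_of_lt (le_of_eq (lintegral_congr fun x => ?_)) hD
    rw [← ENNReal.rpow_mul]
    congr 1
    have : q⁻¹ = 1 - p⁻¹ := by linarith
    rw [this]; field_simp; ring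
  · refine ENNReal.rpow_lt_top_of_nonneg (by positivity) (ne_of_lt ?_)
    have := hf.2 (k * q) (mul_pos hk hq0)
    rw [expMoment, ← lintegral_rnDeriv_mul hν (by fun_prop)] at this
    refine lt_of_le_of_lt (le_of_eq (lintegral_congr fun x => ?_)) this
    rw [ENNReal.mul_rpow_of_nonneg _ _ hq0.le, ENNReal.rpow_inv_rpow hq0.ne', ofReal_exp_rpow]
    congr 3; ring

end ChangeOfMeasure

/-! ### Existence and uniqueness of the value function -/

section ValueFunction

variable {X : Type*} [MeasurableSpace X]

/-- Existence and uniqueness for the value recursion, when it can be written as an entropic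
recursion relative to an equivalent reference measure `μ` that is invariant under `R`. -/
theorem isUniqueValueFunction_valueFunction {Q₀ μ : Measure X} [IsProbabilityMeasure Q₀]
    [IsProbabilityMeasure μ] {R κ : Kernel X X} [IsMarkovKernel R] (hμ : Kernel.Invariant R μ)
    {u h : X × X → ℝ} {α β r : ℝ} (hβ₀ : 0 < β) (hβ₁ : β < 1) (hr : 1 < r)
    (hh : HasAllExpMoments (μ ⊗ₘ R) r h) (hop : ∀ f, valueOp u α β κ f = entropicOp R h β f)
    (hQμ : Q₀ ≪ μ) (hμQ : μ ≪ Q₀)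
    (hmom : ∀ (s : ℝ) (f : X → ℝ), HasAllExpMoments Q₀ s f ↔ HasAllExpMoments μ s f) :
    IsUniqueValueFunction Q₀ u α β r κ (valueFunction Q₀ u α β r κ) := by
  have hiff : ∀ s : ℝ, 1 < s → ∀ f, IsValueFixedPoint Q₀ u α β s κ f ↔
      HasAllExpMoments μ s f ∧ entropicOp R h β f =ᵐ[μ] f := by
    intro s hs f
    rw [IsValueFixedPoint, memOrliczHeart_iff hs.le, hmom, hop]
    exact and_congr_right fun _ => ⟨fun H => hμQ.ae_eq H, fun H => hQμ.ae_eq H⟩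
  have hex : ∃ f, IsValueFixedPoint Q₀ u α β r κ f := by
    obtain ⟨v, hv⟩ := exists_fixedPoint hμ hβ₀ hβ₁ hr hh
    exact ⟨v, (hiff r hr v).2 hv⟩
  have hfix : IsValueFixedPoint Q₀ u α β r κ (valueFunction Q₀ u α β r κ) := by
    rw [valueFunction, dif_pos hex]
    exact hex.choose_spec
  refine ⟨hfix, fun s hs hsr g hg => ?_⟩
  obtain ⟨hg1, hg2⟩ := (hiff s hs g).1 hg
  obtain ⟨hf1, hf2⟩ := (hiff r hr _).1 hfix
  have hf1' := hf1.mono (by linarith) hsr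
  have hh' := hh.mono (by linarith) hsr
  refine hQμ.ae_eq ?_
  filter_upwards [le_ae_of_fixedPoints hμ hβ₀ hβ₁ hs hh' hg1 hf1' hg2 hf2,
    le_ae_of_fixedPoints hμ hβ₀ hβ₁ hs hh' hf1' hg1 hf2 hg2] with x h1 h2
  exact le_antisymm h1 h2

/-- The value function is well defined under the benchmark model. -/
theorem isUniqueValueFunction_benchmark {Q : Kernel X X} [IsMarkovKernel Q]
    {Q₀ : Measure X} [IsProbabilityMeasure Q₀]
    (hQ₀ : Kernel.Invariant Q Q₀) {u : X × X → ℝ} {α β r : ℝ} (hβ₀ : 0 < β) (hβ₁ : β < 1)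
    (hr : 1 < r) (hu : MemOrliczHeart (Q₀ ⊗ₘ Q) r u) :
    IsUniqueValueFunction Q₀ u α β r Q (valueFunction Q₀ u α β r Q) :=
  isUniqueValueFunction_valueFunction hQ₀ hβ₀ hβ₁ hr
    (((memOrliczHeart_iff hr.le).1 hu).const_mul hr.le α) (fun _ => rfl)
    Measure.AbsolutelyContinuous.rfl Measure.AbsolutelyContinuous.rfl fun _ _ => Iff.rfl

variable [MeasurableSpace.CountablyGenerated X] {Q κ : Kernel X X}

theorem measurable_logLikelihoodRatio : Measurable (logLikelihoodRatio Q κ) :=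
  Real.measurable_log.comp (Kernel.measurable_rnDeriv κ Q).ennreal_toReal

variable [IsMarkovKernel Q] [IsMarkovKernel κ]

/-- Mutual absolute continuity makes the density positive and finite, so the default values of
`Real.log` and `toReal` do not intervene. -/
theorem ae_exp_logLikelihoodRatio (hQκ : EverywhereEquivalent Q κ) (x : X) :
    ∀ᵐ y ∂(Q x), Real.exp (logLikelihoodRatio Q κ (x, y)) = ((κ x).rnDeriv (Q x) y).toReal := by
  filter_upwards [Kernel.rnDeriv_eq_rnDeriv_measure (κ := κ) (η := Q) (a := x),
    Measure.rnDeriv_pos' (hQκ x).1, Measure.rnDeriv_lt_top (κ x) (Q x)] with y h1 h2 h3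
  rw [logLikelihoodRatio]
  simp only [h1]
  exact Real.exp_log (ENNReal.toReal_pos h2.ne' h3.ne)

theorem integral_exp_logLikelihoodRatio (hQκ : EverywhereEquivalent Q κ) (x : X) :
    ∫ y, Real.exp (logLikelihoodRatio Q κ (x, y)) ∂(Q x) = 1 := by
  rw [integral_congr_ae (ae_exp_logLikelihoodRatio hQκ x),
    Measure.integral_toReal_rnDeriv (hQκ x).2]
  simp

/-- The log-likelihood ratio becomes part of the payoff, so all alternatives are compared through
one kernel `Q` and one invariant measure. -/
theorem valueOp_eq_entropicOp (hQκ : EverywhereEquivalent Q κ) (u : X × X → ℝ) (α β : ℝ)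
    (f : X → ℝ) :
    valueOp u α β κ f = entropicOp Q (fun z => α * u z + logLikelihoodRatio Q κ z) β f := by
  ext x
  simp only [valueOp, entropicOp]
  rw [← integral_rnDeriv_smul (hQκ x).2]
  congr 2
  refine integral_congr_ae ?_
  filter_upwards [ae_exp_logLikelihoodRatio hQκ x] with y hy
  rw [← add_assoc, Real.exp_add _ (logLikelihoodRatio Q κ (x, y)), hy, smul_eq_mul, mul_comm]

/-- The value function is well defined under every regular alternative model. -/
theorem isUniqueValueFunction_of_satisfiesAM2 {Q₀ : Measure X} [IsProbabilityMeasure Q₀]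
    (hQ₀ : Kernel.Invariant Q Q₀) {u : X × X → ℝ} {α β r M : ℝ} (hβ₀ : 0 < β) (hβ₁ : β < 1)
    (hr : 1 < r) (hu : MemOrliczHeart (Q₀ ⊗ₘ Q) r u) (hκ : SatisfiesAM2 Q₀ Q u α β r M κ) :
    IsUniqueValueFunction Q₀ u α β r κ (valueFunction Q₀ u α β r κ) := by
  have hu' := ((memOrliczHeart_iff hr.le).1 hu).const_mul hr.le α
  obtain ⟨hQκ, ⟨hl, -, -⟩ | ⟨-, κ₀, hκ₀, hinv, hQκ₀, hκ₀Q, p, hp, h1, h2, h3⟩⟩ := hκ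
  -- Case (a): kernel `Q`, reference measure `Q₀`, payoff `α u + ℓ`.
  · exact isUniqueValueFunction_valueFunction hQ₀ hβ₀ hβ₁ hr
      (hu'.add hr.le ((memOrliczHeart_iff hr.le).1 hl)) (valueOp_eq_entropicOp hQκ u α β)
      Measure.AbsolutelyContinuous.rfl Measure.AbsolutelyContinuous.rfl fun _ _ => Iff.rfl
  -- Case (b): kernel `κ`, reference measure `κ₀`, payoff `α u`. The moments of `dκ₀/dQ₀` of orders
  -- `p` and `1 - p` identify the function classes, and the joint density transfers the payoff.
  · refine isUniqueValueFunction_valueFunction hinv hβ₀ hβ₁ hr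
      (hu'.of_rnDeriv_rpow hp ?_ (h3.trans_lt ENNReal.ofReal_lt_top)) (fun _ => rfl) hQκ₀ hκ₀Q
      fun s f => ⟨fun H => H.of_rnDeriv_rpow hp hκ₀Q (h1.trans_lt ENNReal.ofReal_lt_top),
        fun H => H.of_rnDeriv_rpow_neg hp hκ₀Q hQκ₀ (h2.trans_lt ENNReal.ofReal_lt_top)⟩
    exact Measure.AbsolutelyContinuous.compProd hκ₀Q (ae_of_all _ fun x => (hQκ x).2)

end ValueFunction

/-! ### The Luxemburg norm for the exponential Young function -/

section OrliczNorm

variable {E : Type*} [MeasurableSpace E] {μ : Measure E}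

theorem orliczNorm_mono {s : ℝ} (hs : 0 ≤ s) {f g : E → ℝ} (h : ∀ᵐ x ∂μ, |f x| ≤ |g x|) :
    orliczNorm μ s f ≤ orliczNorm μ s g := by
  refine le_iInf₂ fun c hc => iInf₂_le c ⟨hc.1, le_trans (lintegral_mono_ae ?_) hc.2⟩
  filter_upwards [h] with x hx
  refine ENNReal.ofReal_le_ofReal (sub_le_sub_right (Real.exp_le_exp.2 ?_) 1)
  exact Real.rpow_le_rpow (div_nonneg (abs_nonneg _) hc.1.le)
    (div_le_div_of_nonneg_right hx hc.1.le) hs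

theorem orliczNorm_le_const_mul {s s' : ℝ} {f g : E → ℝ} {K : ℝ} (hK : 0 < K)
    (h : ∀ c : ℝ, 0 < c → orliczModular μ s f c ≤ 1 → orliczNorm μ s' g ≤ ENNReal.ofReal (K * c)) :
    orliczNorm μ s' g ≤ ENNReal.ofReal K * orliczNorm μ s f := by
  have h0 : ENNReal.ofReal K ≠ 0 := by simpa using hK
  rw [orliczNorm.eq_def μ s f]
  simp_rw [ENNReal.mul_iInf_of_ne h0 ENNReal.ofReal_ne_top]
  refine le_iInf₂ fun c hc => ?_
  rw [← ENNReal.ofReal_mul hK.le]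
  exact h c hc.1 hc.2

variable [IsProbabilityMeasure μ]

theorem orliczModular_le_one_iff {c : ℝ} (hc : 0 < c) (f : E → ℝ) :
    orliczModular μ 1 f c ≤ 1 ↔ expMoment μ c⁻¹ 1 f ≤ 2 := by
  have h : expMoment μ c⁻¹ 1 f = orliczModular μ 1 f c + 1 := by
    rw [expMoment_eq_orliczModular_add_one one_pos (by positivity)]
    congr 2
    rw [inv_one, Real.rpow_neg_one, inv_inv]
  rw [h, ← one_add_one_eq_two]
  exact (ENNReal.add_le_add_iff_right ENNReal.one_ne_top).symm

theorem orliczNorm_le_ofReal {c : ℝ} (hc : 0 < c) {f : E → ℝ} (h : expMoment μ c⁻¹ 1 f ≤ 2) :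
    orliczNorm μ 1 f ≤ ENNReal.ofReal c :=
  iInf₂_le c ⟨hc, (orliczModular_le_one_iff hc f).2 h⟩

/-- Strictness supplies an admissible constant below `c`, so the infimum need not be attained. -/
theorem expMoment_le_two_of_orliczNorm_lt {c : ℝ} {f : E → ℝ}
    (h : orliczNorm μ 1 f < ENNReal.ofReal c) : expMoment μ c⁻¹ 1 f ≤ 2 := by
  simp only [orliczNorm, iInf_lt_iff] at h
  obtain ⟨c', ⟨hc'0, hc'⟩, hlt⟩ := h
  have hlt' : c' < c := (ENNReal.ofReal_lt_ofReal_iff_of_nonneg hc'0.le).1 hlt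
  refine le_trans (expMoment_mono_left ?_ 1 f) ((orliczModular_le_one_iff hc'0 f).1 hc')
  exact inv_anti₀ hc'0 hlt'.le

theorem orliczNorm_add_le {f g : E → ℝ} (hf : Measurable f) :
    orliczNorm μ 1 (fun x => f x + g x) ≤ orliczNorm μ 1 f + orliczNorm μ 1 g := by
  refine ENNReal.le_of_forall_pos_le_add fun ε hε hfin => ?_
  obtain ⟨hf1, hg1⟩ := ENNReal.add_lt_top.1 hfin
  have key : ∀ w : E → ℝ, orliczNorm μ 1 w < ∞ → 0 < (orliczNorm μ 1 w).toReal + (ε : ℝ) / 2 ∧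
      expMoment μ ((orliczNorm μ 1 w).toReal + (ε : ℝ) / 2)⁻¹ 1 w ≤ 2 := by
    intro w hw
    have hε' : (0 : ℝ) < ε := hε
    have h0 : 0 < (orliczNorm μ 1 w).toReal + (ε : ℝ) / 2 := by positivity
    refine ⟨h0, expMoment_le_two_of_orliczNorm_lt ?_⟩
    rw [ENNReal.lt_ofReal_iff_toReal_lt hw.ne]
    linarith
  obtain ⟨hc, hfc⟩ := key f hf1
  obtain ⟨hd, hgd⟩ := key g hg1
  set c := (orliczNorm μ 1 f).toReal + (ε : ℝ) / 2 with hcdef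
  set d := (orliczNorm μ 1 g).toReal + (ε : ℝ) / 2 with hddef
  have hcd : 0 < c + d := by positivity
  have hsum : expMoment μ (c + d)⁻¹ 1 (fun x => f x + g x) ≤ 2 := by
    rw [expMoment_one] at hfc hgd ⊢
    calc _ ≤ ∫⁻ x, (ENNReal.ofReal (c / (c + d)) * ENNReal.ofReal (Real.exp (c⁻¹ * |f x|))
          + ENNReal.ofReal (d / (c + d)) * ENNReal.ofReal (Real.exp (d⁻¹ * |g x|))) ∂μ := by
          refine lintegral_mono fun x => ?_
          rw [← ENNReal.ofReal_mul (by positivity), ← ENNReal.ofReal_mul (by positivity),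
            ← ENNReal.ofReal_add (by positivity) (by positivity)]
          refine ENNReal.ofReal_le_ofReal ?_
          have h1 := convexOn_exp.2 (Set.mem_univ (c⁻¹ * |f x|)) (Set.mem_univ (d⁻¹ * |g x|))
            (by positivity : 0 ≤ c / (c + d)) (by positivity : 0 ≤ d / (c + d))
            (by field_simp)
          simp only [smul_eq_mul] at h1
          refine le_trans (Real.exp_le_exp.2 ?_) h1
          calc (c + d)⁻¹ * |f x + g x| ≤ (c + d)⁻¹ * (|f x| + |g x|) := by
                gcongr; exact abs_add_le _ _
            _ = _ := by field_simp
      _ = ENNReal.ofReal (c / (c + d)) * ∫⁻ x, ENNReal.ofReal (Real.exp (c⁻¹ * |f x|)) ∂μ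
          + ENNReal.ofReal (d / (c + d)) * ∫⁻ x, ENNReal.ofReal (Real.exp (d⁻¹ * |g x|)) ∂μ := by
          rw [lintegral_add_left (by fun_prop), lintegral_const_mul' _ _ ENNReal.ofReal_ne_top,
            lintegral_const_mul' _ _ ENNReal.ofReal_ne_top]
      _ ≤ ENNReal.ofReal (c / (c + d)) * 2 + ENNReal.ofReal (d / (c + d)) * 2 := by gcongr
      _ = 2 := by
          rw [← add_mul, ← ENNReal.ofReal_add (by positivity) (by positivity), ← add_div,
            div_self hcd.ne']
          simp
  refine (orliczNorm_le_ofReal hcd hsum).trans (le_of_eq ?_)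
  have : c + d = (orliczNorm μ 1 f).toReal + (orliczNorm μ 1 g).toReal + ε := by
    rw [hcdef, hddef]; ring
  rw [this, ENNReal.ofReal_add (by positivity) (by positivity),
    ENNReal.ofReal_add (by positivity) (by positivity), ENNReal.ofReal_toReal hf1.ne,
    ENNReal.ofReal_toReal hg1.ne, ENNReal.ofReal_coe_nnreal]

theorem orliczNorm_const_mul_le {a : ℝ} (ha : 0 < a) (f : E → ℝ) :
    orliczNorm μ 1 (fun x => a * f x) ≤ ENNReal.ofReal a * orliczNorm μ 1 f := by
  refine orliczNorm_le_const_mul ha fun c hc hf => orliczNorm_le_ofReal (by positivity) ?_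
  rw [orliczModular_le_one_iff hc, expMoment_one] at hf
  rw [expMoment_one]
  refine le_trans (le_of_eq (lintegral_congr fun x => ?_)) hf
  rw [abs_mul, abs_of_pos ha]
  congr 2; field_simp

theorem orliczNorm_one_zero : orliczNorm μ 1 (fun _ => 0) = 0 := by
  refine le_antisymm (ENNReal.le_of_forall_pos_le_add fun ε hε _ => ?_) zero_le
  rw [zero_add, ← ENNReal.ofReal_coe_nnreal]
  refine orliczNorm_le_ofReal hε ?_
  rw [expMoment_one]; simp

theorem orliczNorm_sum_le {ι : Type*} (S : Finset ι) {f : ι → E → ℝ}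
    (hf : ∀ i, Measurable (f i)) :
    orliczNorm μ 1 (fun x => ∑ i ∈ S, f i x) ≤ ∑ i ∈ S, orliczNorm μ 1 (f i) := by
  classical
  induction S using Finset.induction_on with
  | empty => simp [orliczNorm_one_zero]
  | insert i S hi ih =>
    simp only [Finset.sum_insert hi]
    exact (orliczNorm_add_le (hf i)).trans (by gcongr)

/-- Jensen's inequality. Lowering the order takes a root of the moment bound, which converts any
finite bound into the bound `2` required by the norm. -/
theorem expMoment_rpow_le {k k' : ℝ} (hk : 0 < k) (hkk : k ≤ k') (s : ℝ) {f : E → ℝ}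
    (hf : Measurable f) : expMoment μ k s f ≤ expMoment μ k' s f ^ (k / k') := by
  have hk' : 0 < k' := hk.trans_le hkk
  have h := lintegral_rpow_le_lintegral_rpow (ν := μ)
    (F := fun x => ENNReal.ofReal (Real.exp (k * |f x| ^ s))) (by fun_prop)
    ((one_le_div hk).2 hkk)
  have h2 : ∫⁻ x, ENNReal.ofReal (Real.exp (k * |f x| ^ s)) ^ (k' / k) ∂μ = expMoment μ k' s f := by
    refine lintegral_congr fun x => ?_
    rw [ofReal_exp_rpow]; congr 2; field_simp
  rw [h2] at h
  calc expMoment μ k s f = (expMoment μ k s f ^ (k' / k)) ^ (k / k') := by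
        rw [← ENNReal.rpow_mul]
        have : k' / k * (k / k') = 1 := by field_simp
        rw [this, ENNReal.rpow_one]
    _ ≤ _ := ENNReal.rpow_le_rpow h (by positivity)

/-- From `t ≤ 1 + t ^ s` the moment at scale `c` is at most `2 * exp 1 ≤ 8`, and the cube root of
`8` is `2`; hence the constant `3`. -/
theorem orliczNorm_one_le_three_mul {s : ℝ} (hs : 1 ≤ s) {f : E → ℝ} (hf : Measurable f) :
    orliczNorm μ 1 f ≤ ENNReal.ofReal 3 * orliczNorm μ s f := by
  refine orliczNorm_le_const_mul (by norm_num) fun c hc hfc => orliczNorm_le_ofReal (by positivity) ?_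
  have h1 : ∫⁻ x, ENNReal.ofReal (Real.exp ((|f x| / c) ^ s)) ∂μ ≤ 2 := by
    rw [lintegral_ofReal_exp_eq_orliczModular_add_one hc.le, ← one_add_one_eq_two]
    gcongr
  have h2 : expMoment μ c⁻¹ 1 f ≤ ENNReal.ofReal 8 := by
    calc expMoment μ c⁻¹ 1 f
        ≤ ∫⁻ x, ENNReal.ofReal (Real.exp 1) * ENNReal.ofReal (Real.exp ((|f x| / c) ^ s)) ∂μ := by
          rw [expMoment_one]
          refine lintegral_mono fun x => ?_
          rw [← ofReal_exp_add]
          refine ofReal_exp_mono ?_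
          rw [← div_eq_inv_mul]
          have h0 : 0 ≤ |f x| / c := by positivity
          rcases le_total (|f x| / c) 1 with h | h
          · linarith [Real.rpow_nonneg h0 s]
          · have := Real.rpow_le_rpow_of_exponent_le h hs
            rw [Real.rpow_one] at this
            linarith
      _ = ENNReal.ofReal (Real.exp 1) * ∫⁻ x, ENNReal.ofReal (Real.exp ((|f x| / c) ^ s)) ∂μ :=
          lintegral_const_mul' _ _ ENNReal.ofReal_ne_top
      _ ≤ ENNReal.ofReal (Real.exp 1) * ENNReal.ofReal 2 := by gcongr; simpa using h1
      _ ≤ ENNReal.ofReal 8 := by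
          rw [← ENNReal.ofReal_mul (by positivity)]
          exact ENNReal.ofReal_le_ofReal (by linarith [Real.exp_one_lt_d9])
  calc expMoment μ (3 * c)⁻¹ 1 f ≤ expMoment μ c⁻¹ 1 f ^ ((3 * c)⁻¹ / c⁻¹) :=
        expMoment_rpow_le (by positivity) (inv_anti₀ hc (by linarith)) 1 hf
    _ ≤ ENNReal.ofReal 8 ^ ((3 * c)⁻¹ / c⁻¹) := by gcongr
    _ = 2 := by
        have : (3 * c)⁻¹ / c⁻¹ = 3⁻¹ := by field_simp
        rw [this, show (8 : ℝ) = 2 ^ (3 : ℝ) by norm_num,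
          ENNReal.ofReal_rpow_of_pos (by positivity), Real.rpow_rpow_inv (by norm_num) (by norm_num)]
        simp

theorem HasAllExpMoments.orliczNorm_lt_top {f : E → ℝ} {s : ℝ} (hs : 1 ≤ s)
    (hf : HasAllExpMoments μ s f) :
    orliczNorm μ 1 f < ∞ :=
  ((memOrliczHeart_iff le_rfl).2 (hf.mono zero_le_one hs)).1.2

end OrliczNorm

/-! ### Weighted conditional expectations -/

section WeightedOp

variable {X : Type*} [MeasurableSpace X] {Q : Kernel X X} [IsMarkovKernel Q]
  {μ : Measure X} [IsProbabilityMeasure μ] {m : X × X → ℝ≥0∞}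

/-- The operator `F ↦ E^Q[m(X_t, X_{t+1}) F(X_{t+1}) | X_t]`. -/
noncomputable def weightedOp (Q : Kernel X X) (m : X × X → ℝ≥0∞) (F : X → ℝ≥0∞) : X → ℝ≥0∞ :=
  fun x => ∫⁻ y, m (x, y) * F y ∂(Q x)

theorem measurable_weightedOp (hm : Measurable m) {F : X → ℝ≥0∞} (hF : Measurable F) :
    Measurable (weightedOp Q m F) :=
  Measurable.lintegral_kernel_prod_right (κ := Q) (f := fun x y => m (x, y) * F y)
    (by simp only [Function.uncurry_def]; fun_prop)

theorem measurable_weightedOp_iterate (hm : Measurable m) {F : X → ℝ≥0∞} (hF : Measurable F)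
    (j : ℕ) : Measurable ((weightedOp Q m)^[j] F) := by
  induction j with
  | zero => simpa using hF
  | succ j ih => rw [Function.iterate_succ_apply']; exact measurable_weightedOp hm ih

theorem weightedOp_mono {R : Kernel X X} {F G : X → ℝ≥0∞} (h : ∀ x, F x ≤ G x) (x : X) :
    weightedOp R m F x ≤ weightedOp R m G x :=
  lintegral_mono fun y => mul_le_mul_right (h y) _

theorem weightedOp_iterate_mono_ae (hμ : Kernel.Invariant Q μ) {F G : X → ℝ≥0∞}
    (h : F ≤ᵐ[μ] G) (j : ℕ) : (weightedOp Q m)^[j] F ≤ᵐ[μ] (weightedOp Q m)^[j] G := by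
  induction j with
  | zero => simpa using h
  | succ j ih =>
    simp only [Function.iterate_succ_apply']
    filter_upwards [ae_ae_of_ae_invariant hμ ih] with x hx
    refine lintegral_mono_ae ?_
    filter_upwards [hx] with y hy
    gcongr

theorem weightedOp_iterate_add_const_mul (hm : Measurable m) {F G : X → ℝ≥0∞} (hF : Measurable F)
    (hG : Measurable G) (c : ℝ≥0∞) (j : ℕ) :
    (weightedOp Q m)^[j] (fun x => F x + c * G x)
      = fun x => (weightedOp Q m)^[j] F x + c * (weightedOp Q m)^[j] G x := by
  induction j with
  | zero => rfl
  | succ j ih =>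
    simp only [Function.iterate_succ_apply', ih]
    have hFj := measurable_weightedOp_iterate (Q := Q) hm hF j
    have hGj := measurable_weightedOp_iterate (Q := Q) hm hG j
    ext x
    simp only [weightedOp] at hFj hGj ⊢
    rw [← lintegral_const_mul _ (by fun_prop), ← lintegral_add_left (by fun_prop)]
    refine lintegral_congr fun y => ?_
    ring

/-- A finite Neumann expansion. The remainder is kept, to be absorbed later for one well-chosen `N`.
-/
theorem le_sum_weightedOp_iterate (hμ : Kernel.Invariant Q μ) (hm : Measurable m)
    {D d : X → ℝ≥0∞} (hD : Measurable D) (hd : Measurable d) {b : ℝ≥0∞}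
    (h : ∀ᵐ x ∂μ, D x ≤ d x + b * weightedOp Q m D x) (N : ℕ) :
    ∀ᵐ x ∂μ, D x ≤ ∑ j ∈ Finset.range N, b ^ j * (weightedOp Q m)^[j] d x
      + b ^ N * (weightedOp Q m)^[N] D x := by
  induction N with
  | zero => simp
  | succ N ih =>
    have h1 := weightedOp_iterate_mono_ae (m := m) hμ h N
    rw [weightedOp_iterate_add_const_mul hm hd (measurable_weightedOp hm hD)] at h1
    filter_upwards [ih, h1] with x hx h1x
    refine hx.trans ?_
    rw [Finset.sum_range_succ, add_assoc]
    gcongr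
    calc b ^ N * (weightedOp Q m)^[N] D x
        ≤ b ^ N * ((weightedOp Q m)^[N] d x + b * (weightedOp Q m)^[N] (weightedOp Q m D) x) := by
          gcongr
      _ = _ := by rw [← Function.iterate_succ_apply, pow_succ]; ring

/-- By `hm1` the measure with density `m (x, ·)` with respect to `Q x` is a probability, so Jensen's
inequality applies at each of the `j` steps. -/
theorem exp_weightedOp_iterate_le (hm : Measurable m) (hm1 : ∀ x, ∫⁻ y, m (x, y) ∂(Q x) = 1)
    {D : X → ℝ≥0∞} (hD : Measurable D) (j : ℕ) (x : X) :
    ENNReal.ofReal (Real.exp ((weightedOp Q m)^[j] D x).toReal)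
      ≤ (weightedOp Q m)^[j] (fun y => ENNReal.ofReal (Real.exp (D y).toReal)) x := by
  induction j generalizing x with
  | zero => exact le_rfl
  | succ j ih =>
    simp only [Function.iterate_succ_apply']
    refine le_trans ?_ (weightedOp_mono ih x)
    have hDj := measurable_weightedOp_iterate (Q := Q) hm hD j
    have hmx : Measurable fun y => m (x, y) := hm.comp measurable_prodMk_left
    have hprob : IsProbabilityMeasure ((Q x).withDensity fun y => m (x, y)) :=
      ⟨by rw [withDensity_apply _ MeasurableSet.univ]; simpa using hm1 x⟩
    have := exp_toReal_lintegral_le (ν := (Q x).withDensity fun y => m (x, y)) hDj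
    rw [lintegral_withDensity_eq_lintegral_mul _ hmx hDj,
      lintegral_withDensity_eq_lintegral_mul _ hmx (by fun_prop)] at this
    exact this

/-- Each step is Hölder with `m` in `L^{2N}` and raises the reciprocal exponent by `1 / (2N)`.
Starting from `L²`, exactly `N` steps are possible before `L¹` is reached. -/
theorem lintegral_weightedOp_iterate_rpow_le (hμ : Kernel.Invariant Q μ) (hm : Measurable m)
    {F : X → ℝ≥0∞} (hF : Measurable F) {N : ℕ} (hN : 0 < N) {j : ℕ} (hj : j ≤ N) :
    (∫⁻ x, (weightedOp Q m)^[j] F x ^ (2 * N / (N + j) : ℝ) ∂μ) ^ (1 / (2 * N / (N + j) : ℝ))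
      ≤ (∫⁻ z, m z ^ (2 * N : ℝ) ∂(μ ⊗ₘ Q)) ^ (j / (2 * N) : ℝ)
        * (∫⁻ x, F x ^ (2 : ℝ) ∂μ) ^ (1 / 2 : ℝ) := by
  have hN0 : (0 : ℝ) < N := by exact_mod_cast hN
  have hN1 : (1 : ℝ) ≤ N := by exact_mod_cast hN
  induction j with
  | zero =>
    have : (2 * N / (N + (0 : ℕ)) : ℝ) = 2 := by simp; field_simp
    rw [this]; simp
  | succ j ih =>
    have ih := ih (by omega)
    have hjN : ((j : ℝ) + 1) ≤ N := by exact_mod_cast hj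
    have hj0 : (0 : ℝ) ≤ j := by positivity
    set a : ℝ := 2 * N / (N + (j + 1 : ℕ)) with ha
    set b : ℝ := 2 * N / (N + j) with hb
    have ha0 : 0 < a := by rw [ha]; positivity
    have ha1 : 1 ≤ a := by rw [ha, one_le_div (by positivity)]; push_cast; linarith
    have ha2 : a < 2 * N := by
      rw [ha, div_lt_iff₀ (by positivity)]; push_cast; nlinarith
    have hab : 1 / a = 1 / (2 * N) + 1 / b := by
      rw [ha, hb]; push_cast; field_simp; ring
    set G := (weightedOp Q m)^[j] F with hG
    have hGm : Measurable G := measurable_weightedOp_iterate hm hF j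
    simp only [Function.iterate_succ_apply']
    calc (∫⁻ x, weightedOp Q m G x ^ a ∂μ) ^ (1 / a)
        ≤ (∫⁻ x, ∫⁻ y, (m (x, y) * G y) ^ a ∂(Q x) ∂μ) ^ (1 / a) := by
          refine ENNReal.rpow_le_rpow (lintegral_mono fun x => ?_) (by positivity)
          exact lintegral_rpow_le_lintegral_rpow (by fun_prop) ha1
      _ = (∫⁻ z, ((m * fun z : X × X => G z.2) z) ^ a ∂(μ ⊗ₘ Q)) ^ (1 / a) := by
          rw [Measure.lintegral_compProd (by fun_prop)]; rfl
      _ ≤ (∫⁻ z, m z ^ (2 * N : ℝ) ∂(μ ⊗ₘ Q)) ^ (1 / (2 * N) : ℝ)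
          * (∫⁻ z, G z.2 ^ b ∂(μ ⊗ₘ Q)) ^ (1 / b) :=
          ENNReal.lintegral_Lp_mul_le_Lq_mul_Lr ha0 ha2 hab (μ ⊗ₘ Q) (f := m)
            (g := fun z : X × X => G z.2) (by fun_prop) (by fun_prop)
      _ = (∫⁻ z, m z ^ (2 * N : ℝ) ∂(μ ⊗ₘ Q)) ^ (1 / (2 * N) : ℝ)
          * (∫⁻ x, G x ^ b ∂μ) ^ (1 / b) := by
          rw [(measurePreserving_snd hμ).lintegral_comp (f := fun x => G x ^ b) (by fun_prop)]
      _ ≤ (∫⁻ z, m z ^ (2 * N : ℝ) ∂(μ ⊗ₘ Q)) ^ (1 / (2 * N) : ℝ)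
          * ((∫⁻ z, m z ^ (2 * N : ℝ) ∂(μ ⊗ₘ Q)) ^ (j / (2 * N) : ℝ)
            * (∫⁻ x, F x ^ (2 : ℝ) ∂μ) ^ (1 / 2 : ℝ)) := by gcongr
      _ = _ := by
          rw [← mul_assoc, ← ENNReal.rpow_add_of_nonneg _ _ (by positivity) (by positivity)]
          congr 2; push_cast; ring

theorem lintegral_weightedOp_iterate_le (hμ : Kernel.Invariant Q μ) (hm : Measurable m)
    {F : X → ℝ≥0∞} (hF : Measurable F) {N : ℕ} (hN : 0 < N) {j : ℕ} (hj : j ≤ N) {B : ℝ≥0∞}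
    (hB1 : 1 ≤ B) (hB : ∫⁻ z, m z ^ (2 * N : ℝ) ∂(μ ⊗ₘ Q) ≤ B) :
    ∫⁻ x, (weightedOp Q m)^[j] F x ∂μ
      ≤ B ^ (1 / 2 : ℝ) * (∫⁻ x, F x ^ (2 : ℝ) ∂μ) ^ (1 / 2 : ℝ) := by
  have hN0 : (0 : ℝ) < N := by exact_mod_cast hN
  have hjN : (j : ℝ) ≤ N := by exact_mod_cast hj
  set a : ℝ := 2 * N / (N + j) with ha
  have ha1 : 1 ≤ a := by rw [ha, one_le_div (by positivity)]; linarith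
  calc ∫⁻ x, (weightedOp Q m)^[j] F x ∂μ
      = ((∫⁻ x, (weightedOp Q m)^[j] F x ∂μ) ^ a) ^ (1 / a) := by
        rw [← ENNReal.rpow_mul, mul_one_div_cancel (by linarith), ENNReal.rpow_one]
    _ ≤ (∫⁻ x, (weightedOp Q m)^[j] F x ^ a ∂μ) ^ (1 / a) :=
        ENNReal.rpow_le_rpow (lintegral_rpow_le_lintegral_rpow
          (measurable_weightedOp_iterate hm hF j).aemeasurable ha1) (by positivity)
    _ ≤ _ := lintegral_weightedOp_iterate_rpow_le hμ hm hF hN hj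
    _ ≤ _ := by
        gcongr
        calc _ ≤ B ^ (j / (2 * N) : ℝ) := ENNReal.rpow_le_rpow hB (by positivity)
          _ ≤ B ^ (1 / 2 : ℝ) := ENNReal.rpow_le_rpow_of_exponent_le hB1 (by
              rw [div_le_div_iff₀ (by positivity) two_pos]; linarith)

end WeightedOp

/-! ### Orlicz bounds for weighted conditional expectations and the Neumann series. -/

section WeightedOp

variable {X : Type*} [MeasurableSpace X] {Q : Kernel X X} [IsMarkovKernel Q]
  {μ : Measure X} [IsProbabilityMeasure μ] {m : X × X → ℝ≥0∞}

theorem weightedOp_iterate_const_mul (hm : Measurable m) {F : X → ℝ≥0∞} (hF : Measurable F)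
    (c : ℝ≥0∞) (j : ℕ) (x : X) :
    (weightedOp Q m)^[j] (fun x => c * F x) x = c * (weightedOp Q m)^[j] F x := by
  induction j generalizing x with
  | zero => rfl
  | succ j ih =>
    have hFj := measurable_weightedOp_iterate (Q := Q) hm hF j
    simp only [Function.iterate_succ_apply']
    rw [show (weightedOp Q m)^[j] (fun x => c * F x) = fun x => c * (weightedOp Q m)^[j] F x from
      funext ih]
    simp only [weightedOp] at hFj ⊢
    rw [← lintegral_const_mul _ (by fun_prop)]
    refine lintegral_congr fun y => ?_
    ring

/-- At order `(2 * c)⁻¹` the square in the `L²` bound restores order `c⁻¹`, so the moment of the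
iterate is at most `exp (b / 2) * exp (1 / 2) ≤ exp b`. A further division by `2 * b` leaves `exp (1
/ 2) ≤ 2`; hence `4 * b`, for every `j ≤ N`. -/
theorem orliczNorm_weightedOp_iterate_le (hμ : Kernel.Invariant Q μ) (hm : Measurable m)
    (hm1 : ∀ x, ∫⁻ y, m (x, y) ∂(Q x) = 1) {N : ℕ} (hN : 0 < N) {j : ℕ} (hj : j ≤ N) {b : ℝ}
    (hb : 1 ≤ b)
    (hB : ∫⁻ z, m z ^ (2 * N : ℝ) ∂(μ ⊗ₘ Q) ≤ ENNReal.ofReal (Real.exp b))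
    {D : X → ℝ} (hD : Measurable D) :
    orliczNorm μ 1 (fun x => ((weightedOp Q m)^[j] (fun y => ENNReal.ofReal |D y|) x).toReal)
      ≤ ENNReal.ofReal (4 * b) * orliczNorm μ 1 D := by
  have hb0 : 0 < b := by linarith
  refine orliczNorm_le_const_mul (by positivity) fun c hc hDc =>
    orliczNorm_le_ofReal (by positivity) ?_
  rw [orliczModular_le_one_iff hc, expMoment_one] at hDc
  have hDm : Measurable fun y => ENNReal.ofReal |D y| := by fun_prop
  set G : X → ℝ := fun x => ((weightedOp Q m)^[j] (fun y => ENNReal.ofReal |D y|) x).toReal with hG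
  have hGm : Measurable G := (measurable_weightedOp_iterate hm hDm j).ennreal_toReal
  have hpt : ∀ x, ENNReal.ofReal (Real.exp ((2 * c)⁻¹ * |G x|)) ≤ (weightedOp Q m)^[j]
      (fun y => ENNReal.ofReal (Real.exp ((2 * c)⁻¹ * |D y|))) x := by
    intro x
    have h1 := exp_weightedOp_iterate_le hm hm1
      (D := fun y => ENNReal.ofReal (2 * c)⁻¹ * ENNReal.ofReal |D y|) (by fun_prop) j x
    rw [weightedOp_iterate_const_mul hm hDm, ENNReal.toReal_mul,
      ENNReal.toReal_ofReal (by positivity)] at h1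
    rw [abs_of_nonneg ENNReal.toReal_nonneg]
    refine h1.trans (le_of_eq (congrFun (congrArg _ (funext fun y => ?_)) x))
    rw [ENNReal.toReal_mul, ENNReal.toReal_ofReal (by positivity),
      ENNReal.toReal_ofReal (abs_nonneg _)]
  have h2 : expMoment μ (2 * c)⁻¹ 1 G ≤ ENNReal.ofReal (Real.exp b) := by
    calc expMoment μ (2 * c)⁻¹ 1 G ≤ ∫⁻ x, (weightedOp Q m)^[j]
          (fun y => ENNReal.ofReal (Real.exp ((2 * c)⁻¹ * |D y|))) x ∂μ := by
          rw [expMoment_one]; exact lintegral_mono hpt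
      _ ≤ ENNReal.ofReal (Real.exp b) ^ (1 / 2 : ℝ) * (∫⁻ x, ENNReal.ofReal
          (Real.exp ((2 * c)⁻¹ * |D x|)) ^ (2 : ℝ) ∂μ) ^ (1 / 2 : ℝ) :=
          lintegral_weightedOp_iterate_le hμ hm (by fun_prop) hN hj (one_le_ofReal_exp hb0.le) hB
      _ ≤ ENNReal.ofReal (Real.exp b) ^ (1 / 2 : ℝ) * ENNReal.ofReal (Real.exp 1) ^ (1 / 2 : ℝ) := by
          gcongr
          calc _ = ∫⁻ x, ENNReal.ofReal (Real.exp (c⁻¹ * |D x|)) ∂μ := by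
                refine lintegral_congr fun x => ?_
                rw [ofReal_exp_rpow]; congr 2; field_simp
            _ ≤ 2 := hDc
            _ = ENNReal.ofReal 2 := by simp
            _ ≤ _ := ENNReal.ofReal_le_ofReal (by linarith [Real.add_one_le_exp (1 : ℝ)])
      _ ≤ _ := by
          rw [ofReal_exp_rpow, ofReal_exp_rpow, ← ofReal_exp_add]
          exact ofReal_exp_mono (by linarith)
  calc expMoment μ (4 * b * c)⁻¹ 1 G
      ≤ expMoment μ (2 * c)⁻¹ 1 G ^ ((4 * b * c)⁻¹ / (2 * c)⁻¹) :=
        expMoment_rpow_le (by positivity) (inv_anti₀ (by positivity) (by nlinarith)) 1 hGm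
    _ ≤ ENNReal.ofReal (Real.exp b) ^ ((4 * b * c)⁻¹ / (2 * c)⁻¹) := by gcongr
    _ = ENNReal.ofReal (Real.exp (1 / 2)) := by
        rw [ofReal_exp_rpow]; congr 2; field_simp; norm_num
    _ ≤ ENNReal.ofReal 2 := by
        refine ENNReal.ofReal_le_ofReal ?_
        rw [← Real.le_log_iff_exp_le two_pos]
        linarith [Real.log_two_gt_d9]
    _ = 2 := by simp

theorem ae_weightedOp_iterate_lt_top (hμ : Kernel.Invariant Q μ) (hm : Measurable m)
    {N : ℕ} (hN : 0 < N) {j : ℕ} (hj : j ≤ N) {B : ℝ≥0∞} (hB1 : 1 ≤ B) (hBtop : B < ∞)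
    (hB : ∫⁻ z, m z ^ (2 * N : ℝ) ∂(μ ⊗ₘ Q) ≤ B)
    {F : X → ℝ≥0∞} (hF : Measurable F) (hF2 : ∫⁻ x, F x ^ (2 : ℝ) ∂μ < ∞) :
    ∀ᵐ x ∂μ, (weightedOp Q m)^[j] F x < ∞ := by
  refine ae_lt_top (measurable_weightedOp_iterate hm hF j) (ne_of_lt ?_)
  refine (lintegral_weightedOp_iterate_le hμ hm hF hN hj hB1 hB).trans_lt (ENNReal.mul_lt_top ?_ ?_)
  · exact ENNReal.rpow_lt_top_of_nonneg (by norm_num) hBtop.ne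
  · exact ENNReal.rpow_lt_top_of_nonneg (by norm_num) hF2.ne

theorem lintegral_sq_lt_top_of_orliczNorm_lt_top {D : X → ℝ} (hD : orliczNorm μ 1 D < ∞) :
    ∫⁻ x, ENNReal.ofReal |D x| ^ (2 : ℝ) ∂μ < ∞ := by
  obtain ⟨c, hc⟩ : ∃ c : ℝ, orliczNorm μ 1 D < ENNReal.ofReal c :=
    ⟨(orliczNorm μ 1 D).toReal + 1, by
      rw [ENNReal.lt_ofReal_iff_toReal_lt hD.ne]; linarith⟩
  have hc0 : 0 < c := by
    by_contra hneg
    rw [ENNReal.ofReal_of_nonpos (not_lt.1 hneg)] at hc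
    exact not_lt_zero hc
  have h := expMoment_le_two_of_orliczNorm_lt hc
  rw [expMoment_one] at h
  calc _ ≤ ∫⁻ x, ENNReal.ofReal (2 * c ^ 2) * ENNReal.ofReal (Real.exp (c⁻¹ * |D x|)) ∂μ := by
        refine lintegral_mono fun x => ?_
        rw [ENNReal.ofReal_rpow_of_nonneg (abs_nonneg _) two_pos.le, ← ENNReal.ofReal_mul (by positivity)]
        refine ENNReal.ofReal_le_ofReal ?_
        have h1 := Real.quadratic_le_exp_of_nonneg (by positivity : 0 ≤ c⁻¹ * |D x|)
        have h2 : (c⁻¹ * |D x|) ^ 2 / 2 ≤ Real.exp (c⁻¹ * |D x|) := by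
          have : 0 ≤ c⁻¹ * |D x| := by positivity
          linarith
        calc |D x| ^ (2 : ℝ) = 2 * c ^ 2 * ((c⁻¹ * |D x|) ^ 2 / 2) := by
              rw [Real.rpow_two]; field_simp
          _ ≤ _ := by gcongr
    _ = ENNReal.ofReal (2 * c ^ 2) * ∫⁻ x, ENNReal.ofReal (Real.exp (c⁻¹ * |D x|)) ∂μ :=
        lintegral_const_mul' _ _ ENNReal.ofReal_ne_top
    _ < ∞ := ENNReal.mul_lt_top ENNReal.ofReal_lt_top (h.trans_lt (by simp))

/-- A quantitative Neumann series bound for functions dominated by `|d| + β E[m D]`. -/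
theorem orliczNorm_le_of_le_add_weightedOp (hμ : Kernel.Invariant Q μ) (hm : Measurable m)
    (hm1 : ∀ x, ∫⁻ y, m (x, y) ∂(Q x) = 1) {N : ℕ} (hN : 0 < N) {b β : ℝ} (hb : 1 ≤ b)
    (hβ₀ : 0 < β) (hβ₁ : β < 1) (hbN : β ^ N * (4 * b) ≤ 1 / 2)
    (hB : ∫⁻ z, m z ^ (2 * N : ℝ) ∂(μ ⊗ₘ Q) ≤ ENNReal.ofReal (Real.exp b))
    {D d : X → ℝ} (hD : Measurable D) (hd : Measurable d) (hD0 : ∀ x, 0 ≤ D x)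
    (hDfin : orliczNorm μ 1 D < ∞)
    (hle : ∀ᵐ x ∂μ, ENNReal.ofReal (D x) ≤ ENNReal.ofReal |d x|
      + ENNReal.ofReal β * weightedOp Q m (fun y => ENNReal.ofReal (D y)) x) :
    orliczNorm μ 1 D ≤ ENNReal.ofReal (8 * b * N) * orliczNorm μ 1 d := by
  have hb0 : 0 < b := by linarith
  have hN0 : (0 : ℝ) < N := by exact_mod_cast hN
  rcases eq_or_ne (orliczNorm μ 1 d) ∞ with htop | hdfin
  · rw [htop, ENNReal.mul_top (by simp; positivity)]; exact le_top
  have hdfin : orliczNorm μ 1 d < ∞ := lt_top_iff_ne_top.2 hdfin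
  have hDabs : ∀ x, |D x| = D x := fun x => abs_of_nonneg (hD0 x)
  set d' : X → ℝ≥0∞ := fun x => ENNReal.ofReal |d x| with hd'
  set D' : X → ℝ≥0∞ := fun x => ENNReal.ofReal |D x| with hD'
  have hd'm : Measurable d' := by fun_prop
  have hD'm : Measurable D' := by fun_prop
  have hit := le_sum_weightedOp_iterate (m := m) (D := D') (d := d') hμ hm hD'm hd'm
    (b := ENNReal.ofReal β) (by simpa only [hD', hDabs] using hle) N
  have hfd : ∀ᵐ x ∂μ, ∀ j ∈ Finset.range N, (weightedOp Q m)^[j] d' x < ∞ :=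
    (Finset.eventually_all (Finset.range N)).2 fun j hj =>
      ae_weightedOp_iterate_lt_top hμ hm hN (Finset.mem_range.1 hj).le (one_le_ofReal_exp hb0.le)
        ENNReal.ofReal_lt_top hB hd'm (lintegral_sq_lt_top_of_orliczNorm_lt_top hdfin)
  have hfD : ∀ᵐ x ∂μ, (weightedOp Q m)^[N] D' x < ∞ :=
    ae_weightedOp_iterate_lt_top hμ hm hN le_rfl (one_le_ofReal_exp hb0.le)
        ENNReal.ofReal_lt_top hB hD'm (lintegral_sq_lt_top_of_orliczNorm_lt_top hDfin)
  set e : ℕ → X → ℝ := fun j x => β ^ j * ((weightedOp Q m)^[j] d' x).toReal with he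
  set f : X → ℝ := fun x => β ^ N * ((weightedOp Q m)^[N] D' x).toReal with hf
  have hem : ∀ j, Measurable (e j) := fun j =>
    (measurable_weightedOp_iterate hm hd'm j).ennreal_toReal.const_mul _
  have hreal : ∀ᵐ x ∂μ, |D x| ≤ |(∑ j ∈ Finset.range N, e j x) + f x| := by
    filter_upwards [hit, hfd, hfD] with x h1 h2 h3
    have hβp : ∀ j, ENNReal.ofReal β ^ j ≠ ∞ := fun j => ENNReal.pow_ne_top ENNReal.ofReal_ne_top
    have h4 : ∀ j ∈ Finset.range N, ENNReal.ofReal β ^ j * (weightedOp Q m)^[j] d' x ≠ ∞ :=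
      fun j hj => ENNReal.mul_ne_top (hβp j) (h2 j hj).ne
    have h5 := ENNReal.toReal_mono (ENNReal.add_ne_top.2
      ⟨ENNReal.sum_ne_top.2 h4, ENNReal.mul_ne_top (hβp N) h3.ne⟩) h1
    rw [ENNReal.toReal_add (ENNReal.sum_ne_top.2 h4) (ENNReal.mul_ne_top (hβp N) h3.ne),
      ENNReal.toReal_sum h4] at h5
    simp only [ENNReal.toReal_mul, ENNReal.toReal_pow, ENNReal.toReal_ofReal hβ₀.le, hD',
      ENNReal.toReal_ofReal (abs_nonneg _)] at h5
    exact h5.trans (le_abs_self _)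
  have hej : ∀ j ∈ Finset.range N, orliczNorm μ 1 (e j)
      ≤ ENNReal.ofReal (4 * b) * orliczNorm μ 1 d := by
    intro j hj
    refine (orliczNorm_const_mul_le (by positivity) _).trans ?_
    calc _ ≤ 1 * (ENNReal.ofReal (4 * b) * orliczNorm μ 1 d) := by
          gcongr
          · exact ENNReal.ofReal_le_one.2 (pow_le_one₀ hβ₀.le hβ₁.le)
          · exact orliczNorm_weightedOp_iterate_le hμ hm hm1 hN (Finset.mem_range.1 hj).le hb hB hd
      _ = _ := one_mul _
  have hfj : orliczNorm μ 1 f ≤ ENNReal.ofReal (1 / 2) * orliczNorm μ 1 D := by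
    refine (orliczNorm_const_mul_le (by positivity) _).trans ?_
    calc _ ≤ ENNReal.ofReal (β ^ N) * (ENNReal.ofReal (4 * b) * orliczNorm μ 1 D) := by
          gcongr
          exact orliczNorm_weightedOp_iterate_le hμ hm hm1 hN le_rfl hb hB hD
      _ = ENNReal.ofReal (β ^ N * (4 * b)) * orliczNorm μ 1 D := by
          rw [← mul_assoc, ENNReal.ofReal_mul (p := β ^ N) (by positivity)]
      _ ≤ _ := by gcongr
  -- Since the norm of `D` is finite, the term with factor `1 / 2` moves to the left side and
  -- doubles the constant `4 * b * N`.
  have hmain : orliczNorm μ 1 D ≤ ENNReal.ofReal (4 * b * N) * orliczNorm μ 1 d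
      + ENNReal.ofReal (1 / 2) * orliczNorm μ 1 D := by
    calc orliczNorm μ 1 D ≤ orliczNorm μ 1 (fun x => (∑ j ∈ Finset.range N, e j x) + f x) :=
          orliczNorm_mono zero_le_one hreal
      _ ≤ orliczNorm μ 1 (fun x => ∑ j ∈ Finset.range N, e j x) + orliczNorm μ 1 f :=
          orliczNorm_add_le (Finset.measurable_sum _ fun j _ => hem j)
      _ ≤ ∑ j ∈ Finset.range N, orliczNorm μ 1 (e j) + orliczNorm μ 1 f := by
          gcongr; exact orliczNorm_sum_le _ hem
      _ ≤ ∑ j ∈ Finset.range N, ENNReal.ofReal (4 * b) * orliczNorm μ 1 d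
          + ENNReal.ofReal (1 / 2) * orliczNorm μ 1 D :=
          add_le_add (Finset.sum_le_sum hej) hfj
      _ = _ := by
          rw [Finset.sum_const, Finset.card_range, nsmul_eq_mul,
            ENNReal.ofReal_mul (by positivity : 0 ≤ 4 * b), ENNReal.ofReal_natCast]
          ring
  obtain ⟨x, hx⟩ : ∃ x : ℝ, x = (orliczNorm μ 1 D).toReal := ⟨_, rfl⟩
  have h1 := ENNReal.toReal_mono (ENNReal.add_ne_top.2
    ⟨ENNReal.mul_ne_top ENNReal.ofReal_ne_top hdfin.ne,
      ENNReal.mul_ne_top ENNReal.ofReal_ne_top hDfin.ne⟩) hmain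
  rw [ENNReal.toReal_add (ENNReal.mul_ne_top ENNReal.ofReal_ne_top hdfin.ne)
    (ENNReal.mul_ne_top ENNReal.ofReal_ne_top hDfin.ne), ENNReal.toReal_mul, ENNReal.toReal_mul,
    ENNReal.toReal_ofReal (by positivity), ENNReal.toReal_ofReal (by norm_num)] at h1
  rw [← ENNReal.ofReal_toReal hDfin.ne, ← ENNReal.ofReal_toReal hdfin.ne,
    ← ENNReal.ofReal_mul (by positivity)]
  exact ENNReal.ofReal_le_ofReal (by linarith)

end WeightedOp

/-! ### Exponential tilting of the transition kernel -/

section Tilt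

variable {X : Type*} [MeasurableSpace X] {Q : Kernel X X} [IsMarkovKernel Q]
  {μ : Measure X} [IsProbabilityMeasure μ]

open Classical in
/-- The normalized density `exp g / E^Q[exp g | X_t]` (and `1` where the normalizing constant is
infinite). -/
noncomputable def tiltDensity (Q : Kernel X X) (g : X × X → ℝ) (z : X × X) : ℝ≥0∞ :=
  if ∫⁻ y, ENNReal.ofReal (Real.exp (g (z.1, y))) ∂(Q z.1) < ∞ then
    ENNReal.ofReal (Real.exp (g z)) / ∫⁻ y, ENNReal.ofReal (Real.exp (g (z.1, y))) ∂(Q z.1)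
  else 1

theorem measurable_lintegral_exp {g : X × X → ℝ} (hg : Measurable g) :
    Measurable fun x => ∫⁻ y, ENNReal.ofReal (Real.exp (g (x, y))) ∂(Q x) :=
  Measurable.lintegral_kernel_prod_right (κ := Q)
    (f := fun x y => ENNReal.ofReal (Real.exp (g (x, y))))
    (by simp only [Function.uncurry_def]; fun_prop)

theorem measurable_tiltDensity {g : X × X → ℝ} (hg : Measurable g) :
    Measurable (tiltDensity Q g) := by
  have h1 : Measurable fun z : X × X => ∫⁻ y, ENNReal.ofReal (Real.exp (g (z.1, y))) ∂(Q z.1) :=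
    (measurable_lintegral_exp hg).comp measurable_fst
  refine Measurable.ite (measurableSet_lt h1 measurable_const) ?_ measurable_const
  exact Measurable.div (by fun_prop) h1

theorem lintegral_tiltDensity {g : X × X → ℝ} (hg : Measurable g) (x : X) :
    ∫⁻ y, tiltDensity Q g (x, y) ∂(Q x) = 1 := by
  by_cases h : ∫⁻ y, ENNReal.ofReal (Real.exp (g (x, y))) ∂(Q x) < ∞
  · simp only [tiltDensity, if_pos h, div_eq_mul_inv]
    rw [lintegral_mul_const _ (by fun_prop), ENNReal.mul_inv_cancel _ h.ne]
    intro h0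
    rw [lintegral_eq_zero_iff (by fun_prop)] at h0
    obtain ⟨y, hy⟩ := h0.exists
    exact ofReal_exp_ne_zero _ hy
  · simp [tiltDensity, if_neg h]

/-- The density is at most `exp |g| * E^Q[exp |g| | X_t]`, because the inverse normalizing constant
is at most `E^Q[exp (-g) | X_t]`. Integrating the `c`-th power squares a conditional moment, which
Jensen turns into order `2 * c`. -/
theorem lintegral_tiltDensity_rpow_le {g : X × X → ℝ} (hg : Measurable g) {c : ℝ} (hc : 1 ≤ c) :
    ∫⁻ z, tiltDensity Q g z ^ c ∂(μ ⊗ₘ Q) ≤ expMoment (μ ⊗ₘ Q) (2 * c) 1 g := by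
  have hc0 : 0 < c := by linarith
  have hpt : ∀ x y, tiltDensity Q g (x, y) ^ c ≤ ENNReal.ofReal (Real.exp (c * |g (x, y)|))
      * ∫⁻ y, ENNReal.ofReal (Real.exp (c * |g (x, y)|)) ∂(Q x) := by
    intro x y
    have h1 : tiltDensity Q g (x, y) ≤ ENNReal.ofReal (Real.exp |g (x, y)|)
        * ∫⁻ y, ENNReal.ofReal (Real.exp |g (x, y)|) ∂(Q x) := by
      by_cases h : ∫⁻ y, ENNReal.ofReal (Real.exp (g (x, y))) ∂(Q x) < ∞
      · simp only [tiltDensity, if_pos h, div_eq_mul_inv]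
        have h2 := one_le_lintegral_exp_mul_lintegral_exp_neg (ν := Q x)
          (f := fun y => g (x, y)) (by fun_prop)
        have h3 : (∫⁻ y, ENNReal.ofReal (Real.exp (g (x, y))) ∂(Q x))⁻¹
            ≤ ∫⁻ y, ENNReal.ofReal (Real.exp (-g (x, y))) ∂(Q x) :=
          ENNReal.inv_le_iff_le_mul (fun _ h0 => by simp [h0] at h2) (fun h0 => absurd h0 h.ne)
            |>.2 h2
        gcongr
        · exact le_abs_self _
        · exact h3.trans (lintegral_mono fun y => ofReal_exp_mono (neg_le_abs _))
      · simp only [tiltDensity, if_neg h]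
        exact one_le_mul (one_le_ofReal_exp (abs_nonneg _))
          (one_le_lintegral_of_one_le fun y => one_le_ofReal_exp (abs_nonneg _))
    calc _ ≤ (ENNReal.ofReal (Real.exp |g (x, y)|)
        * ∫⁻ y, ENNReal.ofReal (Real.exp |g (x, y)|) ∂(Q x)) ^ c := ENNReal.rpow_le_rpow h1 hc0.le
      _ = ENNReal.ofReal (Real.exp (c * |g (x, y)|))
        * (∫⁻ y, ENNReal.ofReal (Real.exp |g (x, y)|) ∂(Q x)) ^ c := by
          rw [ENNReal.mul_rpow_of_nonneg _ _ hc0.le, ofReal_exp_rpow, mul_comm c]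
      _ ≤ _ := by
          gcongr
          refine (lintegral_rpow_le_lintegral_rpow (by fun_prop) hc).trans (le_of_eq ?_)
          refine lintegral_congr fun y => ?_
          rw [ofReal_exp_rpow, mul_comm]
  have hm := measurable_tiltDensity (Q := Q) hg
  rw [Measure.lintegral_compProd (by fun_prop), expMoment_one,
    Measure.lintegral_compProd (by fun_prop)]
  refine lintegral_mono fun x => ?_
  calc _ ≤ ∫⁻ y, ENNReal.ofReal (Real.exp (c * |g (x, y)|))
      * ∫⁻ y, ENNReal.ofReal (Real.exp (c * |g (x, y)|)) ∂(Q x) ∂(Q x) := lintegral_mono (hpt x)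
    _ = (∫⁻ y, ENNReal.ofReal (Real.exp (c * |g (x, y)|)) ∂(Q x)) ^ (2 : ℝ) := by
        rw [lintegral_mul_const _ (by fun_prop), ENNReal.rpow_two, sq]
    _ ≤ _ := by
        refine (lintegral_rpow_le_lintegral_rpow (by fun_prop) one_le_two).trans (le_of_eq ?_)
        refine lintegral_congr fun y => ?_
        rw [ofReal_exp_rpow]; congr 2; ring

theorem ae_integrable_exp_of_expMoment_lt_top {g : X × X → ℝ} (hg : Measurable g) {c : ℝ}
    (hc : 1 ≤ c) (h : expMoment (μ ⊗ₘ Q) c 1 g < ∞) :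
    ∀ᵐ x ∂μ, Integrable (fun y => Real.exp (g (x, y))) (Q x) := by
  rw [expMoment_one, Measure.lintegral_compProd (by fun_prop)] at h
  have h3 := ae_lt_top (Measurable.lintegral_kernel_prod_right (κ := Q)
    (f := fun x y => ENNReal.ofReal (Real.exp (c * |g (x, y)|)))
    (by simp only [Function.uncurry_def]; fun_prop)) h.ne
  filter_upwards [h3] with x hx
  rw [integrable_exp_iff (by fun_prop)]
  refine lt_of_le_of_lt (lintegral_mono fun y => ofReal_exp_mono ?_) hx
  nlinarith [le_abs_self (g (x, y)), abs_nonneg (g (x, y))]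

/-- The gradient inequality for the entropic operator. -/
theorem ofReal_entropicOp_sub_le {h : X × X → ℝ} (hh : Measurable h) {β : ℝ} (hβ₀ : 0 < β)
    {f g : X → ℝ} (hf : Measurable f) (hg : Measurable g) {x : X}
    (hfi : Integrable (fun y => Real.exp (f y + h (x, y))) (Q x))
    (hgi : Integrable (fun y => Real.exp (g y + h (x, y))) (Q x)) :
    ENNReal.ofReal (entropicOp Q h β f x - entropicOp Q h β g x) ≤ ENNReal.ofReal β
      * weightedOp Q (tiltDensity Q fun z => f z.2 + h z) (fun y => ENNReal.ofReal (f y - g y)) x := by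
  simp only [entropicOp]
  rw [← mul_sub, ENNReal.ofReal_mul hβ₀.le]
  gcongr
  refine (log_integral_exp_sub_le (by fun_prop) (by fun_prop) hfi hgi).trans (le_of_eq ?_)
  refine lintegral_congr fun y => ?_
  have hlt := (integrable_exp_iff (f := fun y => f y + h (x, y)) (by fun_prop)).1 hfi
  simp only [tiltDensity]
  rw [if_pos hlt]
  congr 2; ring

/-- One-sided stability of approximate fixed points of the entropic operator. -/
theorem orliczNorm_pos_part_sub_le (hμ : Kernel.Invariant Q μ) {h : X × X → ℝ} (hh : Measurable h)
    {N : ℕ} (hN : 0 < N) {b β : ℝ} (hb : 1 ≤ b) (hβ₀ : 0 < β) (hβ₁ : β < 1)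
    (hbN : β ^ N * (4 * b) ≤ 1 / 2) {f g d : X → ℝ} (hf : Measurable f) (hg : Measurable g)
    (hd : Measurable d)
    (hfb : expMoment (μ ⊗ₘ Q) (4 * N) 1 (fun z => f z.2 + h z) ≤ ENNReal.ofReal (Real.exp b))
    (hgb : expMoment (μ ⊗ₘ Q) (4 * N) 1 (fun z => g z.2 + h z) < ∞)
    (hfin : orliczNorm μ 1 (fun x => f x - g x) < ∞)
    (hle : ∀ᵐ x ∂μ, f x - g x ≤ entropicOp Q h β f x - entropicOp Q h β g x + |d x|) :
    orliczNorm μ 1 (fun x => max (f x - g x) 0) ≤ ENNReal.ofReal (8 * b * N) * orliczNorm μ 1 d := by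
  have hN1 : (1 : ℝ) ≤ N := by exact_mod_cast hN
  have hgm : Measurable fun z : X × X => f z.2 + h z := by fun_prop
  refine orliczNorm_le_of_le_add_weightedOp hμ (measurable_tiltDensity hgm)
    (lintegral_tiltDensity hgm) hN hb hβ₀ hβ₁ hbN ?_ (by fun_prop) hd (fun x => le_max_right _ _) ?_ ?_
  -- The moment of order `2N` of the density costs an exponential moment of order `2 * 2N = 4N`.
  · refine (lintegral_tiltDensity_rpow_le hgm (by linarith)).trans ?_
    rwa [← mul_assoc, show (2 : ℝ) * 2 = 4 by norm_num]
  · refine lt_of_le_of_lt (orliczNorm_mono zero_le_one (ae_of_all _ fun x => ?_)) hfin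
    rw [abs_of_nonneg (le_max_right _ _)]
    exact max_le (le_abs_self _) (abs_nonneg _)
  · filter_upwards [hle, ae_integrable_exp_of_expMoment_lt_top (by fun_prop) (by linarith)
      (hfb.trans_lt ENNReal.ofReal_lt_top), ae_integrable_exp_of_expMoment_lt_top (by fun_prop)
      (by linarith) hgb] with x hx h1 h2
    have h3 := ofReal_entropicOp_sub_le hh hβ₀ hf hg h1 h2
    have hmax : ∀ t : ℝ, ENNReal.ofReal (max t 0) = ENNReal.ofReal t := fun t => by simp
    simp only [hmax]
    calc _ ≤ ENNReal.ofReal (entropicOp Q h β f x - entropicOp Q h β g x + |d x|) :=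
          ENNReal.ofReal_le_ofReal hx
      _ ≤ _ := ENNReal.ofReal_add_le
      _ ≤ _ := by rw [add_comm]; gcongr

end Tilt

/-! ### Stability of the fixed point under perturbations of the kernel -/

section Stability

variable {E : Type*} [MeasurableSpace E] {ν : Measure E}

theorem expMoment_add_le {f g : E → ℝ} (hf : Measurable f) {t : ℝ} (ht : 0 ≤ t) {B : ℝ≥0∞}
    (hfB : expMoment ν (2 * t) 1 f ≤ B) (hgB : expMoment ν (2 * t) 1 g ≤ B) :
    expMoment ν t 1 (fun x => f x + g x) ≤ B := by
  rw [expMoment_one] at hfB hgB ⊢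
  calc _ ≤ ∫⁻ x, (ENNReal.ofReal (1 / 2) * ENNReal.ofReal (Real.exp (2 * t * |f x|))
        + ENNReal.ofReal (1 / 2) * ENNReal.ofReal (Real.exp (2 * t * |g x|))) ∂ν := by
        refine lintegral_mono fun x => ?_
        rw [← ENNReal.ofReal_mul (by positivity), ← ENNReal.ofReal_mul (by positivity),
          ← ENNReal.ofReal_add (by positivity) (by positivity)]
        refine ENNReal.ofReal_le_ofReal ?_
        have h1 := convexOn_exp.2 (Set.mem_univ (2 * t * |f x|)) (Set.mem_univ (2 * t * |g x|))
          (by positivity : (0 : ℝ) ≤ 1 / 2) (by positivity : (0 : ℝ) ≤ 1 / 2) (by norm_num)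
        simp only [smul_eq_mul] at h1
        refine le_trans (Real.exp_le_exp.2 ?_) h1
        have := mul_le_mul_of_nonneg_left (abs_add_le (f x) (g x)) ht
        linarith
    _ = ENNReal.ofReal (1 / 2) * ∫⁻ x, ENNReal.ofReal (Real.exp (2 * t * |f x|)) ∂ν
        + ENNReal.ofReal (1 / 2) * ∫⁻ x, ENNReal.ofReal (Real.exp (2 * t * |g x|)) ∂ν := by
        rw [lintegral_add_left (by fun_prop), lintegral_const_mul' _ _ ENNReal.ofReal_ne_top,
          lintegral_const_mul' _ _ ENNReal.ofReal_ne_top]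
    _ ≤ ENNReal.ofReal (1 / 2) * B + ENNReal.ofReal (1 / 2) * B := by gcongr
    _ = B := by
        rw [← add_mul, ← ENNReal.ofReal_add (by positivity) (by positivity)]
        norm_num

theorem expMoment_const_mul {c : ℝ} (hc : 0 ≤ c) (t : ℝ) (f : E → ℝ) :
    expMoment ν t 1 (fun x => c * f x) = expMoment ν (t * c) 1 f := by
  rw [expMoment_one, expMoment_one]
  refine lintegral_congr fun x => ?_
  rw [abs_mul, abs_of_nonneg hc, mul_assoc]

variable [IsProbabilityMeasure ν]

/-- Young's inequality bounds `t |f|` by `t ^ (r / (r - 1)) + |f| ^ r`. The log-moment thus grows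
polynomially in the order, which `β ^ N` beats; the ceiling makes the exponent a natural number. -/
theorem HasAllExpMoments.exists_expMoment_le {r : ℝ} (hr : 1 < r) {f : E → ℝ}
    (hf : HasAllExpMoments ν r f) :
    ∃ K : ℝ, 1 ≤ K ∧ ∀ t : ℝ, 1 ≤ t →
      expMoment ν t 1 f ≤ ENNReal.ofReal (Real.exp (K * t ^ ⌈r / (r - 1)⌉₊)) := by
  set k := ⌈r / (r - 1)⌉₊
  have hfin := hf.2 1 one_pos
  have hone := one_le_expMoment (μ := ν) zero_le_one r f
  set L := Real.log (expMoment ν 1 r f).toReal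
  have hM : 1 ≤ (expMoment ν 1 r f).toReal := by
    have := ENNReal.toReal_mono hfin.ne hone
    simpa using this
  have hL : 0 ≤ L := Real.log_nonneg hM
  have hexp : expMoment ν 1 r f = ENNReal.ofReal (Real.exp L) := by
    rw [Real.exp_log (by linarith), ENNReal.ofReal_toReal hfin.ne]
  refine ⟨1 + L, by linarith, fun t ht => ?_⟩
  have ht0 : 0 ≤ t := by linarith
  calc expMoment ν t 1 f
      ≤ ∫⁻ x, ENNReal.ofReal (Real.exp (t ^ k)) * ENNReal.ofReal (Real.exp (1 * |f x| ^ r)) ∂ν := by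
        rw [expMoment_one]
        refine lintegral_mono fun x => ?_
        rw [← ofReal_exp_add]
        refine ofReal_exp_mono ?_
        have h1 := mul_le_rpow_add_rpow ht0 (abs_nonneg (f x)) hr
        have h2 : t ^ (r / (r - 1)) ≤ t ^ k := by
          rw [← Real.rpow_natCast]
          exact Real.rpow_le_rpow_of_exponent_le ht (Nat.le_ceil _)
        linarith
    _ = ENNReal.ofReal (Real.exp (t ^ k)) * expMoment ν 1 r f :=
        lintegral_const_mul' _ _ ENNReal.ofReal_ne_top
    _ ≤ _ := by
        rw [hexp, ← ofReal_exp_add]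
        refine ofReal_exp_mono ?_
        have := one_le_pow₀ (n := k) ht
        nlinarith

variable {X : Type*} [MeasurableSpace X] {Q : Kernel X X} [IsMarkovKernel Q]
  {μ : Measure X} [IsProbabilityMeasure μ]

theorem expMoment_comp_snd (hμ : Kernel.Invariant Q μ) (k : ℝ) {f : X → ℝ} (hf : Measurable f) :
    expMoment (μ ⊗ₘ Q) k 1 (fun z => f z.2) = expMoment μ k 1 f := by
  rw [expMoment_one, expMoment_one]
  exact (measurePreserving_snd hμ).lintegral_comp
    (f := fun x => ENNReal.ofReal (Real.exp (k * |f x|))) (by fun_prop)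

/-- With `a` the moment of `f` at order `t / β`, the fixed-point equation gives `a ≤ a ^ β * H ^ (1
- β)`. As `a` is finite, this cancels to `a ≤ H`. The bound involves only the payoff, so it is
uniform over perturbations with a common moment bound. -/
theorem expMoment_fixedPoint_le (hμ : Kernel.Invariant Q μ) {h : X × X → ℝ} (hh : Measurable h)
    {β t : ℝ} (hβ₀ : 0 < β) (hβ₁ : β < 1) (ht : 1 ≤ t) {f : X → ℝ} {s : ℝ} (hs : 1 ≤ s)
    (hf : HasAllExpMoments μ s f) (hfix : entropicOp Q h β f =ᵐ[μ] f) :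
    expMoment μ t 1 f ≤ expMoment (μ ⊗ₘ Q) (t / (1 - β)) 1 h := by
  have hβ' : 0 < 1 - β := by linarith
  have htβ : t ≤ t / β := by rw [le_div_iff₀ hβ₀]; nlinarith
  have ht0 : 0 < t / β := by positivity
  have h1 := expMoment_one_entropicOp_le hμ hh hβ₀ hβ₁ (k := t / β)
    (by rw [div_mul_cancel₀ _ hβ₀.ne']; exact ht) hf.1
  rw [expMoment_congr_ae hfix, expMoment_const_mul (by positivity)] at h1
  have e1 : t / β * (β / (1 - β)) = t / (1 - β) := by field_simp
  rw [e1] at h1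
  set a := expMoment μ (t / β) 1 f with ha
  set H := expMoment (μ ⊗ₘ Q) (t / (1 - β)) 1 h
  have ha1 : 1 ≤ a := one_le_expMoment ht0.le _ _
  have hafin : a < ∞ := (hf.mono zero_le_one hs).2 _ ht0
  refine (expMoment_mono_left htβ 1 f).trans ?_
  have h2 : a ^ (1 - β) ≤ H ^ (1 - β) := by
    have h3 : a ^ β * a ^ (1 - β) = a := by
      rw [← ENNReal.rpow_add_of_nonneg _ _ hβ₀.le hβ'.le]; simp
    have h4 : a ^ β * a ^ (1 - β) ≤ a ^ β * H ^ (1 - β) := by rw [h3]; exact h1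
    refine (ENNReal.mul_le_mul_iff_right ?_ ?_).1 h4
    · exact (ENNReal.rpow_pos (by positivity) hafin.ne).ne'
    · exact ENNReal.rpow_ne_top_of_nonneg hβ₀.le hafin.ne
  exact (ENNReal.rpow_le_rpow_iff hβ').1 h2

/-- Uniform Lipschitz stability of the fixed point of the entropic operator with respect to
perturbations `l` of the payoff that are small in the exponential Orlicz norm. -/
theorem exists_orliczNorm_fixedPoint_sub_le (hμ : Kernel.Invariant Q μ) {β r : ℝ} (hβ₀ : 0 < β)
    (hβ₁ : β < 1) (hr : 1 < r) {U : X × X → ℝ} (hU : HasAllExpMoments (μ ⊗ₘ Q) r U) {v : X → ℝ}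
    (hv : HasAllExpMoments μ r v) :
    ∃ C Λ : ℝ, 0 < C ∧ 0 < Λ ∧ ∀ l : X × X → ℝ, Measurable l → expMoment (μ ⊗ₘ Q) Λ 1 l ≤ 2 →
      ∀ w : X → ℝ, HasAllExpMoments μ r w → entropicOp Q (fun z => U z + l z) β w =ᵐ[μ] w →
        orliczNorm μ 1 (w - v)
          ≤ ENNReal.ofReal C * orliczNorm μ 1 (entropicOp Q (fun z => U z + l z) β v - v) := by
  have hβ' : 0 < 1 - β := by linarith
  obtain ⟨K₁, hK₁, hU'⟩ := hU.exists_expMoment_le hr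
  obtain ⟨K₂, hK₂, hv'⟩ := hv.exists_expMoment_le hr
  set k := ⌈r / (r - 1)⌉₊
  set K := max K₁ K₂ with hK
  have hK1 : 1 ≤ K := hK₁.trans (le_max_left _ _)
  have hlim : Tendsto (fun n : ℕ => 4 * K * (16 / (1 - β)) ^ k * ((n : ℝ) ^ k * β ^ n)) atTop
      (𝓝 (4 * K * (16 / (1 - β)) ^ k * 0)) :=
    (tendsto_pow_const_mul_const_pow_of_abs_lt_one k (by rwa [abs_of_pos hβ₀])).const_mul _
  rw [mul_zero] at hlim
  obtain ⟨N, hNsmall, hN⟩ := ((hlim.eventually (ge_mem_nhds (by norm_num : (0 : ℝ) < 1 / 2))).and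
    (eventually_gt_atTop 0)).exists
  have hN1 : (1 : ℝ) ≤ N := by exact_mod_cast hN
  -- The tilts need order `4N` of `f + h`, hence `8N` of each summand. For the fixed point `w` this
  -- needs order `8N / (1 - β) = Λ / 2` of `h`, hence `Λ` of `U` and `l`.
  set Λ : ℝ := 16 * N / (1 - β) with hΛ
  have hΛ16 : 16 * (N : ℝ) ≤ Λ := by rw [hΛ, le_div_iff₀ hβ']; nlinarith
  have hΛ1 : 1 ≤ Λ := by linarith
  set b : ℝ := K * Λ ^ k with hb
  have hb1 : 1 ≤ b := one_le_mul_of_one_le_of_one_le hK1 (one_le_pow₀ hΛ1)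
  have hbN : β ^ N * (4 * b) ≤ 1 / 2 := by
    refine le_trans (le_of_eq ?_) hNsmall
    rw [hb, hΛ, mul_div_right_comm, mul_pow]; ring
  refine ⟨16 * b * N, Λ, by positivity, by linarith, fun l hl hlΛ w hw hfix => ?_⟩
  have hUm := hU.1
  have hvm := hv.1
  have hwm := hw.1
  set h : X × X → ℝ := fun z => U z + l z with hh
  have hhm : Measurable h := by fun_prop
  have hUb : expMoment (μ ⊗ₘ Q) Λ 1 U ≤ ENNReal.ofReal (Real.exp b) :=
    (hU' Λ hΛ1).trans (ofReal_exp_mono (by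
      rw [hb]; exact mul_le_mul_of_nonneg_right (le_max_left _ _) (by positivity)))
  have hvb : expMoment μ Λ 1 v ≤ ENNReal.ofReal (Real.exp b) :=
    (hv' Λ hΛ1).trans (ofReal_exp_mono (by
      rw [hb]; exact mul_le_mul_of_nonneg_right (le_max_right _ _) (by positivity)))
  have hlb : expMoment (μ ⊗ₘ Q) Λ 1 l ≤ ENNReal.ofReal (Real.exp b) := by
    refine hlΛ.trans ?_
    rw [show (2 : ℝ≥0∞) = ENNReal.ofReal 2 by simp]
    exact ENNReal.ofReal_le_ofReal (by linarith [Real.add_one_le_exp b])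
  have hhb : expMoment (μ ⊗ₘ Q) (Λ / 2) 1 h ≤ ENNReal.ofReal (Real.exp b) :=
    expMoment_add_le hUm (by linarith) (by rwa [mul_div_cancel₀ _ two_ne_zero])
      (by rwa [mul_div_cancel₀ _ two_ne_zero])
  have hwb : expMoment μ (8 * N) 1 w ≤ ENNReal.ofReal (Real.exp b) := by
    refine (expMoment_fixedPoint_le hμ hhm hβ₀ hβ₁ (by linarith) hr.le hw hfix).trans ?_
    refine le_trans (le_of_eq ?_) hhb
    congr 1; rw [hΛ]; ring
  have hsum : ∀ f : X → ℝ, Measurable f → expMoment μ (8 * N) 1 f ≤ ENNReal.ofReal (Real.exp b) →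
      expMoment (μ ⊗ₘ Q) (4 * N) 1 (fun z => f z.2 + h z) ≤ ENNReal.ofReal (Real.exp b) := by
    intro f hf hfb
    refine expMoment_add_le (by fun_prop) (by linarith) ?_ ?_
    · rw [expMoment_comp_snd hμ _ hf]
      refine le_trans (le_of_eq ?_) hfb
      congr 1; ring
    · exact (expMoment_mono_left (by linarith) 1 h).trans hhb
  have hwg := hsum w hwm hwb
  have hvg := hsum v hvm ((expMoment_mono_left (by linarith) 1 v).trans hvb)
  set d : X → ℝ := entropicOp Q h β v - v with hd
  have hdm : Measurable d := (measurable_entropicOp hhm β hvm).sub hvm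
  have hfin : ∀ f g : X → ℝ, HasAllExpMoments μ r f → HasAllExpMoments μ r g →
      orliczNorm μ 1 (fun x => f x - g x) < ∞ := by
    intro f g hf hg
    have := (hf.add hr.le (hg.const_mul hr.le (-1))).orliczNorm_lt_top hr.le
    refine lt_of_le_of_lt (le_of_eq ?_) this
    congr 1; ext x; ring
  -- The two signs use different tilts, by `w + h` here and by `v + h` for `h2`; each contributes `8
  -- * b * N`.
  have h1 := orliczNorm_pos_part_sub_le hμ hhm hN hb1 hβ₀ hβ₁ hbN hwm hvm hdm hwg
    (hvg.trans_lt ENNReal.ofReal_lt_top) (hfin w v hw hv) (by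
      filter_upwards [hfix] with x hx
      have : d x = entropicOp Q h β v x - v x := rfl
      linarith [le_abs_self (d x)])
  have h2 := orliczNorm_pos_part_sub_le hμ hhm hN hb1 hβ₀ hβ₁ hbN hvm hwm hdm hvg
    (hwg.trans_lt ENNReal.ofReal_lt_top) (hfin v w hv hw) (by
      filter_upwards [hfix] with x hx
      have : d x = entropicOp Q h β v x - v x := rfl
      linarith [neg_le_abs (d x)])
  calc orliczNorm μ 1 (w - v)
      ≤ orliczNorm μ 1 (fun x => max (w x - v x) 0 + max (v x - w x) 0) := by
        refine orliczNorm_mono zero_le_one (ae_of_all _ fun x => le_trans ?_ (le_abs_self _))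
        rw [Pi.sub_apply]
        exact abs_le'.2 ⟨by linarith [le_max_left (w x - v x) 0, le_max_right (v x - w x) 0],
          by linarith [le_max_right (w x - v x) 0, le_max_left (v x - w x) 0]⟩
    _ ≤ _ := orliczNorm_add_le (by fun_prop)
    _ ≤ _ := add_le_add h1 h2
    _ = _ := by
        rw [← add_mul, ← ENNReal.ofReal_add (by positivity) (by positivity)]
        congr 2; ring

end Stability

/-! ### From the score to the log-likelihood ratio -/

section Score

variable {X : Type*} [MeasurableSpace X] [MeasurableSpace.CountablyGenerated X]
  {Q κ : Kernel X X} [IsMarkovKernel Q] [IsMarkovKernel κ]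
  {Q₀ : Measure X} [IsProbabilityMeasure Q₀]

/-- A small score forces a small log-likelihood ratio, since the likelihood ratio integrates to
one. -/
theorem expMoment_logLikelihoodRatio_le_two (hQκ : EverywhereEquivalent Q κ) {ε : ℝ} (hε₀ : 0 < ε)
    (hε₁ : ε ≤ 1) (h : orliczNorm (Q₀ ⊗ₘ Q) 1 (score Q κ) < ENNReal.ofReal ε) :
    expMoment (Q₀ ⊗ₘ Q) (ε⁻¹ / 2) 1 (logLikelihoodRatio Q κ) ≤ 2 := by
  have hlm : Measurable (logLikelihoodRatio Q κ) := measurable_logLikelihoodRatio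
  set c : X → ℝ := fun x => ∫ y, logLikelihoodRatio Q κ (x, y) ∂(Q x) with hc
  have hcm : Measurable c :=
    (StronglyMeasurable.integral_kernel_prod_right (κ := Q)
      (f := fun x y => logLikelihoodRatio Q κ (x, y)) hlm.stronglyMeasurable).measurable
  have hsm : Measurable (score Q κ) := hlm.sub (hcm.comp measurable_fst)
  have hscore := expMoment_le_two_of_orliczNorm_lt h
  -- Because `exp ℓ` has conditional mean one, `log E^Q[exp η | X_t] = -c`.
  have hlog : ∀ x, |Real.log (∫ y, Real.exp (score Q κ (x, y)) ∂(Q x))| = |c x| := by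
    intro x
    have : ∀ y, Real.exp (score Q κ (x, y))
        = Real.exp (logLikelihoodRatio Q κ (x, y)) * Real.exp (-c x) := fun y => by
      rw [← Real.exp_add]; rfl
    simp_rw [this]
    rw [integral_mul_const, integral_exp_logLikelihoodRatio hQκ, one_mul, Real.log_exp, abs_neg]
  have hcb : expMoment (Q₀ ⊗ₘ Q) ε⁻¹ 1 (fun z => c z.1) ≤ 2 := by
    refine le_trans ?_ hscore
    rw [expMoment_one, expMoment_one, Measure.lintegral_compProd (by fun_prop),
      Measure.lintegral_compProd (by fun_prop)]
    refine lintegral_mono fun x => ?_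
    have h1 := exp_abs_log_integral_exp_le_one (ν := Q x) (g := fun y => score Q κ (x, y))
      ((one_le_inv₀ hε₀).2 hε₁)
    rw [hlog] at h1
    simpa using h1
  -- The log-likelihood ratio is `η + c`, with both terms controlled at order `ε⁻¹`; the sum halves
  -- the order.
  have := expMoment_add_le (ν := Q₀ ⊗ₘ Q) (t := ε⁻¹ / 2) (B := 2) hsm (by positivity)
    (by rwa [mul_div_cancel₀ _ two_ne_zero])
    (by rwa [mul_div_cancel₀ _ two_ne_zero] : expMoment _ _ _ (fun z => c z.1) ≤ 2)
  refine le_trans (le_of_eq ?_) this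
  congr 1; ext z
  simp [score, hc]

end Score

/-! ### Bounds for the worst-case belief distortion -/

section Distortion

theorem distortion_div_distortion {Y : Type*} (u : Y × Y → ℝ) (α β : ℝ) (w v : Y → ℝ) (z : Y × Y) :
    distortion u α β w z / distortion u α β v z
      = Real.exp ((w - v) z.2 + -(β⁻¹ * (w - v) z.1)) := by
  rw [distortion, distortion, ← Real.exp_sub]
  congr 1
  simp only [Pi.sub_apply]; ring

theorem distortion_sub_distortion {Y : Type*} (u : Y × Y → ℝ) (α β : ℝ) (w v : Y → ℝ) :
    distortion u α β w - distortion u α β v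
      = fun z => distortion u α β v z
        * (Real.exp ((w - v) z.2 + -(β⁻¹ * (w - v) z.1)) - 1) := by
  ext z
  rw [← distortion_div_distortion u α, Pi.sub_apply, mul_sub, mul_div_cancel₀, mul_one]
  exact (Real.exp_pos _).ne'

variable {E : Type*} [MeasurableSpace E] {ν : Measure E} [IsProbabilityMeasure ν]

/-- By convexity `exp |t| - 1 ≤ τ (exp (|t| / τ) - 1)`. The explicit factor `τ` carries the rate. -/
theorem abs_exp_sub_one_le_mul_exp {t τ : ℝ} (hτ₀ : 0 < τ) (hτ₁ : τ ≤ 1) :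
    |Real.exp t - 1| ≤ τ * Real.exp (|t| / τ) := by
  have h1 : |Real.exp t - 1| ≤ Real.exp |t| - 1 := by
    rw [abs_le]
    constructor
    · have h2 := Real.add_one_le_exp t
      have h3 := Real.add_one_le_exp |t|
      have h4 := neg_abs_le t
      linarith
    · linarith [Real.exp_le_exp.2 (le_abs_self t)]
  have h2 := convexOn_exp.2 (Set.mem_univ (|t| / τ)) (Set.mem_univ 0) hτ₀.le
    (by linarith : 0 ≤ 1 - τ) (by ring)
  simp only [smul_eq_mul, mul_zero, add_zero, Real.exp_zero, mul_one,
    mul_div_cancel₀ _ hτ₀.ne'] at h2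
  linarith

/-- With `τ = p * c` in `abs_exp_sub_one_le_mul_exp`, the `p`-th power of the exponential factor is
`exp (|G| / c)`, whose integral is at most `2`. -/
theorem eLpNorm_exp_sub_one_le {G : E → ℝ} {p c : ℝ} (hp : 1 ≤ p) (hc : 0 < c) (hpc : p * c ≤ 1)
    (hG : orliczNorm ν 1 G < ENNReal.ofReal c) :
    eLpNorm (fun z => Real.exp (G z) - 1) (ENNReal.ofReal p) ν ≤ ENNReal.ofReal (2 * p * c) := by
  have hp0 : 0 < p := by linarith
  have hmom := expMoment_le_two_of_orliczNorm_lt hG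
  rw [expMoment_one] at hmom
  rw [eLpNorm_eq_lintegral_rpow_enorm_toReal (by simpa using hp0) ENNReal.ofReal_ne_top,
    ENNReal.toReal_ofReal hp0.le]
  have hpt : ∀ z, ‖Real.exp (G z) - 1‖ₑ ^ p
      ≤ ENNReal.ofReal ((p * c) ^ p) * ENNReal.ofReal (Real.exp (c⁻¹ * |G z|)) := by
    intro z
    rw [Real.enorm_eq_ofReal_abs, ENNReal.ofReal_rpow_of_nonneg (abs_nonneg _) hp0.le,
      ← ENNReal.ofReal_mul (by positivity)]
    refine ENNReal.ofReal_le_ofReal ?_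
    calc |Real.exp (G z) - 1| ^ p ≤ (p * c * Real.exp (|G z| / (p * c))) ^ p :=
          Real.rpow_le_rpow (abs_nonneg _) (abs_exp_sub_one_le_mul_exp (by positivity) hpc) hp0.le
      _ = (p * c) ^ p * Real.exp (c⁻¹ * |G z|) := by
          rw [Real.mul_rpow (by positivity) (Real.exp_pos _).le, ← Real.exp_mul]
          congr 2; field_simp
  calc (∫⁻ z, ‖Real.exp (G z) - 1‖ₑ ^ p ∂ν) ^ (1 / p)
      ≤ (ENNReal.ofReal ((p * c) ^ p) * 2) ^ (1 / p) := by
        gcongr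
        calc _ ≤ _ := lintegral_mono hpt
          _ = _ := lintegral_const_mul' _ _ ENNReal.ofReal_ne_top
          _ ≤ _ := by gcongr
    _ = ENNReal.ofReal (p * c) * 2 ^ (1 / p) := by
        rw [ENNReal.mul_rpow_of_nonneg _ _ (by positivity),
          ENNReal.ofReal_rpow_of_nonneg (by positivity) (by positivity), ← Real.rpow_mul (by positivity),
          mul_one_div_cancel hp0.ne', Real.rpow_one]
    _ ≤ ENNReal.ofReal (p * c) * 2 := by
        gcongr
        calc (2 : ℝ≥0∞) ^ (1 / p) ≤ 2 ^ (1 : ℝ) :=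
              ENNReal.rpow_le_rpow_of_exponent_le one_le_two ((div_le_one hp0).2 hp)
          _ = 2 := ENNReal.rpow_one 2
    _ = _ := by
        rw [show (2 : ℝ≥0∞) = ENNReal.ofReal 2 by simp, ← ENNReal.ofReal_mul (by positivity)]
        congr 1; ring

theorem HasAllExpMoments.eLpNorm_exp_lt_top {V : E → ℝ} {s : ℝ} (hs : 1 ≤ s)
    (hV : HasAllExpMoments ν s V) {p : ℝ} (hp : 0 < p) :
    eLpNorm (fun z => Real.exp (V z)) (ENNReal.ofReal p) ν < ∞ := by
  rw [eLpNorm_eq_lintegral_rpow_enorm_toReal (by simpa using hp) ENNReal.ofReal_ne_top,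
    ENNReal.toReal_ofReal hp.le]
  refine ENNReal.rpow_lt_top_of_nonneg (by positivity) (ne_of_lt ?_)
  refine lt_of_le_of_lt (lintegral_mono fun z => ?_) ((hV.mono zero_le_one hs).2 p hp)
  rw [Real.enorm_eq_ofReal_abs, abs_of_pos (Real.exp_pos _), ofReal_exp_rpow, Real.rpow_one]
  refine ofReal_exp_mono ?_
  nlinarith [le_abs_self (V z)]

theorem eLpNorm_mul_le_two_mul {μ : Measure E} {f g : E → ℝ} (hf : Measurable f) (hg : Measurable g) {p : ℝ}
    (hp : 0 < p) :
    eLpNorm (fun z => f z * g z) (ENNReal.ofReal p) μ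
      ≤ eLpNorm f (ENNReal.ofReal (2 * p)) μ * eLpNorm g (ENNReal.ofReal (2 * p)) μ := by
  have : ENNReal.HolderTriple (ENNReal.ofReal (2 * p)) (ENNReal.ofReal (2 * p))
      (ENNReal.ofReal p) := ⟨by
    rw [← ENNReal.ofReal_inv_of_pos (by positivity), ← ENNReal.ofReal_inv_of_pos hp,
      ← ENNReal.ofReal_add (by positivity) (by positivity)]
    congr 1; field_simp; norm_num⟩
  have h := eLpNorm_smul_le_mul_eLpNorm (𝕜 := ℝ) (E := ℝ) (μ := μ) (p := ENNReal.ofReal (2 * p))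
    (q := ENNReal.ofReal (2 * p)) (r := ENNReal.ofReal p) (f := g) (φ := f)
    hg.aestronglyMeasurable hf.aestronglyMeasurable
  exact h

variable {X : Type*} [MeasurableSpace X] {Q : Kernel X X} [IsMarkovKernel Q]
  {μ : Measure X} [IsProbabilityMeasure μ]

theorem orliczNorm_comp_measurePreserving {E' : Type*} [MeasurableSpace E']
    {μ : Measure E} {ν' : Measure E'} {F : E → ℝ} {φ : E' → E} (hφ : MeasurePreserving φ ν' μ) (hF : Measurable F) :
    orliczNorm ν' 1 (fun z => F (φ z)) = orliczNorm μ 1 F := by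
  have : ∀ c, orliczModular ν' 1 (fun z => F (φ z)) c = orliczModular μ 1 F c := fun c =>
    hφ.lintegral_comp (f := fun x => ENNReal.ofReal (Real.exp ((|F x| / c) ^ (1 : ℝ)) - 1))
      (by fun_prop)
  simp only [orliczNorm, this]

theorem orliczNorm_shift_le (hμ : Kernel.Invariant Q μ) {β : ℝ} (hβ₀ : 0 < β) {f : X → ℝ}
    (hf : Measurable f) :
    orliczNorm (μ ⊗ₘ Q) 1 (fun z => f z.2 + -(β⁻¹ * f z.1))
      ≤ ENNReal.ofReal (1 + β⁻¹) * orliczNorm μ 1 f := by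
  calc _ ≤ orliczNorm (μ ⊗ₘ Q) 1 (fun z => f z.2)
        + orliczNorm (μ ⊗ₘ Q) 1 (fun z => -(β⁻¹ * f z.1)) := orliczNorm_add_le (by fun_prop)
    _ ≤ orliczNorm (μ ⊗ₘ Q) 1 (fun z => f z.2)
        + orliczNorm (μ ⊗ₘ Q) 1 (fun z => β⁻¹ * f z.1) := by
        gcongr
        exact orliczNorm_mono zero_le_one (ae_of_all _ fun z => by rw [abs_neg])
    _ ≤ orliczNorm μ 1 f + ENNReal.ofReal β⁻¹ * orliczNorm μ 1 f := by
        refine add_le_add (orliczNorm_comp_measurePreserving (measurePreserving_snd hμ) hf).le ?_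
        refine (orliczNorm_const_mul_le (by positivity) _).trans ?_
        rw [orliczNorm_comp_measurePreserving (φ := Prod.fst) measurePreserving_fst hf]
    _ = _ := by
        rw [ENNReal.ofReal_add zero_le_one (by positivity), ENNReal.ofReal_one, add_mul, one_mul]

theorem eLpNorm_distortion_ratio_le (hμ : Kernel.Invariant Q μ) (u : X × X → ℝ) (α : ℝ) {β : ℝ}
    (hβ₀ : 0 < β) {w v : X → ℝ} (hw : Measurable w) (hv : Measurable v) {p c : ℝ} (hp : 1 ≤ p)
    (hc : 0 < c) (hpc : p * ((1 + β⁻¹) * c) ≤ 1)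
    (h : orliczNorm μ 1 (w - v) < ENNReal.ofReal c) :
    eLpNorm (fun z => distortion u α β w z / distortion u α β v z - 1) (ENNReal.ofReal p) (μ ⊗ₘ Q)
      ≤ ENNReal.ofReal (2 * p * ((1 + β⁻¹) * c)) := by
  simp_rw [distortion_div_distortion]
  refine eLpNorm_exp_sub_one_le hp (by positivity) hpc ?_
  refine (orliczNorm_shift_le hμ hβ₀ (hw.sub hv)).trans_lt ?_
  rw [ENNReal.ofReal_mul (by positivity)]
  exact ENNReal.mul_lt_mul_right (by simp; positivity) ENNReal.ofReal_ne_top h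

/-- The difference is the benchmark distortion times the ratio minus one; Hölder puts both factors
in `L^{2p}`. -/
theorem eLpNorm_distortion_sub_le (hμ : Kernel.Invariant Q μ) {u : X × X → ℝ} (hu : Measurable u)
    (α : ℝ) {β : ℝ}
    (hβ₀ : 0 < β) {w v : X → ℝ} (hw : Measurable w) (hv : Measurable v) {p c : ℝ} (hp : 1 ≤ p)
    (hc : 0 < c) (hpc : 2 * p * ((1 + β⁻¹) * c) ≤ 1)
    (h : orliczNorm μ 1 (w - v) < ENNReal.ofReal c) :
    eLpNorm (distortion u α β w - distortion u α β v) (ENNReal.ofReal p) (μ ⊗ₘ Q)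
      ≤ eLpNorm (distortion u α β v) (ENNReal.ofReal (2 * p)) (μ ⊗ₘ Q)
        * ENNReal.ofReal (2 * (2 * p) * ((1 + β⁻¹) * c)) := by
  have h1 := eLpNorm_distortion_ratio_le hμ u α hβ₀ hw hv (by linarith) hc hpc h
  simp_rw [distortion_div_distortion] at h1
  rw [distortion_sub_distortion]
  have hvm : Measurable (distortion u α β v) := by unfold distortion; fun_prop
  refine (eLpNorm_mul_le_two_mul hvm ?_ (by linarith)).trans (by gcongr)
  have := hw.sub hv
  fun_prop

end Distortion

/-! ### Posterior contraction -/

/-- Once `S n` misses `A n`, its mass is at most that of the complement of `A n`. Only monotonicity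
is applied to `S n`, so it need not be measurable. -/
theorem tendstoInMeasure_real_of_eventually_subset_compl {Ω Θ : Type*} [MeasurableSpace Ω]
    {P : Measure Ω} [MeasurableSpace Θ] {post : ℕ → Ω → Measure Θ}
    (hpost : ∀ n ω, IsProbabilityMeasure (post n ω)) {A S : ℕ → Set Θ}
    (hA : ∀ n, MeasurableSet (A n))
    (hpostA : TendstoInMeasure P (fun n ω => (post n ω).real (A n)) atTop (fun _ => (1 : ℝ)))
    (hS : ∀ᶠ n in atTop, ∀ κ ∈ A n, κ ∉ S n) :
    TendstoInMeasure P (fun n ω => (post n ω).real (S n)) atTop (fun _ => (0 : ℝ)) := by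
  intro ε hε
  refine tendsto_of_tendsto_of_tendsto_of_le_of_le' tendsto_const_nhds (hpostA ε hε)
    (Eventually.of_forall fun _ => zero_le) ?_
  filter_upwards [hS] with n hn
  refine measure_mono fun ω hω => le_trans (show ε ≤ edist _ _ from hω) ?_
  have := hpost n ω
  have h1 : (post n ω).real (S n) ≤ 1 - (post n ω).real (A n) := by
    rw [← probReal_compl_eq_one_sub (hA n)]
    exact measureReal_mono fun κ hκ hκA => hn κ hκA hκ
  rw [edist_dist, edist_dist, Real.dist_eq, Real.dist_eq, sub_zero,
    abs_of_nonneg measureReal_nonneg, abs_sub_comm]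
  exact ENNReal.ofReal_le_ofReal (h1.trans (le_abs_self _))

section Rate

variable {X : Type*} [MeasurableSpace X] [MeasurableSpace.CountablyGenerated X]

/-- The rate of `𝕋(κ) v - v` carries over to `v(κ) - v`, uniformly over regular models `κ` whose
scores vanish uniformly. -/
theorem exists_eventually_orliczNorm_valueFunction_sub_le
    (Q : Kernel X X) [IsMarkovKernel Q]
    (Q₀ : Measure X) [IsProbabilityMeasure Q₀] (hQ₀ : Kernel.Invariant Q Q₀)
    {α β r : ℝ} (hβ₀ : 0 < β) (hβ₁ : β < 1) (hr : 1 < r)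
    {u : X × X → ℝ} (hu : MemOrliczHeart (Q₀ ⊗ₘ Q) r u)
    {A : ℕ → Set (MarkovKernels X)} {M : ℝ}
    (hAM2 : ∀ n, ∀ κ ∈ A n, SatisfiesAM2 Q₀ Q u α β r M κ.1)
    (hη : Tendsto (fun n => ⨆ κ ∈ A n, orliczNorm (Q₀ ⊗ₘ Q) 1 (score Q κ.1)) atTop (𝓝 0))
    {a : ℕ → ℝ} (ha_pos : ∀ n, 0 < a n) {s : ℝ} (hs₁ : 1 ≤ s)
    (hT : ∃ K : ℝ, ∀ᶠ n in atTop,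
      ⨆ κ ∈ A n, orliczNorm Q₀ s (valueOp u α β κ.1 (valueFunction Q₀ u α β r Q)
          - valueFunction Q₀ u α β r Q) ≤ ENNReal.ofReal (K * a n)) :
    ∃ K : ℝ, 0 < K ∧ ∀ᶠ n in atTop, ∀ κ ∈ A n,
      orliczNorm Q₀ 1 (valueFunction Q₀ u α β r κ.1 - valueFunction Q₀ u α β r Q)
        < ENNReal.ofReal (K * a n) := by
  have hU := ((memOrliczHeart_iff hr.le).1 hu).const_mul hr.le α
  have hv := (memOrliczHeart_iff hr.le).1
    (isUniqueValueFunction_benchmark (α := α) hQ₀ hβ₀ hβ₁ hr hu).1.1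
  set v := valueFunction Q₀ u α β r Q
  obtain ⟨C, Λ, hC, hΛ, hmain⟩ := exists_orliczNorm_fixedPoint_sub_le hQ₀ hβ₀ hβ₁ hr hU hv
  obtain ⟨K, hK⟩ := hT
  set ε := min 1 (1 / (2 * Λ)) with hε
  have hε0 : 0 < ε := lt_min one_pos (by positivity)
  have hεΛ : Λ ≤ ε⁻¹ / 2 := by
    have h1 : ε ≤ 1 / (2 * Λ) := min_le_right _ _
    have h2 := inv_anti₀ hε0 h1
    rw [one_div, inv_inv] at h2
    linarith
  -- The `3` is the cost of passing from `φ_s` to `φ_1`, and `+ 1` makes the inequality strict.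
  refine ⟨3 * C * (|K| + 1), by positivity, ?_⟩
  filter_upwards [hK, hη.eventually (gt_mem_nhds (by simpa using hε0 : 0 < ENNReal.ofReal ε))]
    with n hKn hηn κ hκ
  have : IsMarkovKernel κ.1 := κ.2
  have hAM := hAM2 n κ hκ
  have hop := valueOp_eq_entropicOp hAM.1 u α β
  have hscore : orliczNorm (Q₀ ⊗ₘ Q) 1 (score Q κ.1) < ENNReal.ofReal ε :=
    (le_iSup₂ (f := fun κ (_ : κ ∈ A n) => orliczNorm (Q₀ ⊗ₘ Q) 1 (score Q κ.1)) κ hκ).trans_lt hηn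
  have hTv := (le_iSup₂ (f := fun κ (_ : κ ∈ A n) => orliczNorm Q₀ s
    (valueOp u α β κ.1 v - v)) κ hκ).trans hKn
  have hl := (expMoment_mono_left hεΛ 1 _).trans
    (expMoment_logLikelihoodRatio_le_two hAM.1 hε0 (min_le_left _ _) hscore)
  obtain ⟨hw, hfix⟩ := (isUniqueValueFunction_of_satisfiesAM2 hQ₀ hβ₀ hβ₁ hr hu hAM).1
  have hlm : Measurable (logLikelihoodRatio Q κ.1) := measurable_logLikelihoodRatio
  rw [hop] at hfix hTv
  have hdm : Measurable (entropicOp Q (fun z => α * u z + logLikelihoodRatio Q κ.1 z) β v - v) :=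
    (measurable_entropicOp (hU.1.add hlm) β hv.1).sub hv.1
  have hle := hmain (logLikelihoodRatio Q κ.1) hlm hl _ ((memOrliczHeart_iff hr.le).1 hw) hfix
  have han := ha_pos n
  calc _ ≤ _ := hle
    _ ≤ ENNReal.ofReal C * (ENNReal.ofReal 3 * ENNReal.ofReal (K * a n)) := by
        gcongr
        exact (orliczNorm_one_le_three_mul hs₁ hdm).trans (by gcongr)
    _ ≤ ENNReal.ofReal C * (ENNReal.ofReal 3 * ENNReal.ofReal (|K| * a n)) := by
        gcongr; exact le_abs_self K
    _ = ENNReal.ofReal (3 * C * |K| * a n) := by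
        rw [← ENNReal.ofReal_mul (by norm_num), ← ENNReal.ofReal_mul hC.le]
        congr 1; ring
    _ < _ := by
        rw [ENNReal.ofReal_lt_ofReal_iff (by positivity)]
        have : 0 < 3 * C * a n := by positivity
        linarith

end Rate

end RobustValue

/-! ### The main theorem. -/

theorem proposition5p2
    {X : Type*} [MeasurableSpace X] [MeasurableSpace.CountablyGenerated X]
    -- the benchmark model and its stationary distribution
    (Q : Kernel X X) [IsMarkovKernel Q]
    (Q₀ : Measure X) [IsProbabilityMeasure Q₀] (hQ₀ : Kernel.Invariant Q Q₀)
    -- preference parameters and utility growth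
    (α β r : ℝ) (hα : α < 0) (hβ₀ : 0 < β) (hβ₁ : β < 1) (hr : 1 < r)
    (u : X × X → ℝ) (hu : RobustValue.MemOrliczHeart (Q₀ ⊗ₘ Q) r u)
    -- the sampling space and the posteriors
    {Ω : Type*} [MeasurableSpace Ω] (P : Measure Ω) [IsProbabilityMeasure P]
    [MeasurableSpace (RobustValue.MarkovKernels X)]
    (post : ℕ → Ω → Measure (RobustValue.MarkovKernels X))
    (hpost : ∀ n ω, IsProbabilityMeasure (post n ω))
    -- the sets on which the posteriors concentrate
    (A : ℕ → Set (RobustValue.MarkovKernels X)) (hA : ∀ n, MeasurableSet (A n))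
    (hpostA : TendstoInMeasure P (fun n ω => (post n ω).real (A n)) atTop (fun _ => (1 : ℝ)))
    (M : ℝ) (hAM2 : ∀ n, ∀ κ ∈ A n, RobustValue.SatisfiesAM2 Q₀ Q u α β r M κ.1)
    (hη : Tendsto
      (fun n => ⨆ κ ∈ A n, RobustValue.orliczNorm (Q₀ ⊗ₘ Q) 1 (RobustValue.score Q κ.1))
      atTop (𝓝 0))
    -- the rate
    (a : ℕ → ℝ) (ha_pos : ∀ n, 0 < a n) (ha : Tendsto a atTop (𝓝 0))
    (s : ℝ) (hs₁ : 1 ≤ s) (hsr : s ≤ r)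
    (hT : ∃ K : ℝ, ∀ᶠ n in atTop,
      ⨆ κ ∈ A n, RobustValue.orliczNorm Q₀ s
        (RobustValue.valueOp u α β κ.1 (RobustValue.valueFunction Q₀ u α β r Q)
          - RobustValue.valueFunction Q₀ u α β r Q)
      ≤ ENNReal.ofReal (K * a n)) :
    -- the value functions are well defined under `Q` and under every model in `A n`
    RobustValue.IsUniqueValueFunction Q₀ u α β r Q (RobustValue.valueFunction Q₀ u α β r Q) ∧
    (∀ n, ∀ κ ∈ A n, RobustValue.IsUniqueValueFunction Q₀ u α β r κ.1
      (RobustValue.valueFunction Q₀ u α β r κ.1)) ∧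
    -- posterior contraction
    ∀ C : ℕ → ℝ, (∀ n, 0 < C n) → Tendsto C atTop atTop →
      TendstoInMeasure P
        (fun n ω => (post n ω).real {κ | ENNReal.ofReal (C n * a n) <
          RobustValue.orliczNorm Q₀ 1
            (RobustValue.valueFunction Q₀ u α β r κ.1 - RobustValue.valueFunction Q₀ u α β r Q)})
        atTop (fun _ => (0 : ℝ)) ∧
      ∀ p : ℝ≥0∞, 1 < p → p < ∞ →
        TendstoInMeasure P
          (fun n ω => (post n ω).real {κ | ENNReal.ofReal (C n * a n) <
            eLpNorm
              (RobustValue.distortion u α β (RobustValue.valueFunction Q₀ u α β r κ.1)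
                - RobustValue.distortion u α β (RobustValue.valueFunction Q₀ u α β r Q))
              p (Q₀ ⊗ₘ Q)})
          atTop (fun _ => (0 : ℝ)) ∧
        TendstoInMeasure P
          (fun n ω => (post n ω).real {κ | ENNReal.ofReal (C n * a n) <
            eLpNorm
              (fun z =>
                RobustValue.distortion u α β (RobustValue.valueFunction Q₀ u α β r κ.1) z
                  / RobustValue.distortion u α β (RobustValue.valueFunction Q₀ u α β r Q) z - 1)
              p (Q₀ ⊗ₘ Q)})
          atTop (fun _ => (0 : ℝ)) := by
  have hQ := RobustValue.isUniqueValueFunction_benchmark (α := α) hQ₀ hβ₀ hβ₁ hr hu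
  have hA' : ∀ n, ∀ κ ∈ A n, RobustValue.IsUniqueValueFunction Q₀ u α β r κ.1
      (RobustValue.valueFunction Q₀ u α β r κ.1) := fun n κ hκ => by
    have : IsMarkovKernel κ.1 := κ.2
    exact RobustValue.isUniqueValueFunction_of_satisfiesAM2 hQ₀ hβ₀ hβ₁ hr hu (hAM2 n κ hκ)
  refine ⟨hQ, hA', fun C _ hClim => ?_⟩
  obtain ⟨K, hK, hrate⟩ := RobustValue.exists_eventually_orliczNorm_valueFunction_sub_le
    Q Q₀ hQ₀ hβ₀ hβ₁ hr hu hAM2 hη ha_pos hs₁ hT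
  set v := RobustValue.valueFunction Q₀ u α β r Q
  have hvall := (RobustValue.memOrliczHeart_iff hr.le).1 hQ.1.1
  have huall := (RobustValue.memOrliczHeart_iff hr.le).1 hu
  have hvm := hvall.1
  have hβi : 0 < 1 + β⁻¹ := by positivity
  have hwm : ∀ n, ∀ κ ∈ A n, Measurable (RobustValue.valueFunction Q₀ u α β r κ.1) :=
    fun n κ hκ => (hA' n κ hκ).1.1.1.1
  -- an `O(a n)` bound on `A n` excludes the event that `C n * a n` is exceeded
  have hcontr : ∀ (F : RobustValue.MarkovKernels X → ℝ≥0∞) (B : ℝ),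
      (∀ᶠ n in atTop, ∀ κ ∈ A n, F κ ≤ ENNReal.ofReal (B * a n)) →
      TendstoInMeasure P (fun n ω => (post n ω).real {κ | ENNReal.ofReal (C n * a n) < F κ}) atTop
        (fun _ => (0 : ℝ)) := by
    intro F B hB
    refine RobustValue.tendstoInMeasure_real_of_eventually_subset_compl hpost hA hpostA ?_
    filter_upwards [hB, hClim.eventually_ge_atTop B] with n hn hCn κ hκ
    exact not_lt.2 ((hn κ hκ).trans (ENNReal.ofReal_le_ofReal
      (mul_le_mul_of_nonneg_right hCn (ha_pos n).le)))
  -- As `a n → 0`, the smallness conditions of the distortion bounds hold eventually.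
  have hsmall : ∀ q : ℝ, ∀ᶠ n in atTop, q * ((1 + β⁻¹) * (K * a n)) ≤ 1 := by
    intro q
    have h0 : Tendsto (fun n => q * ((1 + β⁻¹) * (K * a n))) atTop (𝓝 (q * ((1 + β⁻¹) * (K * 0)))) :=
      ((ha.const_mul K).const_mul _).const_mul q
    simp only [mul_zero] at h0
    exact h0.eventually (ge_mem_nhds one_pos)
  refine ⟨hcontr _ K (hrate.mono fun n hn κ hκ => (hn κ hκ).le), fun p hp1 hp => ?_⟩
  obtain ⟨q, hq1, rfl⟩ : ∃ q : ℝ, 1 ≤ q ∧ p = ENNReal.ofReal q := by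
    refine ⟨p.toReal, ?_, (ENNReal.ofReal_toReal hp.ne).symm⟩
    simpa using ENNReal.toReal_mono hp.ne hp1.le
  constructor
  -- The exponent of the benchmark distortion has all exponential moments, so `m_v(Q)` lies in
  -- `L^{2q}` and its norm enters only the constant.
  · have hfin : eLpNorm (RobustValue.distortion u α β v) (ENNReal.ofReal (2 * q)) (Q₀ ⊗ₘ Q) < ∞ := by
      have hV := ((hvall.comp_snd hQ₀).add hr.le (huall.const_mul hr.le α)).add hr.le
        ((hvall.comp_fst (Q := Q)).const_mul hr.le (-β⁻¹))
      refine lt_of_le_of_lt (le_of_eq ?_) (hV.eLpNorm_exp_lt_top hr.le (by linarith : 0 < 2 * q))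
      congr 1; ext z
      rw [RobustValue.distortion]; congr 1; ring
    set m := eLpNorm (RobustValue.distortion u α β v) (ENNReal.ofReal (2 * q)) (Q₀ ⊗ₘ Q) with hm
    refine hcontr _ (m.toReal * (2 * (2 * q) * ((1 + β⁻¹) * K))) ?_
    filter_upwards [hrate, hsmall (2 * q)] with n hn hsn κ hκ
    refine (RobustValue.eLpNorm_distortion_sub_le hQ₀ huall.1 α hβ₀ (hwm n κ hκ) hvm hq1
      (mul_pos hK (ha_pos n)) hsn (hn κ hκ)).trans (le_of_eq ?_)
    rw [← hm, ← ENNReal.ofReal_toReal hfin.ne, ← ENNReal.ofReal_mul ENNReal.toReal_nonneg,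
      ENNReal.toReal_ofReal ENNReal.toReal_nonneg]
    congr 1; ring
  · refine hcontr _ (2 * q * ((1 + β⁻¹) * K)) ?_
    filter_upwards [hrate, hsmall q] with n hn hsn κ hκ
    refine (RobustValue.eLpNorm_distortion_ratio_le hQ₀ u α hβ₀ (hwm n κ hκ) hvm hq1
      (mul_pos hK (ha_pos n)) hsn (hn κ hκ)).trans (le_of_eq ?_)
    congr 1; ring
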